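/- Let $R$ be a commutative ring with unit, $n\ge 0$ an integer and $X=\{x_1<\dots<x_n\}$. **The module $\mathrm{Lie}_2(n)$.** Two Lie brackets $[\cdot,\cdot]$, $\langle\cdot,\cdot\rangle$ on an $R$-module (bilinear, antisymmetric, satisfying the Jacobi identity) are compatible if $[x,\langle y,z\rangle]+[y,\langle z,x\rangle]+[z,\langle x,y\rangle]+\langle x,[y,z]\rangle+\langle y,[z,x]\rangle+\langle z,[x,y]\rangle=0$ for all $x,y,z$. $\mathrm{Lie}_2(n)$ is the multilinear part of the free $R$-algebra on $X$ with two compatible Lie brackets, i.e. the span of the monomials containing each $x_i$ exactly once. Such monomials are identified with the plane binary trees with leaves labelled bijectively by $X$ and each internal vertex coloured red (for $[\cdot,\cdot]$) or blue (for $\langle\cdot,\cdot\rangle$); let $\mathcal{BT}_n$ be the set of these trees. **The module $\mathrm{Eil}_2(n)$.** Let $\Gamma_n$ be the free $R$-module on all finite oriented graphs with vertex set $X$ and edges coloured red or blue (multiple edges allowed, loops not allowed, connectedness not required). Let $I_n\subset\Gamma_n$ be generated by: (a) $G_1+G_2$, where $G_2$ is $G_1$ with the orientation of one edge reversed; (b)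 $G_1+G_2+G_3$, where the $G_t$ agree outside two edges of the same colour, which are $i\to j\to k$, $j\to k\to i$, $k\to i\to j$ respectively, for distinct $i,j,k$; (c) the sum of the six graphs which agree outside two edges, which are $i\to j\to k$, $j\to k\to i$ or $k\to i\to j$, the first one red and the second one blue or the first one blue and the second one red; (d) graphs with more than one edge between some two vertices; (e) disconnected graphs. (The empty graph, for $n=0$, counts as disconnected.) Put $\mathrm{Eil}_2(n)=\Gamma_n/I_n$. **The pairing.** For a graph $G$ as above and $T\in\mathcal{BT}_n$, send each edge $i\to j$ of $G$ to the nadir of the simple path from leaf $i$ to leaf $j$ in $T$, that is, the vertex of this path closest to the root. If this is a colour-preserving bijection from the edges of $G$ to the internal vertices of $T$, put $\langle\!\langle G,T\rangle\!\rangle=(-1)^N$, where $N$ is the number of edges whose path travels counterclockwise at its nadir (from the right child of the nadir to its left child); otherwise put $\langle\!\langle G,T\rangle\!\rangle=0$. **Trees.** Let $\overline{\mathcal G}_n$ be the set of two-coloured (unoriented) trees on $X$ in which there are no $i<j<k$ such that $\{i,k\},\{j,k\}$ are both red, or $\{i,j\},\{i,k\}$ are both blue, or $\{i,j\}$ is red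 and $\{j,k\}$ is blue. These are exactly the rooted trees on $X$ with each edge coloured red if the parent is smaller than the child and blue if it is larger; in this way every $G\in\overline{\mathcal G}_n$ has a root. The same definitions apply to every subset of $X$. Let $o_G$ be the graph $G$ with red edges oriented from the smaller to the larger vertex and blue edges from the larger to the smaller one. Define the monomial $b_G$ recursively: if $G$ is a single vertex $r$, then $b_G=r$; otherwise let $r$ be the root; if there are red edges at $r$, let $G'$ be the subtree of the smallest vertex joined to $r$ by a red edge and $b_G=[b_{G\setminus G'},b_{G'}]$; if all edges at $r$ are blue, let $G'$ be the subtree of the largest vertex joined to $r$ and $b_G=\langle b_{G'},b_{G\setminus G'}\rangle$. Put $\mathcal B_n(X)=\{b_G\}$ and $\mathcal O_n(X)=\{o_G\}$ for $G\in\overline{\mathcal G}_n$. **The relation $\le_{\mathrm{op}}$.** For a non-root vertex $y$ of $G$ let $e(y)$ be the edge from $y$ to its parent, and let $G(y)$, $\tilde G(y)$ be the components of $G$ minus $e(y)$ containing $y$ and the root, respectively. For $G\ne H$ write $G\to_{\mathrm{op}}H$ if either $H$ is obtained, for some non-root vertex $y$ of $G$, by joining the roots of $\tilde G(y)$ and $G(y)$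 by an edge of the colour of $e(y)$; or, recursively, $H$ is obtained, for some child $x$ of the root of $G$ and some $H'$ with $G(x)\to_{\mathrm{op}}H'$, by joining the roots of $\tilde G(x)$ and $H'$ by an edge of the colour of $e(x)$. Let $\le_{\mathrm{op}}$ be the reflexive transitive closure of $\to_{\mathrm{op}}$ on $\overline{\mathcal G}_n$. **Theorem.** (1) There is a unique bilinear form $\mathrm{Lie}_2(n)\times\mathrm{Eil}_2(n)\to R$ whose value at the classes of $T\in\mathcal{BT}_n$ and of a graph $G$ is $\langle\!\langle G,T\rangle\!\rangle$. It is a perfect pairing: it induces isomorphisms $\mathrm{Lie}_2(n)\cong\mathrm{Hom}_R(\mathrm{Eil}_2(n),R)$ and $\mathrm{Eil}_2(n)\cong\mathrm{Hom}_R(\mathrm{Lie}_2(n),R)$. (2) $\le_{\mathrm{op}}$ is a partial order on $\overline{\mathcal G}_n$, each $b_G$ with $G\in\overline{\mathcal G}_n$ lies in $\mathcal{BT}_n$, and for every linear extension $\le$ of $\le_{\mathrm{op}}$ the matrix $\big(\langle\!\langle o_G,b_H\rangle\!\rangle\big)_{G,H\in\overline{\mathcal G}_n}$, with rows and columns ordered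 by $\le$, is upper triangular, with all diagonal entries equal to $1$ or $-1$. -/

import Mathlib

namespace TwoBracket

/-- The two colours. Red corresponds to the bracket `[·,·]`, blue to the bracket `⟨·,·⟩`. -/
inductive Color
  | red
  | blue
  deriving DecidableEq

instance : Fintype Color where
  elems := {.red, .blue}
  complete := fun c => by cases c <;> simp

/-! ## Two-coloured binary trees, i.e. bracket monomials -/

/-- Plane binary trees with coloured internal vertices and leaves labelled in `X`. Equivalently,
monomials in letters of `X` formed with two binary brackets. -/
inductive BTree (X : Type*)
  | leaf (x : X) : BTree X
  | node (c : Color) (l r : BTree X) : BTree X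

namespace BTree

variable {X : Type*}

/-- The labels of the leaves, from left to right. -/
def leaves : BTree X → List X
  | leaf x => [x]
  | node _ l r => l.leaves ++ r.leaves

/-- Every letter of the alphabet labels exactly one leaf. -/
def IsMultilinear (T : BTree X) : Prop :=
  T.leaves.Nodup ∧ ∀ x, x ∈ T.leaves

/-- A vertex of a tree is given by its address: the list of turns (`false` for left, `true` for
right) which lead to it from the root, which has address `[]`. `T.colorAt v` is the colour of the
vertex `v` if this is an internal vertex of `T`, and `none` otherwise. -/
def colorAt : BTree X → List Bool → Option Color
  | leaf _, _ => none
  | node c _ _, [] => some c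
  | node _ l _, false :: v => l.colorAt v
  | node _ _ r, true :: v => r.colorAt v

/-- The set of internal vertices. -/
def internal (T : BTree X) : Set (List Bool) :=
  {v | T.colorAt v ≠ none}

variable [DecidableEq X]

/-- The vertices on the way from the leaf labelled `i` up to the root (both included). -/
def upPath : BTree X → X → List (List Bool)
  | leaf _, _ => [[]]
  | node _ l r, i =>
    if i ∈ l.leaves then (l.upPath i).map (false :: ·) ++ [[]]
    else (r.upPath i).map (true :: ·) ++ [[]]

/-- The list of vertices on the simple path from the leaf labelled `i` to the leaf labelled `j`. -/
def path : BTree X → X → X → List (List Bool)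
  | leaf _, _, _ => [[]]
  | node _ l r, i, j =>
    if i ∈ l.leaves then
      if j ∈ l.leaves then (l.path i j).map (false :: ·)
      else (l.upPath i).map (false :: ·) ++ [[]] ++ (r.upPath j).reverse.map (true :: ·)
    else
      if j ∈ l.leaves then
        (r.upPath i).map (true :: ·) ++ [[]] ++ (l.upPath j).reverse.map (false :: ·)
      else (r.path i j).map (true :: ·)

/-- The nadir of the path from `i` to `j`: the vertex on the path which is closest to the root.
(The path is never empty, so the default value is irrelevant.) -/
def nadir (T : BTree X) (i j : X) : List Bool :=
  ((T.path i j).argmin List.length).getD []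

/-- The path from `i` to `j` travels counterclockwise at its nadir `v`: it arrives at `v` from the
right child of `v` and leaves to the left child of `v` (trees are drawn with the root on top). -/
def Counterclockwise (T : BTree X) (i j : X) : Prop :=
  [T.nadir i j ++ [true], T.nadir i j, T.nadir i j ++ [false]] <:+: T.path i j

end BTree

/-- Two-coloured binary trees whose leaves are labelled bijectively by `x_1 < ⋯ < x_n`. -/
abbrev BT (n : ℕ) : Type := {T : BTree (Fin n) // T.IsMultilinear}

/-! ## The free algebra with two compatible Lie brackets and its multilinear part -/

section Lie

variable (R : Type*) [CommRing R] (X : Type*)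

/-- The free module on all bracket monomials. -/
abbrev FreeMag : Type _ := BTree X →₀ R

variable {R X}

/-- The bilinear extension of the bracket of colour `c` from monomials. -/
noncomputable def br (c : Color) (x y : FreeMag R X) : FreeMag R X :=
  x.sum fun s a => y.sum fun t b => Finsupp.single (BTree.node c s t) (a * b)

variable (R X)

/-- `I` is closed under bracketing with arbitrary elements and contains all instances of the
antisymmetry and Jacobi identities of both brackets and of the mixed Jacobi identity. -/
structure IsCompatibleIdeal (I : Submodule R (FreeMag R X)) : Prop where
  br_left : ∀ c a x, x ∈ I → br c a x ∈ I
  br_right : ∀ c a x, x ∈ I → br c x a ∈ I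
  antisymm : ∀ c x y, br c x y + br c y x ∈ I
  jacobi : ∀ c x y z, br c x (br c y z) + br c y (br c z x) + br c z (br c x y) ∈ I
  mixed : ∀ x y z,
    br .red x (br .blue y z) + br .red y (br .blue z x) + br .red z (br .blue x y) +
      br .blue x (br .red y z) + br .blue y (br .red z x) + br .blue z (br .red x y) ∈ I

/-- The smallest ideal containing all the relations. -/
noncomputable def compatibleIdeal : Submodule R (FreeMag R X) :=
  sInf {I | IsCompatibleIdeal R X I}

/-- The free algebra on `X` with two compatible Lie brackets. -/
abbrev FreeLie2 : Type _ := FreeMag R X ⧸ compatibleIdeal R X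

/-- The class of a monomial in the free algebra with two compatible Lie brackets. -/
noncomputable def monomial (T : BTree X) : FreeLie2 R X :=
  (compatibleIdeal R X).mkQ (Finsupp.single T 1)

/-- The multilinear part: the span of all monomials which contain every letter exactly once. -/
noncomputable def multilinearPart : Submodule R (FreeLie2 R X) :=
  Submodule.span R {m | ∃ T : BTree X, T.IsMultilinear ∧ m = monomial R X T}

/-- The module `Lie₂(n)`. -/
abbrev Lie2 (n : ℕ) : Type _ := multilinearPart R (Fin n)

/-- The element of `Lie₂(n)` given by a tree. -/
noncomputable def lieClass {n : ℕ} (T : BT n) : Lie2 R n :=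
  ⟨monomial R (Fin n) T.1, Submodule.subset_span ⟨T.1, T.2, rfl⟩⟩

end Lie

/-! ## Oriented two-coloured graphs -/

/-- An oriented coloured edge `src → dst` between distinct vertices. -/
@[ext] structure OEdge (X : Type*) where
  src : X
  dst : X
  color : Color
  ne : src ≠ dst
  deriving DecidableEq

namespace OEdge

variable {X : Type*}

/-- The same edge with the opposite orientation. -/
def flip (e : OEdge X) : OEdge X := ⟨e.dst, e.src, e.color, e.ne.symm⟩

/-- Consistent edges: increasing red ones and decreasing blue ones. -/
def Consistent [LinearOrder X] (e : OEdge X) : Prop :=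
  (e.color = .red ∧ e.src < e.dst) ∨ (e.color = .blue ∧ e.dst < e.src)

noncomputable instance [Fintype X] : Fintype (OEdge X) :=
  Fintype.ofInjective (fun e : OEdge X => (e.src, e.dst, e.color)) (by
    intro a b h
    simp only [Prod.mk.injEq] at h
    exact OEdge.ext h.1 h.2.1 h.2.2)

end OEdge

/-- An oriented two-coloured graph on the vertex set `X`: a finite multiset of oriented coloured
edges. Multiple edges are allowed, loops are not, and connectedness is not required. -/
abbrev OGraph (X : Type*) : Type _ := Multiset (OEdge X)

namespace OGraph

variable {X : Type*}

/-- The graph is connected (orientations being ignored). -/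
def IsConnected (G : OGraph X) : Prop :=
  (SimpleGraph.fromRel fun i j : X => ∃ e ∈ G, e.src = i ∧ e.dst = j).Connected

open Classical in
/-- There is more than one edge between some two vertices. -/
def HasMultipleEdge (G : OGraph X) : Prop :=
  ∃ i j : X, 1 < G.countP fun e => (e.src = i ∧ e.dst = j) ∨ (e.src = j ∧ e.dst = i)

end OGraph

open Classical in
/-- The pairing `⟪G, T⟫` of an oriented two-coloured graph and a two-coloured binary tree. Each edge
`i → j` of `G` is sent to the nadir of the path from `i` to `j` in `T`. If this is a colour-preserving
bijection from the edges of `G` (counted with multiplicity) to the internal vertices of `T`, then the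
value is `(-1)^N`, where `N` is the number of edges whose path travels counterclockwise at its nadir;
otherwise the value is `0`. -/
noncomputable def pairing (R : Type*) [CommRing R] {X : Type*} [DecidableEq X]
    (G : OGraph X) (T : BTree X) : R :=
  if Set.BijOn (fun e : G => T.nadir e.1.src e.1.dst) Set.univ T.internal ∧
      ∀ e ∈ G, T.colorAt (T.nadir e.src e.dst) = some e.color
  then (-1) ^ G.countP (fun e => T.Counterclockwise e.src e.dst)
  else 0

section Eil

variable (R : Type*) [CommRing R] (X : Type*)

/-- The free module on all oriented two-coloured graphs. -/
abbrev Gam : Type _ := OGraph X →₀ R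

/-- The basis element of a graph. -/
noncomputable def gr {X : Type*} (G : OGraph X) : Gam R X := Finsupp.single G 1

/-- The graph which consists of `G` and the two edges `i → j` of colour `c` and `j → k` of
colour `d`. -/
def addTwo {X : Type*} (G : OGraph X) (c d : Color) (i j k : X) (hij : i ≠ j) (hjk : j ≠ k) :
    OGraph X :=
  ⟨i, j, c, hij⟩ ::ₘ ⟨j, k, d, hjk⟩ ::ₘ G

/-- The sum of the three graphs obtained from `addTwo G c d i j k` by cyclic rotation
of `i, j, k`. -/
noncomputable def cyclicSum {X : Type*} (G : OGraph X) (c d : Color) (i j k : X)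
    (hij : i ≠ j) (hjk : j ≠ k) (hki : k ≠ i) : Gam R X :=
  gr R (addTwo G c d i j k hij hjk) + gr R (addTwo G c d j k i hjk hki) +
    gr R (addTwo G c d k i j hki hij)

/-- The submodule of relations among graphs: symmetry, Jacobi and mixed Jacobi combinations, graphs
with multiple edges, and disconnected graphs. -/
noncomputable def eilRelations : Submodule R (Gam R X) :=
  Submodule.span R
    ({x | ∃ (G : OGraph X) (e : OEdge X), x = gr R (e ::ₘ G) + gr R (e.flip ::ₘ G)} ∪
     {x | ∃ (G : OGraph X) (c : Color) (i j k : X) (hij : i ≠ j) (hjk : j ≠ k) (hki : k ≠ i),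
        x = cyclicSum R G c c i j k hij hjk hki} ∪
     {x | ∃ (G : OGraph X) (i j k : X) (hij : i ≠ j) (hjk : j ≠ k) (hki : k ≠ i),
        x = cyclicSum R G .blue .red i j k hij hjk hki +
          cyclicSum R G .red .blue i j k hij hjk hki} ∪
     {x | ∃ G : OGraph X, G.HasMultipleEdge ∧ x = gr R G} ∪
     {x | ∃ G : OGraph X, ¬ G.IsConnected ∧ x = gr R G})

/-- The module `Eil₂(n)`. -/
abbrev Eil2 (n : ℕ) : Type _ := Gam R (Fin n) ⧸ eilRelations R (Fin n)

/-- The class of a graph in `Eil₂(n)`. -/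
noncomputable def eilClass {n : ℕ} (G : OGraph (Fin n)) : Eil2 R n :=
  (eilRelations R (Fin n)).mkQ (gr R G)

end Eil

/-- The bilinear form `B` between `Lie₂(n)` and `Eil₂(n)` is induced by the pairing of graphs
and trees. -/
def IsInducedPairing {R : Type*} [CommRing R] {n : ℕ} (B : Lie2 R n →ₗ[R] Eil2 R n →ₗ[R] R) :
    Prop :=
  ∀ (T : BT n) (G : OGraph (Fin n)), B (lieClass R T) (eilClass R G) = pairing R G T.1

/-! ## Two-coloured rooted trees -/

/-- A rooted two-coloured graph (without any condition): a finite set of vertices, a root, and a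
finite set of coloured unoriented edges. -/
@[ext] structure RGraph (X : Type*) where
  verts : Finset X
  root : X
  edges : Finset (Sym2 X × Color)

namespace RGraph

variable {X : Type*} [LinearOrder X]

/-- There is an edge `{i, j}` of colour `c`, and it is red with `i < j` or blue with `i > j`. -/
def Arrow (G : RGraph X) (c : Color) (i j : X) : Prop :=
  (s(i, j), c) ∈ G.edges ∧ ((c = .red ∧ i < j) ∨ (c = .blue ∧ j < i))

/-- `G` is a two-coloured tree on its vertex set which avoids the patterns `1r3r2`, `2b1b3` and
`1r2b3`, and its root is the vertex to which no arrow points. Equivalently, `G` is a rooted tree whose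
increasing edges are red and whose decreasing edges are blue. -/
structure IsAvoidingTree (G : RGraph X) : Prop where
  edge_mem : ∀ i j c, (s(i, j), c) ∈ G.edges → i ∈ G.verts ∧ j ∈ G.verts ∧ i ≠ j
  one_color : ∀ i j, ¬ ((s(i, j), .red) ∈ G.edges ∧ (s(i, j), .blue) ∈ G.edges)
  isTree : (SimpleGraph.fromRel fun i j : G.verts => ∃ c, (s(i.1, j.1), c) ∈ G.edges).IsTree
  avoid_1r3r2 : ∀ i j k, i < j → j < k → ¬ ((s(i, k), .red) ∈ G.edges ∧ (s(j, k), .red) ∈ G.edges)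
  avoid_2b1b3 : ∀ i j k, i < j → j < k →
    ¬ ((s(i, j), .blue) ∈ G.edges ∧ (s(i, k), .blue) ∈ G.edges)
  avoid_1r2b3 : ∀ i j k, i < j → j < k →
    ¬ ((s(i, j), .red) ∈ G.edges ∧ (s(j, k), .blue) ∈ G.edges)
  root_mem : root G ∈ G.verts
  root_source : ∀ c i, ¬ G.Arrow c i G.root

/-- `y` can be reached from `x` along edges of `G` different from `e`. -/
def ReachAvoiding (G : RGraph X) (e : Sym2 X × Color) (x y : X) : Prop :=
  Relation.ReflTransGen (fun u v => ∃ c, (s(u, v), c) ∈ G.edges ∧ (s(u, v), c) ≠ e) x y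

open Classical in
/-- The component of `x` in the graph obtained from `G` by removing the edge `e`, with root `x`. -/
noncomputable def side (G : RGraph X) (e : Sym2 X × Color) (x : X) : RGraph X where
  verts := G.verts.filter fun v => G.ReachAvoiding e x v
  root := x
  edges := G.edges.filter fun f => f ≠ e ∧ ∃ v ∈ f.1, G.ReachAvoiding e x v

/-- The graph obtained from two disjoint rooted graphs by connecting their roots with an edge of
colour `c`; the new root is the smaller one of the two roots if `c` is red and the larger one if
`c` is blue. -/
def join (c : Color) (G₁ G₂ : RGraph X) : RGraph X where
  verts := G₁.verts ∪ G₂.verts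
  root := match c with
    | .red => min G₁.root G₂.root
    | .blue => max G₁.root G₂.root
  edges := insert (s(G₁.root, G₂.root), c) (G₁.edges ∪ G₂.edges)

/-- The relation `G →_op H`. In the first case `{p, y}` is the edge from `y` to its parent `p`, and
`H` is the graph operated from `G` with respect to `y`. In the second case `x` is a child of the root
of `G`, and the subtree `G(x)` is replaced by a graph `H'` with `G(x) →_op H'`. -/
inductive OpStep : RGraph X → RGraph X → Prop
  | operate (G : RGraph X) (c : Color) (p y : X) (harrow : G.Arrow c p y)
      (hne : G ≠ join c (G.side (s(p, y), c) G.root) (G.side (s(p, y), c) y)) :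
      OpStep G (join c (G.side (s(p, y), c) G.root) (G.side (s(p, y), c) y))
  | inside (G H' : RGraph X) (c : Color) (x : X) (harrow : G.Arrow c G.root x)
      (hstep : OpStep (G.side (s(G.root, x), c) x) H')
      (hne : G ≠ join c (G.side (s(G.root, x), c) G.root) H') :
      OpStep G (join c (G.side (s(G.root, x), c) G.root) H')

/-- The vertices joined to the root by an edge of colour `c`. -/
def rootNbrs (G : RGraph X) (c : Color) : Finset X :=
  G.verts.filter fun x => (s(G.root, x), c) ∈ G.edges

theorem side_lt (G : RGraph X) (e : Sym2 X × Color) (x : X) (he : e ∈ G.edges) :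
    (G.side e x).edges.card < G.edges.card := by
  classical
  exact Finset.card_lt_card (Finset.filter_ssubset.2 ⟨e, he, fun h => h.1 rfl⟩)

theorem mem_edges_of_mem_rootNbrs {G : RGraph X} {c : Color} {x : X} (h : x ∈ G.rootNbrs c) :
    (s(G.root, x), c) ∈ G.edges :=
  (Finset.mem_filter.mp h).2

/-- The monomial `b_G`. If there are red edges at the root `r`, then `b_G = [b_{G∖G'}, b_{G'}]`, where
`G'` is the subtree of the smallest vertex joined to `r` by a red edge; if all edges at `r` are blue,
then `b_G = ⟨b_{G'}, b_{G∖G'}⟩`, where `G'` is the subtree of the largest vertex joined to `r`; if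
there are no edges at `r`, then `b_G = r`. -/
noncomputable def bMonomial (G : RGraph X) : BTree X :=
  if hr : (G.rootNbrs .red).Nonempty then
    .node .red
      (bMonomial (G.side (s(G.root, (G.rootNbrs .red).min' hr), .red) G.root))
      (bMonomial (G.side (s(G.root, (G.rootNbrs .red).min' hr), .red)
        ((G.rootNbrs .red).min' hr)))
  else if hb : (G.rootNbrs .blue).Nonempty then
    .node .blue
      (bMonomial (G.side (s(G.root, (G.rootNbrs .blue).max' hb), .blue)
        ((G.rootNbrs .blue).max' hb)))
      (bMonomial (G.side (s(G.root, (G.rootNbrs .blue).max' hb), .blue) G.root))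
  else .leaf G.root
termination_by G.edges.card
decreasing_by
  · exact side_lt _ _ _ (mem_edges_of_mem_rootNbrs (Finset.min'_mem _ hr))
  · exact side_lt _ _ _ (mem_edges_of_mem_rootNbrs (Finset.min'_mem _ hr))
  · exact side_lt _ _ _ (mem_edges_of_mem_rootNbrs (Finset.max'_mem _ hb))
  · exact side_lt _ _ _ (mem_edges_of_mem_rootNbrs (Finset.max'_mem _ hb))

open Classical in
/-- The oriented copy `o_G`: the consistent oriented graph with the same coloured edges as `G`. -/
noncomputable def orientedCopy [Fintype X] (G : RGraph X) : OGraph X :=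
  (Finset.univ.filter fun e : OEdge X =>
    (s(e.src, e.dst), e.color) ∈ G.edges ∧ e.Consistent).val

end RGraph

/-- The set of two-coloured trees on `x_1 < ⋯ < x_n` avoiding the three patterns, each considered as
a rooted tree. -/
abbrev GBar (n : ℕ) : Type :=
  {G : RGraph (Fin n) // G.IsAvoidingTree ∧ G.verts = Finset.univ}

/-- The relation `≤_op`, generated by `→_op`. -/
def LeOp {n : ℕ} : GBar n → GBar n → Prop :=
  Relation.ReflTransGen fun G H => G.1.OpStep H.1

end TwoBracket

/-!
The value of the pairing of a graph and a bracket monomial `T` is nonzero only if the graph belongs to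
`T.matchings`: it has one edge across every internal vertex of `T`, of the colour of that vertex.

*The pairing is well defined.* On the side of graphs, two of three leaves `i`, `j`, `k` of a tree meet
first, and the paths from these two to the third leaf have the same nadir; hence one of the three terms
of a Jacobi combination vanishes and the other two cancel (`eilRelations_le_ker_pairingForm`). On the
side of brackets, the generating function of all pairings with `T` is a product, over the internal
vertices, of antisymmetric biadditive expressions `crossSum` in the sets of letters on the left and on
the right. Antisymmetry and the Jacobi identities become identities in a commutative ring, which hold
for all elements of the free algebra and not only for multilinear ones
(`compatibleIdeal_le_ker_genFunMap`).

*Triangularity.* The avoiding trees are exactly the rooted trees `IsArb` whose arrows go from parents to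
children. The bracket of two monomials corresponds to the operation `RGraph.join` of joining two roots,
so every monomial `T` with distinct letters has a tree `T.toRGraph`, and the tree of `b_G` is `G`
(`IsArb.bMonomial_spec`). If `o_G` is a matching of `T`, then cutting `G` at the edge across the root
of `T` and joining the roots of the two parts again goes up in the operation order; by induction
`G ≤ T.toRGraph` (`le_toRGraph_of_mem_matchings`). The operation order is antisymmetric because an
operation lowers the numbers of descendants lexicographically (`OpStep.lexLess`).

*Spanning on the side of brackets.* Two monomials with the same tree agree up to sign and monomials with
smaller trees (`congBelow_of_toRGraph_eq`): two subtrees at the root may be joined in either order,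
since the other terms of the (mixed) Jacobi identity have smaller trees. So the `b_G` span `Lie₂(n)`.

*Spanning on the side of graphs.* In the commutative ring of graphs modulo the relations on edges, a
tree times an additional edge is zero (`IsTreeProd.mul_edge`); therefore only trees matter. By induction
on the number of vertices, a product over a tree lies in the span of the products over the `o_G`
(`IsTreeProd.mem_treeSpan`): remove the minimal vertex `m` and rewrite the rest. A blue edge can be
attached at `m` to any avoiding tree, a red edge is moved along the tree to its root, and two trees that
meet in `m` are merged, where two blue parents of `m` are reduced to one by Arnold's relation.

Two spanning families with an invertible triangular matrix of pairings are dual bases up to a change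
of basis, so the pairing is perfect (`isPerfPair_of_partialOrder`).
-/

namespace TwoBracket

open Relation

/-! ### Rooted trees described by their arrows -/

/-- Of two roots joined by an edge of colour `c`, the one that `Beats` the other becomes the new
root: the smaller one for red, the larger one for blue. -/
def Beats {X : Type*} [LinearOrder X] (c : Color) (i j : X) : Prop :=
  (c = .red ∧ i < j) ∨ (c = .blue ∧ j < i)

section Beats

variable {X : Type*} [LinearOrder X] {c d : Color} {i j k : X}

theorem Beats.ne (h : Beats c i j) : i ≠ j := by
  rcases h with ⟨_, h⟩ | ⟨_, h⟩
  exacts [h.ne, h.ne']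

theorem Beats.asymm (h : Beats c i j) : ¬ Beats c j i := by
  rcases h with ⟨rfl, h⟩ | ⟨rfl, h⟩ <;> simp [Beats, h.le]

theorem beats_or_beats (c : Color) (h : i ≠ j) : Beats c i j ∨ Beats c j i := by
  cases c <;> rcases lt_or_gt_of_ne h with h | h <;> simp [Beats, h]

theorem beats_red : Beats .red i j ↔ i < j := by simp [Beats]

theorem beats_blue : Beats .blue i j ↔ j < i := by simp [Beats]

end Beats

namespace RGraph

variable {X : Type*} [LinearOrder X] {G : RGraph X}

/-- There is an arrow of some colour from `i` to `j`. -/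
def Arr (G : RGraph X) (i j : X) : Prop := ∃ c, G.Arrow c i j

theorem arrow_iff {c : Color} {i j : X} : G.Arrow c i j ↔ (s(i, j), c) ∈ G.edges ∧ Beats c i j :=
  Iff.rfl

/-- `G` is a rooted tree whose edges are red if the parent is smaller than the child and blue if it
is larger: every arrow goes from a parent to a child, no vertex has two parents, the root has none,
and every vertex can be reached from the root. -/
structure IsArb (G : RGraph X) : Prop where
  edge_mem : ∀ i j c, (s(i, j), c) ∈ G.edges → i ∈ G.verts ∧ j ∈ G.verts ∧ i ≠ j
  in_unique : ∀ {c c' p p' y}, G.Arrow c p y → G.Arrow c' p' y → p = p' ∧ c = c'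
  root_mem : G.root ∈ G.verts
  root_source : ∀ c i, ¬ G.Arrow c i G.root
  reach : ∀ v ∈ G.verts, ReflTransGen G.Arr G.root v

theorem IsArb.src_mem (h : G.IsArb) {c : Color} {i j : X} (a : G.Arrow c i j) : i ∈ G.verts :=
  (h.edge_mem _ _ _ a.1).1

theorem IsArb.dst_mem (h : G.IsArb) {c : Color} {i j : X} (a : G.Arrow c i j) : j ∈ G.verts :=
  (h.edge_mem _ _ _ a.1).2.1

theorem IsArb.arrow_or_arrow (h : G.IsArb) {c : Color} {i j : X} (e : (s(i, j), c) ∈ G.edges) :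
    G.Arrow c i j ∨ G.Arrow c j i := by
  rcases beats_or_beats c (h.edge_mem _ _ _ e).2.2 with b | b
  · exact Or.inl ⟨e, b⟩
  · exact Or.inr ⟨by rwa [Sym2.eq_swap], b⟩

theorem IsArb.acyclic (h : G.IsArb) {v : X} (hv : v ∈ G.verts) : ¬ TransGen G.Arr v v := by
  have key := h.reach v hv
  clear hv
  induction key with
  | refl =>
    intro t
    obtain ⟨x, -, c, hx⟩ := TransGen.tail'_iff.1 t
    exact h.root_source _ _ hx
  | @tail b w _ hbw ih =>
    intro t
    obtain ⟨x, hx, c, hxw⟩ := TransGen.tail'_iff.1 t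
    obtain ⟨d, hbw'⟩ := hbw
    obtain ⟨rfl, -⟩ := h.in_unique hxw hbw'
    exact ih (TransGen.head' ⟨d, hbw'⟩ hx)

theorem IsArb.not_reach_parent (h : G.IsArb) {c : Color} {p y : X} (a : G.Arrow c p y) :
    ¬ ReflTransGen G.Arr y p := fun t =>
  h.acyclic (h.src_mem a) (TransGen.head' ⟨c, a⟩ t)

/-- An edge with its lower end below `y` has its upper end below `y`, unless the lower end is `y`. -/
theorem IsArb.reach_of_reach (h : G.IsArb) {y a b : X} (hb : ReflTransGen G.Arr y b)
    (hab : G.Arr a b) (hne : b ≠ y) : ReflTransGen G.Arr y a := by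
  rcases ReflTransGen.cases_tail hb with rfl | ⟨b', hb', d, hd⟩
  · exact absurd rfl hne
  · obtain ⟨c, hc⟩ := hab
    obtain ⟨rfl, -⟩ := h.in_unique hc hd
    exact hb'

theorem IsArb.mem_of_reach (h : G.IsArb) {y v : X} (hy : y ∈ G.verts)
    (t : ReflTransGen G.Arr y v) : v ∈ G.verts := by
  induction t with
  | refl => exact hy
  | tail _ hb _ => obtain ⟨c, hc⟩ := hb; exact h.dst_mem hc

/-- The forbidden patterns are the three ways in which a vertex can have two parents. -/
theorem IsAvoidingTree.isArb (h : G.IsAvoidingTree) : G.IsArb := by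
  have uniq : ∀ {c c' p p' y}, G.Arrow c p y → G.Arrow c' p' y → p = p' ∧ c = c' := by
    intro c c' p p' y a a'
    have hp : p = p' := by
      by_contra hne
      wlog hlt : p < p' generalizing p p' c c'
      · exact this a' a (Ne.symm hne) (lt_of_le_of_ne (not_lt.1 hlt) (Ne.symm hne))
      rcases a with ⟨e, ⟨rfl, l⟩ | ⟨rfl, l⟩⟩ <;> rcases a' with ⟨e', ⟨rfl, l'⟩ | ⟨rfl, l'⟩⟩
      · exact h.avoid_1r3r2 p p' y hlt l' ⟨e, e'⟩
      · exact h.avoid_1r2b3 p y p' l l' ⟨e, by rwa [Sym2.eq_swap]⟩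
      · exact absurd (l.trans (hlt.trans l')) (lt_irrefl _)
      · exact h.avoid_2b1b3 y p p' l hlt ⟨by rwa [Sym2.eq_swap], by rwa [Sym2.eq_swap]⟩
    subst hp
    refine ⟨rfl, ?_⟩
    have key := h.one_color p y
    rcases c <;> rcases c'
    exacts [rfl, absurd ⟨a.1, a'.1⟩ key, absurd ⟨a'.1, a.1⟩ key, rfl]
  refine ⟨h.edge_mem, uniq, h.root_mem, h.root_source, fun v hv => ?_⟩
  have conn := h.isTree.1.preconnected ⟨G.root, h.root_mem⟩ ⟨v, hv⟩
  obtain ⟨w⟩ := conn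
  -- The set of vertices reachable from the root is closed under adjacency.
  have key : ∀ (a b : G.verts), (SimpleGraph.fromRel fun i j : G.verts =>
      ∃ c, (s(i.1, j.1), c) ∈ G.edges).Walk a b → ReflTransGen G.Arr G.root a.1 →
      ReflTransGen G.Arr G.root b.1 := by
    intro a b w
    induction w with
    | nil => exact id
    | @cons a b' _ hadj _ ih =>
      intro ha
      apply ih
      have hab : ∃ c, (s(a.1, b'.1), c) ∈ G.edges := by
        rw [SimpleGraph.fromRel_adj] at hadj
        rcases hadj.2 with ⟨c, hc⟩ | ⟨c, hc⟩
        · exact ⟨c, hc⟩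
        · exact ⟨c, by rwa [Sym2.eq_swap]⟩
      obtain ⟨c, e⟩ := hab
      rcases beats_or_beats c (h.edge_mem _ _ _ e).2.2 with b | b
      · exact ha.tail ⟨c, e, b⟩
      · have arr : G.Arrow c b'.1 a.1 := ⟨by rwa [Sym2.eq_swap], b⟩
        rcases ReflTransGen.cases_tail ha with h0 | ⟨x, hx, d, hd⟩
        · rw [h0] at arr
          exact absurd arr (h.root_source _ _)
        · obtain ⟨h1, -⟩ := uniq arr hd
          rw [h1]; exact hx
  exact key _ _ w .refl

theorem IsArb.one_color (h : G.IsArb) (i j : X) :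
    ¬ ((s(i, j), .red) ∈ G.edges ∧ (s(i, j), .blue) ∈ G.edges) := by
  wlog hij : i < j generalizing i j
  · intro e
    refine this j i (lt_of_le_of_ne (not_lt.1 hij) (h.edge_mem _ _ _ e.1).2.2.symm) ?_
    rwa [Sym2.eq_swap]
  rintro ⟨e, e'⟩
  have a : G.Arrow .red i j := ⟨e, Or.inl ⟨rfl, hij⟩⟩
  have b : G.Arrow .blue j i := ⟨by rwa [Sym2.eq_swap], Or.inr ⟨rfl, hij⟩⟩
  exact h.not_reach_parent a (.single ⟨_, b⟩)

theorem IsArb.isAvoidingTree (h : G.IsArb) : G.IsAvoidingTree := by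
  have adj : ∀ a b : G.verts, (SimpleGraph.fromRel fun i j : G.verts =>
      ∃ c, (s(i.1, j.1), c) ∈ G.edges).Adj a b ↔ G.Arr a b ∨ G.Arr b a := by
    intro a b
    rw [SimpleGraph.fromRel_adj]
    constructor
    · rintro ⟨-, ⟨c, e⟩ | ⟨c, e⟩⟩
      · exact (h.arrow_or_arrow e).imp (⟨c, ·⟩) (⟨c, ·⟩)
      · exact (h.arrow_or_arrow e).symm.imp (⟨c, ·⟩) (⟨c, ·⟩)
    · rintro (⟨c, e⟩ | ⟨c, e⟩)
      · exact ⟨fun h' => (h.edge_mem _ _ _ e.1).2.2 (congrArg _ h'), Or.inl ⟨c, e.1⟩⟩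
      · exact ⟨fun h' => (h.edge_mem _ _ _ e.1).2.2 (congrArg _ h').symm, Or.inr ⟨c, e.1⟩⟩
  refine ⟨h.edge_mem, h.one_color, ⟨?_, ?_⟩, ?_, ?_, ?_, h.root_mem, h.root_source⟩
  · have : Nonempty G.verts := ⟨⟨_, h.root_mem⟩⟩
    rw [SimpleGraph.connected_iff_exists_forall_reachable]
    refine ⟨⟨_, h.root_mem⟩, ?_⟩
    rintro ⟨v, hv⟩
    have key := h.reach v hv
    induction key with
    | refl => exact .refl _
    | @tail b c _ hbc ih =>
      obtain ⟨d, hd⟩ := hbc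
      exact (ih (h.src_mem hd)).trans (SimpleGraph.Adj.reachable ((adj _ _).2 (Or.inl ⟨d, hd⟩)))
  · -- Every edge is a bridge: it separates the vertices below its lower end from the others.
    rw [SimpleGraph.isAcyclic_iff_forall_adj_isBridge]
    suffices H : ∀ p y : G.verts, G.Arr p y → (SimpleGraph.fromRel fun i j : G.verts =>
      ∃ c, (s(i.1, j.1), c) ∈ G.edges).IsBridge s(p, y) by
      intro a b hab
      rcases (adj _ _).1 hab with h1 | h1
      · exact H _ _ h1
      · rw [Sym2.eq_swap]; exact H _ _ h1
    intro p y hpy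
    rw [SimpleGraph.isBridge_iff]
    rintro ⟨w⟩
    have key : ∀ a b : G.verts, ((SimpleGraph.fromRel fun i j : G.verts =>
      ∃ c, (s(i.1, j.1), c) ∈ G.edges).deleteEdges {s(p, y)}).Walk a b →
      ReflTransGen G.Arr y.1 b.1 → ReflTransGen G.Arr y.1 a.1 := by
      intro a b w
      induction w with
      | nil => exact id
      | @cons a b' _ hadj _ ih =>
        intro hb
        have hb' := ih hb
        rw [SimpleGraph.deleteEdges_adj] at hadj
        rcases (adj _ _).1 hadj.1 with h1 | h1
        · by_cases hy : b'.1 = y.1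
          · exfalso
            obtain ⟨c, hc⟩ := h1
            obtain ⟨d, hd⟩ := hpy
            rw [hy] at hc
            obtain ⟨hp, -⟩ := h.in_unique hc hd
            refine hadj.2 ?_
            rw [Set.mem_singleton_iff, Subtype.ext hp, Subtype.ext hy]
          · exact h.reach_of_reach hb' h1 hy
        · exact hb'.tail h1
    obtain ⟨c, hc⟩ := hpy
    exact h.not_reach_parent hc (key _ _ w .refl)
  · rintro i j k hij hjk ⟨e, e'⟩
    exact hij.ne (h.in_unique (c := .red) (c' := .red) (y := k)
      ⟨e, Or.inl ⟨rfl, hij.trans hjk⟩⟩ ⟨e', Or.inl ⟨rfl, hjk⟩⟩).1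
  · rintro i j k hij hjk ⟨e, e'⟩
    exact hjk.ne (h.in_unique (c := .blue) (c' := .blue) (y := i)
      ⟨by rwa [Sym2.eq_swap], Or.inr ⟨rfl, hij⟩⟩
      ⟨by rwa [Sym2.eq_swap], Or.inr ⟨rfl, hij.trans hjk⟩⟩).1
  · rintro i j k hij hjk ⟨e, e'⟩
    exact (hij.trans hjk).ne (h.in_unique (c := .red) (c' := .blue) (y := j)
      ⟨e, Or.inl ⟨rfl, hij⟩⟩ ⟨by rwa [Sym2.eq_swap], Or.inr ⟨rfl, hjk⟩⟩).1

end RGraph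

/-! ### Building and cutting rooted trees -/

namespace RGraph

variable {X : Type*} [LinearOrder X] {G : RGraph X}

/-- The tree with one vertex. -/
def single (x : X) : RGraph X := ⟨{x}, x, ∅⟩

/-- The union of two trees, with the root of the first one. It is meant for the case that the only
common vertex is the root of the second tree. -/
def merge (A B : RGraph X) : RGraph X := ⟨A.verts ∪ B.verts, A.root, A.edges ∪ B.edges⟩

/-- The tree `B` is attached below the vertex `p` of the tree `A` by an edge of colour `c`. -/
def graft (c : Color) (p : X) (A B : RGraph X) : RGraph X :=
  ⟨A.verts ∪ B.verts, A.root, insert (s(p, B.root), c) (A.edges ∪ B.edges)⟩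

/-- The conditions under which `graft c p A B` is a tree with a new arrow from `p` to the root
of `B`. -/
structure Graftable (c : Color) (p : X) (A B : RGraph X) : Prop where
  left : A.IsArb
  right : B.IsArb
  disj : Disjoint A.verts B.verts
  mem : p ∈ A.verts
  beats : Beats c p B.root

theorem isArb_single (x : X) : (single x).IsArb where
  edge_mem i j c h := by simp [single] at h
  in_unique a := by simp [single, arrow_iff] at a
  root_mem := by simp [single]
  root_source c i a := by simp [single, arrow_iff] at a
  reach v hv := by
    obtain rfl : v = x := by simpa [single] using hv
    exact .refl

theorem IsArb.mem_verts_of_mem (h : G.IsArb) {e : Sym2 X × Color} (he : e ∈ G.edges) {x : X}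
    (hx : x ∈ e.1) : x ∈ G.verts := by
  obtain ⟨f, c⟩ := e
  induction f with
  | _ i j =>
    rcases Sym2.mem_iff.1 hx with rfl | rfl
    · exact (h.edge_mem _ _ _ he).1
    · exact (h.edge_mem _ _ _ he).2.1

theorem arr_mono {A : RGraph X} (h : A.edges ⊆ G.edges) {x y : X} (t : ReflTransGen A.Arr x y) :
    ReflTransGen G.Arr x y :=
  ReflTransGen.mono (fun _ _ ⟨c, e, b⟩ => ⟨c, h e, b⟩) _ _ t

theorem merge_arrow {A B : RGraph X} {c : Color} {i j : X} :
    (merge A B).Arrow c i j ↔ A.Arrow c i j ∨ B.Arrow c i j := by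
  simp only [arrow_iff, merge, Finset.mem_union]
  tauto

theorem isArb_merge {A B : RGraph X} (hA : A.IsArb) (hB : B.IsArb)
    (hv : ∀ x, x ∈ A.verts → x ∈ B.verts → x = B.root) (hr : B.root ∈ A.verts) :
    (merge A B).IsArb where
  edge_mem i j c h := by
    rcases Finset.mem_union.1 h with h | h
    · have := hA.edge_mem _ _ _ h
      simp [merge, this]
    · have := hB.edge_mem _ _ _ h
      simp [merge, this]
  in_unique {c c' p p' y} a a' := by
    have key : ∀ {c c' p p'}, A.Arrow c p y → ¬ B.Arrow c' p' y := by
      intro c c' p p' a a'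
      obtain rfl := hv _ (hA.dst_mem a) (hB.dst_mem a')
      exact hB.root_source _ _ a'
    rcases merge_arrow.1 a with a | a <;> rcases merge_arrow.1 a' with a' | a'
    · exact hA.in_unique a a'
    · exact (key a a').elim
    · exact (key a' a).elim
    · exact hB.in_unique a a'
  root_mem := by simp [merge, hA.root_mem]
  root_source c i a := by
    rcases merge_arrow.1 a with a | a
    · exact hA.root_source _ _ a
    · have := hv _ hA.root_mem (hB.dst_mem a)
      simp only [merge] at a
      rw [this] at a
      exact hB.root_source _ _ a
  reach v hv := by
    rcases Finset.mem_union.1 hv with hv | hv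
    · exact arr_mono Finset.subset_union_left (hA.reach v hv)
    · exact (arr_mono Finset.subset_union_left (hA.reach _ hr)).trans
        (arr_mono Finset.subset_union_right (hB.reach v hv))

section Graft

variable {A B : RGraph X} {c d : Color} {p i j : X}

theorem graft_arrow (h : Graftable c p A B) :
    (graft c p A B).Arrow d i j ↔
      A.Arrow d i j ∨ B.Arrow d i j ∨ (d = c ∧ i = p ∧ j = B.root) := by
  simp only [arrow_iff, graft, Finset.mem_insert, Finset.mem_union, Prod.mk.injEq, Sym2.eq_iff]
  constructor
  · rintro ⟨(⟨⟨rfl, rfl⟩ | ⟨rfl, rfl⟩, rfl⟩ | h' | h'), b⟩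
    · exact Or.inr (Or.inr ⟨rfl, rfl, rfl⟩)
    · exact absurd h.beats b.asymm
    · exact Or.inl ⟨h', b⟩
    · exact Or.inr (Or.inl ⟨h', b⟩)
  · rintro (⟨h', b⟩ | ⟨h', b⟩ | ⟨rfl, rfl, rfl⟩)
    · exact ⟨Or.inr (Or.inl h'), b⟩
    · exact ⟨Or.inr (Or.inr h'), b⟩
    · exact ⟨Or.inl ⟨Or.inl ⟨rfl, rfl⟩, rfl⟩, h.beats⟩

theorem Graftable.not_mem (h : Graftable c p A B) {x : X} (hx : x ∈ A.verts) : x ∉ B.verts :=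
  Finset.disjoint_left.1 h.disj hx

theorem Graftable.not_mem' (h : Graftable c p A B) {x : X} (hx : x ∈ B.verts) : x ∉ A.verts :=
  Finset.disjoint_right.1 h.disj hx

theorem Graftable.isArb (h : Graftable c p A B) : (graft c p A B).IsArb where
  edge_mem i j d e := by
    simp only [graft, Finset.mem_insert, Finset.mem_union, Prod.mk.injEq, Sym2.eq_iff] at e
    rcases e with ⟨⟨rfl, rfl⟩ | ⟨rfl, rfl⟩, rfl⟩ | e | e
    · simp [graft, h.mem, h.right.root_mem, h.beats.ne]
    · simp [graft, h.mem, h.right.root_mem, h.beats.ne.symm]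
    · have := h.left.edge_mem _ _ _ e
      simp [graft, this]
    · have := h.right.edge_mem _ _ _ e
      simp [graft, this]
  in_unique {c₁ c₂ p₁ p₂ y} a₁ a₂ := by
    rcases (graft_arrow h).1 a₁ with a | a | ⟨rfl, rfl, rfl⟩ <;>
      rcases (graft_arrow h).1 a₂ with a' | a' | ⟨rfl, rfl, hy⟩
    · exact h.left.in_unique a a'
    · exact absurd (h.right.dst_mem a') (h.not_mem (h.left.dst_mem a))
    · exact absurd (hy ▸ h.right.root_mem) (h.not_mem (h.left.dst_mem a))
    · exact absurd (h.right.dst_mem a) (h.not_mem (h.left.dst_mem a'))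
    · exact h.right.in_unique a a'
    · exact absurd (hy ▸ a) (h.right.root_source _ _)
    · exact absurd h.right.root_mem (h.not_mem (h.left.dst_mem a'))
    · exact absurd a' (h.right.root_source _ _)
    · exact ⟨rfl, rfl⟩
  root_mem := by simp [graft, h.left.root_mem]
  root_source d i a := by
    rcases (graft_arrow h).1 a with a | a | ⟨rfl, rfl, hy⟩
    · exact h.left.root_source _ _ a
    · exact h.not_mem h.left.root_mem (h.right.dst_mem a)
    · exact h.not_mem h.left.root_mem (hy ▸ h.right.root_mem)
  reach v hv := by
    have sA : A.edges ⊆ (graft c p A B).edges := fun e he => by simp [graft, he]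
    have sB : B.edges ⊆ (graft c p A B).edges := fun e he => by simp [graft, he]
    rcases Finset.mem_union.1 hv with hv | hv
    · exact arr_mono sA (h.left.reach v hv)
    · exact ((arr_mono sA (h.left.reach p h.mem)).tail
        ⟨c, (graft_arrow h).2 (Or.inr (Or.inr ⟨rfl, rfl, rfl⟩))⟩).trans
        (arr_mono sB (h.right.reach v hv))

theorem Graftable.reachAvoiding_right (h : Graftable c p A B) (v : X) :
    (graft c p A B).ReachAvoiding (s(p, B.root), c) B.root v ↔ v ∈ B.verts := by
  constructor
  · intro t
    induction t with
    | refl => exact h.right.root_mem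
    | @tail u w _ huw hu =>
      obtain ⟨d, e, hne⟩ := huw
      simp only [graft, Finset.mem_insert, Finset.mem_union] at e
      rcases e with e | e | e
      · exact absurd e hne
      · exact absurd hu (h.not_mem (h.left.edge_mem _ _ _ e).1)
      · exact (h.right.edge_mem _ _ _ e).2.1
  · intro hv
    refine ReflTransGen.mono ?_ _ _ (h.right.reach v hv)
    rintro u w ⟨d, a⟩
    refine ⟨d, by simp [graft, a.1], fun he => ?_⟩
    have hp := h.right.mem_verts_of_mem a.1 (x := p)
      (by rw [congrArg Prod.fst he]; exact Sym2.mem_mk_left _ _)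
    exact h.not_mem h.mem hp

theorem Graftable.reachAvoiding_left (h : Graftable c p A B) (v : X) :
    (graft c p A B).ReachAvoiding (s(p, B.root), c) A.root v ↔ v ∈ A.verts := by
  constructor
  · intro t
    induction t with
    | refl => exact h.left.root_mem
    | @tail u w _ huw hu =>
      obtain ⟨d, e, hne⟩ := huw
      simp only [graft, Finset.mem_insert, Finset.mem_union] at e
      rcases e with e | e | e
      · exact absurd e hne
      · exact (h.left.edge_mem _ _ _ e).2.1
      · exact absurd (h.right.edge_mem _ _ _ e).1 (h.not_mem hu)
  · intro hv
    refine ReflTransGen.mono ?_ _ _ (h.left.reach v hv)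
    rintro u w ⟨d, a⟩
    refine ⟨d, by simp [graft, a.1], fun he => ?_⟩
    have hp := h.left.mem_verts_of_mem a.1 (x := B.root)
      (by rw [congrArg Prod.fst he]; exact Sym2.mem_mk_right _ _)
    exact h.not_mem hp h.right.root_mem

theorem exists_mem_sym2 {X : Type*} (f : Sym2 X) : ∃ x, x ∈ f := by
  induction f with
  | _ i j => exact ⟨i, Sym2.mem_mk_left _ _⟩

/-- Cutting the new edge of a graft gives back the attached tree. -/
theorem Graftable.side_right (h : Graftable c p A B) :
    (graft c p A B).side (s(p, B.root), c) B.root = B := by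
  ext x
  · simp only [side, Finset.mem_filter, h.reachAvoiding_right]
    simp only [graft, Finset.mem_union]
    tauto
  · rfl
  · simp only [side, Finset.mem_filter, h.reachAvoiding_right]
    simp only [graft, Finset.mem_insert, Finset.mem_union]
    constructor
    · rintro ⟨e | e | e, hne, v, hv, hvB⟩
      · exact absurd e hne
      · exact absurd hvB (h.not_mem (h.left.mem_verts_of_mem e hv))
      · exact e
    · intro e
      obtain ⟨v, hv⟩ := exists_mem_sym2 x.1
      refine ⟨Or.inr (Or.inr e), ?_, v, hv, h.right.mem_verts_of_mem e hv⟩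
      rintro rfl
      exact h.not_mem h.mem (h.right.mem_verts_of_mem e (Sym2.mem_mk_left _ _))

/-- Cutting the new edge of a graft gives back the tree it is attached to. -/
theorem Graftable.side_left (h : Graftable c p A B) :
    (graft c p A B).side (s(p, B.root), c) A.root = A := by
  ext x
  · simp only [side, Finset.mem_filter, h.reachAvoiding_left]
    simp only [graft, Finset.mem_union]
    tauto
  · rfl
  · simp only [side, Finset.mem_filter, h.reachAvoiding_left]
    simp only [graft, Finset.mem_insert, Finset.mem_union]
    constructor
    · rintro ⟨e | e | e, hne, v, hv, hvA⟩
      · exact absurd e hne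
      · exact e
      · exact absurd (h.right.mem_verts_of_mem e hv) (h.not_mem hvA)
    · intro e
      obtain ⟨v, hv⟩ := exists_mem_sym2 x.1
      refine ⟨Or.inr (Or.inl e), ?_, v, hv, h.left.mem_verts_of_mem e hv⟩
      rintro rfl
      exact h.not_mem (h.left.mem_verts_of_mem e (Sym2.mem_mk_right _ _)) h.right.root_mem

end Graft

open Classical in
/-- Every arrow of a tree exhibits it as a graft. -/
theorem IsArb.exists_graft (h : G.IsArb) {c : Color} {p y : X} (a : G.Arrow c p y) :
    ∃ A B : RGraph X, Graftable c p A B ∧ A.root = G.root ∧ B.root = y ∧ G = graft c p A B := by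
  set D : X → Prop := fun v => ReflTransGen G.Arr y v with hD
  let A : RGraph X := ⟨G.verts.filter (¬ D ·), G.root, G.edges.filter fun f => ∀ v ∈ f.1, ¬ D v⟩
  let B : RGraph X := ⟨G.verts.filter D, y, G.edges.filter fun f => ∀ v ∈ f.1, D v⟩
  have pD : ¬ D p := h.not_reach_parent a
  have rD : ¬ D G.root := by
    intro t
    rcases ReflTransGen.cases_tail t with e | ⟨_, _, d, hd⟩
    · exact h.root_source _ _ (e ▸ a)
    · exact h.root_source _ _ hd
  have arrA : ∀ {d i j}, A.Arrow d i j ↔ G.Arrow d i j ∧ ¬ D i ∧ ¬ D j := by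
    intro d i j
    simp [arrow_iff, A]; tauto
  have arrB : ∀ {d i j}, B.Arrow d i j ↔ G.Arrow d i j ∧ D i ∧ D j := by
    intro d i j
    simp [arrow_iff, B]; tauto
  have hA : A.IsArb := by
    refine ⟨?_, fun a a' => h.in_unique (arrA.1 a).1 (arrA.1 a').1, ?_,
      fun d i a => h.root_source _ _ (arrA.1 a).1, ?_⟩
    · intro i j d e
      simp only [A, Finset.mem_filter, Sym2.mem_iff, forall_eq_or_imp, forall_eq] at e ⊢
      have := h.edge_mem _ _ _ e.1
      tauto
    · simp [A, h.root_mem, rD]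
    · intro v hv
      simp only [A, Finset.mem_filter] at hv
      obtain ⟨hv, hn⟩ := hv
      have t := h.reach v hv
      clear hv
      induction t with
      | refl => exact .refl
      | @tail b w _ hbw ih =>
        have hb : ¬ D b := fun t => hn (t.tail hbw)
        obtain ⟨d, hd⟩ := hbw
        exact (ih hb).tail ⟨d, arrA.2 ⟨hd, hb, hn⟩⟩
  have hB : B.IsArb := by
    refine ⟨?_, fun a a' => h.in_unique (arrB.1 a).1 (arrB.1 a').1, ?_, ?_, ?_⟩
    · intro i j d e
      simp only [B, Finset.mem_filter, Sym2.mem_iff, forall_eq_or_imp, forall_eq] at e ⊢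
      have := h.edge_mem _ _ _ e.1
      tauto
    · simp only [B, Finset.mem_filter]
      exact ⟨h.dst_mem a, .refl⟩
    · intro d i a'
      obtain ⟨a', hi, -⟩ := arrB.1 a'
      obtain ⟨rfl, -⟩ := h.in_unique a a'
      exact pD hi
    · intro v hv
      simp only [B, Finset.mem_filter] at hv
      have t : ReflTransGen G.Arr y v := hv.2
      clear hv
      induction t with
      | refl => exact .refl
      | @tail b w hyb hbw ih =>
        have hw := hyb.tail hbw
        obtain ⟨d, hd⟩ := hbw
        exact ih.tail ⟨d, arrB.2 ⟨hd, hyb, hw⟩⟩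
  refine ⟨A, B, ⟨hA, hB, ?_, ?_, a.2⟩, rfl, rfl, ?_⟩
  · rw [Finset.disjoint_left]
    intro x hx hx'
    simp only [A, B, Finset.mem_filter] at hx hx'
    exact hx.2 hx'.2
  · simp only [A, Finset.mem_filter]
    exact ⟨h.src_mem a, pD⟩
  · ext e
    · simp only [graft, A, B, Finset.mem_union, Finset.mem_filter]
      tauto
    · rfl
    · simp only [graft, A, B, Finset.mem_union, Finset.mem_filter, Finset.mem_insert]
      constructor
      · intro he
        obtain ⟨f, d⟩ := e
        induction f with
        | _ i j =>
          -- An arrow that crosses from one part to the other is the given one.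
          have key : ∀ i j, G.Arrow d i j → (s(i, j), d) = (s(p, y), c) ∨
              (¬ D i ∧ ¬ D j) ∨ (D i ∧ D j) := by
            intro i j a'
            by_cases hi : D i
            · exact Or.inr (Or.inr ⟨hi, hi.tail ⟨d, a'⟩⟩)
            · by_cases hj : D j
              · by_cases hjy : j = y
                · subst hjy
                  obtain ⟨rfl, rfl⟩ := h.in_unique a a'
                  exact Or.inl rfl
                · exact absurd (h.reach_of_reach hj ⟨d, a'⟩ hjy) hi
              · exact Or.inr (Or.inl ⟨hi, hj⟩)
          simp only [Sym2.mem_iff, forall_eq_or_imp, forall_eq, he, true_and]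
          rcases h.arrow_or_arrow he with a' | a'
          · exact key _ _ a'
          · rw [Sym2.eq_swap]
            rcases key _ _ a' with h1 | h1 | h1
            · exact Or.inl h1
            · exact Or.inr (Or.inl h1.symm)
            · exact Or.inr (Or.inr h1.symm)
      · rintro (rfl | ⟨he, -⟩ | ⟨he, -⟩)
        exacts [a.1, he, he]

/-! ### Joining two trees at their roots -/

section Join

variable {A B : RGraph X} {c : Color}

theorem join_comm (c : Color) (A B : RGraph X) : join c A B = join c B A := by
  have h1 : (join c A B).verts = (join c B A).verts := Finset.union_comm _ _
  have h2 : (join c A B).edges = (join c B A).edges := by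
    simp only [join, Sym2.eq_swap, Finset.union_comm]
  have h3 : (join c A B).root = (join c B A).root := by
    cases c
    · exact min_comm _ _
    · exact max_comm _ _
  exact RGraph.ext h1 h3 h2

theorem root_join (b : Beats c A.root B.root) : (join c A B).root = A.root := by
  rcases b with ⟨rfl, l⟩ | ⟨rfl, l⟩
  · exact min_eq_left l.le
  · exact max_eq_left l.le

theorem join_eq_graft (b : Beats c A.root B.root) : join c A B = graft c A.root A B :=
  RGraph.ext rfl (root_join b) rfl

theorem verts_join (c : Color) (A B : RGraph X) : (join c A B).verts = A.verts ∪ B.verts := rfl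

theorem IsArb.root_ne (hA : A.IsArb) (hB : B.IsArb) (hd : Disjoint A.verts B.verts) :
    A.root ≠ B.root := fun h =>
  Finset.disjoint_left.1 hd hA.root_mem (h ▸ hB.root_mem)

theorem graftable_root (hA : A.IsArb) (hB : B.IsArb) (hd : Disjoint A.verts B.verts)
    (b : Beats c A.root B.root) : Graftable c A.root A B :=
  ⟨hA, hB, hd, hA.root_mem, b⟩

theorem isArb_join (hA : A.IsArb) (hB : B.IsArb) (hd : Disjoint A.verts B.verts) :
    (join c A B).IsArb := by
  rcases beats_or_beats c (hA.root_ne hB hd) with b | b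
  · rw [join_eq_graft b]
    exact (graftable_root hA hB hd b).isArb
  · rw [join_comm, join_eq_graft b]
    exact (graftable_root hB hA hd.symm b).isArb

end Join

end RGraph

/-! ### The operation order -/

namespace RGraph

variable {X : Type*} [LinearOrder X] {G H : RGraph X}

/-- The reflexive transitive closure of `OpStep` on all rooted graphs. -/
def Le (G H : RGraph X) : Prop := ReflTransGen OpStep G H

section Graft

variable {A B K : RGraph X} {c d : Color} {p q : X}

theorem graft_graft_right (c d : Color) (p q : X) (A B K : RGraph X) :
    graft d q B (graft c p A K) = graft c p (graft d q B A) K := by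
  ext x
  · simp only [graft, Finset.mem_union]; tauto
  · rfl
  · simp only [graft, Finset.mem_union, Finset.mem_insert]; tauto

theorem graft_graft_comm (c d : Color) (p q : X) (A B K : RGraph X) :
    graft d q (graft c p A K) B = graft c p (graft d q A B) K := by
  ext x
  · simp only [graft, Finset.mem_union]; tauto
  · rfl
  · simp only [graft, Finset.mem_union, Finset.mem_insert]; tauto

theorem Graftable.arrow (h : Graftable c p A B) : (graft c p A B).Arrow c p B.root :=
  (graft_arrow h).2 (Or.inr (Or.inr ⟨rfl, rfl, rfl⟩))

/-- An induction principle for `OpStep`, in terms of grafts instead of components. -/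
theorem OpStep.induction_graft {P : RGraph X → RGraph X → Prop}
    (operate : ∀ c p A B, Graftable c p A B → graft c p A B ≠ join c A B →
      P (graft c p A B) (join c A B))
    (inside : ∀ c A B B', Graftable c A.root A B → OpStep B B' → P B B' →
      P (graft c A.root A B) (join c A B'))
    (s : OpStep G H) (hG : G.IsArb) : P G H := by
  induction s with
  | operate G c p y harrow hne =>
    obtain ⟨A, B, hg, -, rfl, rfl⟩ := hG.exists_graft harrow
    have e1 : (graft c p A B).side (s(p, B.root), c) (graft c p A B).root = A := hg.side_left
    rw [e1, hg.side_right] at hne ⊢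
    exact operate c p A B hg hne
  | inside G H' c x harrow hstep hne ih =>
    obtain ⟨A, B, hg, hr, rfl, hAB⟩ := hG.exists_graft harrow
    rw [← hr] at hg hAB
    subst hAB
    have e1 : (graft c A.root A B).side (s((graft c A.root A B).root, B.root), c)
      (graft c A.root A B).root = A := hg.side_left
    have e2 : (graft c A.root A B).side (s((graft c A.root A B).root, B.root), c) B.root = B :=
      hg.side_right
    rw [e1]
    rw [e2] at hstep ih
    exact inside c A B H' hg hstep (ih hg.right)

theorem le_operate (h : Graftable c p A B) : Le (graft c p A B) (join c A B) := by
  by_cases hne : graft c p A B = join c A B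
  · rw [hne]; exact .refl
  · have e1 : (graft c p A B).side (s(p, B.root), c) (graft c p A B).root = A := h.side_left
    have := OpStep.operate (graft c p A B) c p B.root h.arrow
    rw [e1, h.side_right] at this
    exact .single (this hne)

theorem le_inside {B' : RGraph X} (h : Graftable c A.root A B) (s : OpStep B B') :
    Le (graft c A.root A B) (join c A B') := by
  by_cases hne : graft c A.root A B = join c A B'
  · rw [hne]; exact .refl
  · have e1 : (graft c A.root A B).side (s((graft c A.root A B).root, B.root), c)
      (graft c A.root A B).root = A := h.side_left
    have e2 : (graft c A.root A B).side (s((graft c A.root A B).root, B.root), c) B.root = B :=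
      h.side_right
    have := OpStep.inside (graft c A.root A B) B' c B.root h.arrow
    rw [e1, e2] at this
    exact .single (this s hne)

theorem OpStep.isArb_and_verts (s : OpStep G H) (hG : G.IsArb) :
    H.IsArb ∧ H.verts = G.verts := by
  refine OpStep.induction_graft (P := fun G H => H.IsArb ∧ H.verts = G.verts) ?_ ?_ s hG
  · intro c p A B h _
    exact ⟨isArb_join h.left h.right h.disj, rfl⟩
  · intro c A B B' h _ ih
    exact ⟨isArb_join h.left ih.1 (ih.2 ▸ h.disj), by simp [verts_join, graft, ih.2]⟩

theorem Le.isArb_and_verts (s : Le G H) (hG : G.IsArb) : H.IsArb ∧ H.verts = G.verts := by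
  induction s with
  | refl => exact ⟨hG, rfl⟩
  | tail _ s ih =>
    have := s.isArb_and_verts ih.1
    exact ⟨this.1, this.2.trans ih.2⟩

/-- Joining `B` before `K` is larger than joining `K` before `B` if `K` is joined below the root
of `A`: the two results are equal if `B` is joined below this root too; otherwise the edge to the
root of `K` is operated. -/
theorem join_join_le (hA : A.IsArb) (hK : K.IsArb) (hB : B.IsArb) (hAK : Disjoint A.verts K.verts)
    (hAB : Disjoint A.verts B.verts) (hKB : Disjoint K.verts B.verts)
    (b : Beats c A.root K.root) : Le (join d (join c A K) B) (join c (join d A B) K) := by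
  rw [join_eq_graft b]
  rcases beats_or_beats d (hA.root_ne hB hAB) with b' | b'
  · rw [join_eq_graft (A := graft c A.root A K) b', join_eq_graft b',
      join_eq_graft (A := graft d A.root A B) b]
    have := graft_graft_comm c d A.root A.root A B K
    exact this ▸ .refl
  · rw [join_comm d _ B, join_comm d A B, join_eq_graft (B := graft c A.root A K) b',
      graft_graft_right, join_eq_graft b']
    refine le_operate ⟨(graftable_root hB hA hAB.symm b').isArb, hK, ?_, ?_, b⟩
    · exact Finset.disjoint_union_left.2 ⟨hKB.symm, hAK⟩
    · exact Finset.mem_union_right _ hA.root_mem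

theorem OpStep.join_le {A' : RGraph X} (s : OpStep A A') (hA : A.IsArb) (hK : K.IsArb)
    (hd : Disjoint A.verts K.verts) : Le (join c A K) (join c A' K) := by
  rcases beats_or_beats c (hA.root_ne hK hd) with b | b
  · revert b hd
    refine OpStep.induction_graft (P := fun A A' => Disjoint A.verts K.verts →
      Beats c A.root K.root → Le (join c A K) (join c A' K)) ?_ ?_ s hA
    · intro c' p A B h _ hd b
      obtain ⟨hd1, hd2⟩ := Finset.disjoint_union_left.1 hd
      rw [join_eq_graft b, graft_graft_comm]
      refine ReflTransGen.trans (le_operate ⟨(graftable_root h.left hK hd1 b).isArb, h.right,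
        Finset.disjoint_union_left.2 ⟨h.disj, hd2.symm⟩, Finset.mem_union_left _ h.mem,
        h.beats⟩) ?_
      have e : graft c (graft c' p A B).root A K = join c A K := (join_eq_graft (A := A) b).symm
      rw [e]
      exact join_join_le h.left hK h.right hd1 h.disj hd2.symm b
    · intro c' A B B' h s _ hd b
      obtain ⟨hd1, hd2⟩ := Finset.disjoint_union_left.1 hd
      have hB' := s.isArb_and_verts h.right
      rw [join_eq_graft b, graft_graft_comm]
      refine ReflTransGen.trans (le_inside (A := graft c A.root A K) (B' := B')
        ⟨(graftable_root h.left hK hd1 b).isArb, h.right,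
        Finset.disjoint_union_left.2 ⟨h.disj, hd2.symm⟩, Finset.mem_union_left _ h.mem,
        h.beats⟩ s) ?_
      have e : graft c A.root A K = join c A K := (join_eq_graft (A := A) b).symm
      rw [e]
      exact join_join_le h.left hK hB'.1 hd1 (hB'.2 ▸ h.disj) (hB'.2 ▸ hd2.symm) b
  · rw [join_comm, join_comm c A', join_eq_graft b]
    exact le_inside (graftable_root hK hA hd.symm b) s

theorem Le.join_left {A' : RGraph X} (s : Le A A') (hA : A.IsArb) (hK : K.IsArb)
    (hd : Disjoint A.verts K.verts) : Le (join c A K) (join c A' K) := by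
  induction s with
  | refl => exact .refl
  | tail s s' ih =>
    have := Le.isArb_and_verts s hA
    exact ih.trans (s'.join_le this.1 hK (this.2 ▸ hd))

theorem Le.join_right {K' : RGraph X} (s : Le K K') (hA : A.IsArb) (hK : K.IsArb)
    (hd : Disjoint A.verts K.verts) : Le (join c A K) (join c A K') := by
  rw [join_comm c A, join_comm c A]
  exact s.join_left hK hA hd.symm

theorem IsArb.ext_edges (hG : G.IsArb) (hH : H.IsArb) (hv : G.verts = H.verts)
    (he : G.edges = H.edges) : G = H := by
  refine RGraph.ext hv ?_ he
  by_contra hne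
  rcases ReflTransGen.cases_tail (hG.reach H.root (hv ▸ hH.root_mem)) with h | ⟨x, -, c, hc⟩
  · exact hne h.symm
  · exact hH.root_source c x ⟨he ▸ hc.1, hc.2⟩

theorem join_left_injective {A' : RGraph X} (hA : A.IsArb) (hA' : A'.IsArb) (hK : K.IsArb)
    (hv : A.verts = A'.verts) (hd : Disjoint A.verts K.verts) (h : join c A K = join c A' K) :
    A = A' := by
  have key : ∀ {A A' : RGraph X}, A.IsArb → Disjoint A.verts K.verts →
      join c A K = join c A' K → A.edges ⊆ A'.edges := by
    intro A A' hA hd h e he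
    have h1 : e ∈ (join c A' K).edges := h ▸ by simp [join, he]
    simp only [join, Finset.mem_insert, Finset.mem_union] at h1
    rcases h1 with rfl | h1 | h1
    · exact absurd hK.root_mem (Finset.disjoint_left.1 hd
        (hA.mem_verts_of_mem he (Sym2.mem_mk_right _ _)))
    · exact h1
    · obtain ⟨v, hv⟩ := exists_mem_sym2 e.1
      exact absurd (hK.mem_verts_of_mem h1 hv) (Finset.disjoint_left.1 hd
        (hA.mem_verts_of_mem he hv))
  exact hA.ext_edges hA' hv ((key hA hd h).antisymm (key hA' (hv ▸ hd) h.symm))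

end Graft

/-! ### Antisymmetry of the operation order -/

section Antisymm

/-- The set of the vertices below `v`, including `v`. -/
def desc (G : RGraph X) (v : X) : Set X := {w | ReflTransGen G.Arr v w}

/-- `f` is smaller than `g` at the smallest argument where they differ. -/
def LexLess (f g : X → ℕ) : Prop := ∃ v, f v < g v ∧ ∀ w < v, f w = g w

theorem LexLess.trans {f g h : X → ℕ} : LexLess f g → LexLess g h → LexLess f h := by
  rintro ⟨v, hv, hv'⟩ ⟨w, hw, hw'⟩
  rcases lt_trichotomy v w with l | rfl | l
  · exact ⟨v, hw' v l ▸ hv, fun u hu => (hv' u hu).trans (hw' u (hu.trans l))⟩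
  · exact ⟨v, hv.trans hw, fun u hu => (hv' u hu).trans (hw' u hu)⟩
  · exact ⟨w, hv' w l ▸ hw, fun u hu => (hv' u (hu.trans l)).trans (hw' u hu)⟩

theorem LexLess.irrefl {f : X → ℕ} : ¬ LexLess f f := fun ⟨_, h, _⟩ => lt_irrefl _ h

theorem lexLess_of_le [Finite X] {f g : X → ℕ} {v : X} (h : f v < g v)
    (h' : ∀ w < v, f w ≤ g w) : LexLess f g := by
  induction v using WellFoundedLT.induction with
  | ind v ih =>
    by_cases hw : ∃ w < v, f w < g w
    · obtain ⟨w, hwv, hw⟩ := hw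
      exact ih w hwv hw fun u hu => h' u (hu.trans hwv)
    · push Not at hw
      exact ⟨v, h, fun w hwv => le_antisymm (h' w hwv) (hw w hwv)⟩

theorem IsArb.desc_root (h : G.IsArb) : G.desc G.root = G.verts := by
  ext v
  exact ⟨h.mem_of_reach h.root_mem, h.reach v⟩

theorem IsArb.desc_subset (h : G.IsArb) {v : X} (hv : v ∈ G.verts) : G.desc v ⊆ G.verts :=
  fun _ => h.mem_of_reach hv

theorem IsArb.desc_of_notMem (h : G.IsArb) {v : X} (hv : v ∉ G.verts) : G.desc v = {v} := by
  ext w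
  constructor
  · intro t
    rcases ReflTransGen.cases_head t with rfl | ⟨u, ⟨c, hc⟩, -⟩
    · rfl
    · exact absurd (h.src_mem hc) hv
  · rintro rfl
    exact .refl

theorem IsArb.root_notMem_desc (h : G.IsArb) {v : X} (hv : v ≠ G.root) : G.root ∉ G.desc v := by
  intro t
  rcases ReflTransGen.cases_tail t with e | ⟨x, -, c, hc⟩
  · exact hv e.symm
  · exact h.root_source _ _ hc

variable {A B : RGraph X} {c : Color} {p v : X}

theorem Graftable.desc_right (h : Graftable c p A B) (hv : v ∉ A.verts) :
    (graft c p A B).desc v = B.desc v := by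
  ext w
  constructor
  · intro t
    suffices w ∉ A.verts ∧ ReflTransGen B.Arr v w from this.2
    induction t with
    | refl => exact ⟨hv, .refl⟩
    | tail _ a ih =>
      obtain ⟨d, hd⟩ := a
      rcases (graft_arrow h).1 hd with a | a | ⟨rfl, rfl, rfl⟩
      · exact absurd (h.left.src_mem a) ih.1
      · exact ⟨h.not_mem' (h.right.dst_mem a), ih.2.tail ⟨d, a⟩⟩
      · exact absurd h.mem ih.1
  · exact arr_mono fun e he => by simp [graft, he]

theorem desc_left_subset : A.desc v ⊆ (graft c p A B).desc v :=
  fun _ => arr_mono fun e he => by simp [graft, he]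

theorem Graftable.desc_left (h : Graftable c p A B) (hv : v ∈ A.verts) (hp : p ∉ A.desc v) :
    (graft c p A B).desc v = A.desc v := by
  ext w
  constructor
  · intro t
    induction t with
    | refl => exact .refl
    | tail _ a ih =>
      obtain ⟨d, hd⟩ := a
      rcases (graft_arrow h).1 hd with a | a | ⟨rfl, rfl, rfl⟩
      · exact ReflTransGen.tail ih ⟨d, a⟩
      · exact absurd (h.right.src_mem a) (h.not_mem (h.left.desc_subset hv ih))
      · exact absurd ih hp
  · exact fun t => desc_left_subset t

theorem Graftable.ssubset (h : Graftable c p A B) (hv : v ∈ A.verts)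
    (hp : p ∈ (graft c p A B).desc v) : A.desc v ⊂ (graft c p A B).desc v := by
  refine ⟨desc_left_subset, fun hs => ?_⟩
  have : B.root ∈ (graft c p A B).desc v := ReflTransGen.tail hp ⟨c, h.arrow⟩
  exact h.not_mem' h.right.root_mem (h.left.desc_subset hv (hs this))

/-- The number of vertices below `v`, including `v`. -/
noncomputable def dcard (G : RGraph X) (v : X) : ℕ := (G.desc v).ncard

variable [Finite X]

/-- An operation lowers the first number, in the order of the labels, among the numbers of
descendants that it changes. Indeed, the only vertex which may get more descendants is a vertex `y`
that becomes the root in place of `r`; then `y` is a red child of some `p < y`, or a blue child and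
`r < y`, and both `p` and `r` lose descendants. -/
theorem OpStep.lexLess (s : OpStep G H) (hG : G.IsArb) : LexLess H.dcard G.dcard := by
  refine OpStep.induction_graft (P := fun G H => LexLess H.dcard G.dcard) ?_ ?_ s hG
  · intro c p A B h hne
    rcases beats_or_beats c (h.left.root_ne h.right h.disj) with b | b
    · rw [join_eq_graft b] at hne ⊢
      have hp : p ≠ A.root := by rintro rfl; exact hne rfl
      have h' := graftable_root h.left h.right h.disj b
      refine lexLess_of_le (v := p) ?_ fun w _ => ?_
      · rw [dcard, dcard, h'.desc_left h.mem (h.left.root_notMem_desc hp)]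
        exact Set.ncard_lt_ncard (h.ssubset h.mem .refl) (Set.toFinite _)
      · refine Set.ncard_le_ncard ?_ (Set.toFinite _)
        by_cases hw : w ∈ A.verts
        · by_cases hwr : w = A.root
          · subst hwr
            exact (h'.isArb.desc_root.trans h.isArb.desc_root.symm).le
          · rw [h'.desc_left hw (h.left.root_notMem_desc hwr)]
            exact desc_left_subset
        · rw [h'.desc_right hw, h.desc_right hw]
    · rw [join_comm, join_eq_graft b]
      have h' := graftable_root h.right h.left h.disj.symm b
      have key : ∀ w, w ≠ B.root → (graft c B.root B A).desc w ⊆ (graft c p A B).desc w := by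
        intro w hw
        by_cases hwB : w ∈ B.verts
        · rw [h'.desc_left hwB (h.right.root_notMem_desc hw), h.desc_right (h.not_mem' hwB)]
        · rw [h'.desc_right hwB]
          exact desc_left_subset
      have lt : ∀ v, v ∈ A.verts → p ∈ (graft c p A B).desc v → v < B.root →
          LexLess (graft c B.root B A).dcard (graft c p A B).dcard := by
        intro v hv hpv hlt
        refine lexLess_of_le (v := v) ?_ fun w hw =>
          Set.ncard_le_ncard (key w (hw.trans hlt).ne) (Set.toFinite _)
        rw [dcard, dcard, h'.desc_right (h.not_mem hv)]
        exact Set.ncard_lt_ncard (h.ssubset hv hpv) (Set.toFinite _)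
      cases c
      · exact lt p h.mem .refl (beats_red.1 h.beats)
      · exact lt A.root h.left.root_mem (h.isArb.reach p (Finset.mem_union_left _ h.mem))
          (beats_blue.1 b)
  · rintro c A B B' h s ⟨v, hv, hv'⟩
    obtain ⟨hB', eB'⟩ := s.isArb_and_verts h.right
    have hd' : Disjoint A.verts B'.verts := eB' ▸ h.disj
    have hvB : v ∈ B.verts := by
      by_contra hn
      rw [dcard, dcard, h.right.desc_of_notMem hn, hB'.desc_of_notMem (eB' ▸ hn)] at hv
      exact lt_irrefl _ hv
    have hvA := h.not_mem' hvB
    rcases beats_or_beats c (h.left.root_ne hB' hd') with b | b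
    · rw [join_eq_graft b]
      have h' := graftable_root h.left hB' hd' b
      have key : ∀ w ∈ A.verts,
          (graft c A.root A B').dcard w = (graft c A.root A B).dcard w := by
        intro w hw
        rw [dcard, dcard]
        by_cases hwr : w = A.root
        · have e1 : (graft c A.root A B').desc A.root = (graft c A.root A B').verts :=
            h'.isArb.desc_root
          have e2 : (graft c A.root A B).desc A.root = (graft c A.root A B).verts :=
            h.isArb.desc_root
          rw [hwr, e1, e2]
          simp [graft, eB']
        · rw [h'.desc_left hw (h.left.root_notMem_desc hwr),
            h.desc_left hw (h.left.root_notMem_desc hwr)]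
      refine ⟨v, ?_, fun w hw => ?_⟩
      · rw [dcard, dcard, h'.desc_right hvA, h.desc_right hvA]
        exact hv
      · by_cases hwA : w ∈ A.verts
        · exact key w hwA
        · rw [dcard, dcard, h'.desc_right hwA, h.desc_right hwA]
          exact hv' w hw
    · rw [join_comm, join_eq_graft b]
      have h' := graftable_root hB' h.left hd'.symm b
      have hne : B'.root ≠ B.root := fun e => (e ▸ b).asymm h.beats
      have hr : B'.root ∈ B.verts := eB' ▸ hB'.root_mem
      -- The new root of the subtree has gained descendants, hence comes after `v`.
      have hlt : v < B'.root := by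
        have hss : B.desc B'.root ⊂ B'.desc B'.root := by
          rw [hB'.desc_root, eB']
          refine ⟨h.right.desc_subset hr, fun hs => ?_⟩
          exact h.right.root_notMem_desc hne (hs h.right.root_mem)
        have hcard := Set.ncard_lt_ncard hss (Set.toFinite _)
        rcases lt_trichotomy v B'.root with l | rfl | l
        · exact l
        · exact absurd hv hcard.not_gt
        · exact absurd (hv' _ l) hcard.ne'
      have key : ∀ w, w ≠ B'.root → w ∈ B.verts →
          (graft c B'.root B' A).dcard w = B'.dcard w := by
        intro w hw hwB
        rw [dcard, h'.desc_left (eB' ▸ hwB) (hB'.root_notMem_desc hw), dcard]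
      refine lexLess_of_le (v := v) ?_ fun w hw => ?_
      · rw [key v hlt.ne hvB, dcard.eq_1 (graft _ _ _ _), h.desc_right hvA]
        exact hv
      · by_cases hwB : w ∈ B.verts
        · rw [key w (hw.trans hlt).ne hwB, dcard.eq_1 (graft _ _ _ _),
            h.desc_right (h.not_mem' hwB)]
          exact (hv' w hw).le
        · rw [dcard, dcard, h'.desc_right (eB' ▸ hwB)]
          exact Set.ncard_le_ncard desc_left_subset (Set.toFinite _)

theorem Le.eq_or_lexLess (s : Le G H) (hG : G.IsArb) : G = H ∨ LexLess H.dcard G.dcard := by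
  induction s with
  | refl => exact Or.inl rfl
  | tail s s' ih =>
    have l := s'.lexLess (Le.isArb_and_verts s hG).1
    rcases ih with rfl | ih
    · exact Or.inr l
    · exact Or.inr (l.trans ih)

theorem Le.antisymm (s : Le G H) (s' : Le H G) (hG : G.IsArb) : G = H := by
  rcases s.eq_or_lexLess hG with h | h
  · exact h
  · rcases s'.eq_or_lexLess (s.isArb_and_verts hG).1 with h' | h'
    · exact h'.symm
    · exact absurd (h.trans h') LexLess.irrefl

end Antisymm

/-- `G` is strictly smaller than `H` in the operation order. -/
def Lt (G H : RGraph X) : Prop := Le G H ∧ G ≠ H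

theorem Lt.join_left {A A' K : RGraph X} {c : Color} (s : Lt A A') (hA : A.IsArb) (hK : K.IsArb)
    (hd : Disjoint A.verts K.verts) : Lt (join c A K) (join c A' K) := by
  have h := s.1.isArb_and_verts hA
  exact ⟨s.1.join_left hA hK hd, fun e => s.2 (join_left_injective hA h.1 hK h.2.symm hd e)⟩

end RGraph

open RGraph

variable {n : ℕ}

theorem leOp_iff {G H : GBar n} : LeOp G H ↔ G.1.Le H.1 := by
  constructor
  · intro t
    exact ReflTransGen.lift Subtype.val (fun _ _ h => h) _ _ t
  · intro t
    obtain ⟨H, hH⟩ := H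
    change ReflTransGen _ _ _ at t
    simp only at t
    induction t with
    | refl => exact .refl
    | @tail K H s s' ih =>
      have hK := Le.isArb_and_verts s G.2.1.isArb
      exact (ih ⟨hK.1.isAvoidingTree, hK.2.trans G.2.2⟩).tail s'

theorem isPartialOrder_leOp : IsPartialOrder (GBar n) LeOp where
  refl _ := .refl
  trans _ _ _ := ReflTransGen.trans
  antisymm G _ h h' := Subtype.ext ((leOp_iff.1 h).antisymm (leOp_iff.1 h') G.2.1.isArb)

/-! ### The rooted tree of a bracket monomial -/

namespace BTree

variable {X : Type*} [LinearOrder X]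

/-- The rooted tree of a bracket monomial: a bracket of colour `c` joins the roots of the trees of
its two factors by an edge of colour `c`. -/
def toRGraph : BTree X → RGraph X
  | leaf x => RGraph.single x
  | node c l r => RGraph.join c l.toRGraph r.toRGraph

theorem verts_toRGraph (T : BTree X) : T.toRGraph.verts = T.leaves.toFinset := by
  induction T with
  | leaf x => simp [toRGraph, RGraph.single, leaves]
  | node c l r hl hr => simp [toRGraph, RGraph.verts_join, leaves, hl, hr]

theorem nodup_node {c : Color} {l r : BTree X} : (node c l r).leaves.Nodup ↔
    l.leaves.Nodup ∧ r.leaves.Nodup ∧ Disjoint l.toRGraph.verts r.toRGraph.verts := by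
  rw [leaves, List.nodup_append', verts_toRGraph, verts_toRGraph, List.disjoint_toFinset_iff_disjoint]

theorem isArb_toRGraph (T : BTree X) (h : T.leaves.Nodup) : T.toRGraph.IsArb := by
  induction T with
  | leaf x => exact RGraph.isArb_single x
  | node c l r hl hr =>
    obtain ⟨h1, h2, h3⟩ := nodup_node.1 h
    exact RGraph.isArb_join (hl h1) (hr h2) h3

theorem leaves_length_pos {X : Type*} (T : BTree X) : 0 < T.leaves.length := by
  induction T with
  | leaf x => simp [leaves]
  | node c l r hl hr => simp only [leaves, List.length_append]; omega

end BTree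

namespace RGraph

variable {X : Type*} [LinearOrder X] {G A B : RGraph X} {c : Color} {p : X}

theorem IsArb.graft_of_mem_rootNbrs (h : G.IsArb) {x : X} (hx : x ∈ G.rootNbrs c) :
    ∃ A B, Graftable c A.root A B ∧ A.root = G.root ∧ B.root = x ∧ G = graft c A.root A B := by
  have a : G.Arrow c G.root x := by
    rcases h.arrow_or_arrow (mem_edges_of_mem_rootNbrs hx) with a | a
    · exact a
    · exact absurd a (h.root_source _ _)
  obtain ⟨A, B, hg, hr, hy, hG⟩ := h.exists_graft a
  rw [← hr] at hg hG
  exact ⟨A, B, hg, hr, hy, hG⟩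

theorem Graftable.bMonomial_eq (h : Graftable c A.root A B) {x : X}
    (hx : x = B.root) :
    (graft c A.root A B).side (s((graft c A.root A B).root, x), c) (graft c A.root A B).root = A ∧
      (graft c A.root A B).side (s((graft c A.root A B).root, x), c) x = B := by
  subst hx
  exact ⟨h.side_left, h.side_right⟩

/-- The recursion for `b_G` cuts `G` at an edge of the root, and the bracket of the two parts joins
them again by the same edge; so the rooted tree of `b_G` is `G`. -/
theorem IsArb.bMonomial_spec (h : G.IsArb) :
    G.bMonomial.leaves.Nodup ∧ G.bMonomial.toRGraph = G := by
  induction hn : G.edges.card using Nat.strong_induction_on generalizing G with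
  | _ m ih =>
    subst hn
    rw [bMonomial]
    split_ifs with hr hb
    · have hx := Finset.min'_mem _ hr
      have lt := fun y => side_lt G _ y (mem_edges_of_mem_rootNbrs hx)
      set x := (G.rootNbrs .red).min' hr
      clear_value x
      clear hr
      obtain ⟨A, B, hg, hA, hB, rfl⟩ := h.graft_of_mem_rootNbrs hx
      obtain ⟨e1, e2⟩ := hg.bMonomial_eq hB.symm
      have l1 := lt (graft .red A.root A B).root
      have l2 := lt x
      rw [e1] at l1 ⊢
      rw [e2] at l2 ⊢
      obtain ⟨n1, i1⟩ := ih _ l1 hg.left rfl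
      obtain ⟨n2, i2⟩ := ih _ l2 hg.right rfl
      refine ⟨BTree.nodup_node.2 ⟨n1, n2, by rw [i1, i2]; exact hg.disj⟩, ?_⟩
      rw [BTree.toRGraph, i1, i2, join_eq_graft hg.beats]
    · have hx := Finset.max'_mem _ hb
      have lt := fun y => side_lt G _ y (mem_edges_of_mem_rootNbrs hx)
      set x := (G.rootNbrs .blue).max' hb
      clear_value x
      clear hr hb
      obtain ⟨A, B, hg, hA, hB, rfl⟩ := h.graft_of_mem_rootNbrs hx
      obtain ⟨e1, e2⟩ := hg.bMonomial_eq hB.symm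
      have l1 := lt (graft .blue A.root A B).root
      have l2 := lt x
      rw [e1] at l1 ⊢
      rw [e2] at l2 ⊢
      obtain ⟨n1, i1⟩ := ih _ l1 hg.left rfl
      obtain ⟨n2, i2⟩ := ih _ l2 hg.right rfl
      refine ⟨BTree.nodup_node.2 ⟨n2, n1, by rw [i1, i2]; exact hg.disj.symm⟩, ?_⟩
      rw [BTree.toRGraph, i1, i2, join_comm, join_eq_graft hg.beats]
    · refine ⟨by simp [BTree.leaves], ?_⟩
      -- Without edges at the root, there are no other vertices.
      have key : ∀ v ∈ G.verts, v = G.root := by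
        intro v hv
        rcases ReflTransGen.cases_head (h.reach v hv) with e | ⟨x, ⟨c, hc⟩, -⟩
        · exact e.symm
        · have hm : x ∈ G.rootNbrs c := Finset.mem_filter.2 ⟨h.dst_mem hc, hc.1⟩
          cases c
          · exact absurd ⟨x, hm⟩ hr
          · exact absurd ⟨x, hm⟩ hb
      refine (isArb_single _).ext_edges h ?_ ?_
      · ext v
        simp only [single, Finset.mem_singleton]
        exact ⟨fun e => e ▸ h.root_mem, key v⟩
      · rw [single]
        symm
        rw [Finset.eq_empty_iff_forall_notMem]
        rintro ⟨f, d⟩ hf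
        induction f with
        | _ i j =>
          obtain ⟨h1, h2, h3⟩ := h.edge_mem _ _ _ hf
          exact h3 ((key _ h1).trans (key _ h2).symm)

/-! ### Oriented copies of rooted trees -/

variable [Fintype X]

theorem mem_orientedCopy {e : OEdge X} :
    e ∈ G.orientedCopy ↔ G.Arrow e.color e.src e.dst := by
  simp only [orientedCopy, Finset.mem_val, Finset.mem_filter, Finset.mem_univ, true_and]
  rfl

theorem nodup_orientedCopy (G : RGraph X) : G.orientedCopy.Nodup := Finset.nodup _

theorem orientedCopy_single (x : X) : (single x).orientedCopy = 0 := by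
  rw [Multiset.eq_zero_iff_forall_notMem]
  intro e he
  rw [mem_orientedCopy] at he
  simp [single, arrow_iff] at he

theorem Graftable.orientedCopy_graft (h : Graftable c p A B) :
    (graft c p A B).orientedCopy =
      ⟨p, B.root, c, h.beats.ne⟩ ::ₘ (A.orientedCopy + B.orientedCopy) := by
  refine (Multiset.Nodup.ext (nodup_orientedCopy _) ?_).2 fun e => ?_
  · rw [Multiset.nodup_cons, Multiset.nodup_add]
    refine ⟨?_, nodup_orientedCopy _, nodup_orientedCopy _, ?_⟩
    · rw [Multiset.mem_add, mem_orientedCopy, mem_orientedCopy]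
      rintro (a | a)
      · exact h.not_mem (h.left.dst_mem a) h.right.root_mem
      · exact h.right.root_source _ _ a
    · rw [Multiset.disjoint_left]
      intro e he he'
      rw [mem_orientedCopy] at he he'
      exact h.not_mem (h.left.dst_mem he) (h.right.dst_mem he')
  · rw [mem_orientedCopy, graft_arrow h, Multiset.mem_cons, Multiset.mem_add, mem_orientedCopy,
      mem_orientedCopy, OEdge.ext_iff]
    tauto

theorem orientedCopy_merge (hA : A.IsArb) (hB : B.IsArb)
    (hv : ∀ x, x ∈ A.verts → x ∈ B.verts → x = B.root) :
    (merge A B).orientedCopy = A.orientedCopy + B.orientedCopy := by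
  refine (Multiset.Nodup.ext (nodup_orientedCopy _) ?_).2 fun e => ?_
  · rw [Multiset.nodup_add]
    refine ⟨nodup_orientedCopy _, nodup_orientedCopy _, ?_⟩
    rw [Multiset.disjoint_left]
    intro e he he'
    rw [mem_orientedCopy] at he he'
    exact hB.root_source _ _ (hv _ (hA.dst_mem he) (hB.dst_mem he') ▸ he')
  · rw [mem_orientedCopy, merge_arrow, Multiset.mem_add, mem_orientedCopy, mem_orientedCopy]

end RGraph

/-! ### Matchings of a bracket monomial -/

namespace BTree

variable {X : Type*}

/-- The graphs which have exactly one edge for each internal vertex of the tree `T`, of the same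
colour and connecting the leaves on its left to the leaves on its right. -/
def matchings : BTree X → Set (OGraph X)
  | leaf _ => {0}
  | node c l r => {G | ∃ e : OEdge X, ∃ G₁ ∈ l.matchings, ∃ G₂ ∈ r.matchings, e.color = c ∧
      ((e.src ∈ l.leaves ∧ e.dst ∈ r.leaves) ∨ (e.src ∈ r.leaves ∧ e.dst ∈ l.leaves)) ∧
      G = e ::ₘ (G₁ + G₂)}

theorem mem_leaves_of_mem_matchings {T : BTree X} {G : OGraph X} (h : G ∈ T.matchings)
    {e : OEdge X} (he : e ∈ G) : e.src ∈ T.leaves ∧ e.dst ∈ T.leaves := by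
  induction T generalizing G with
  | leaf x =>
    rw [matchings, Set.mem_singleton_iff] at h
    simp [h] at he
  | node c l r hl hr =>
    obtain ⟨e', G₁, h₁, G₂, h₂, -, hc, rfl⟩ := h
    simp only [leaves, List.mem_append]
    rw [Multiset.mem_cons, Multiset.mem_add] at he
    rcases he with rfl | he | he
    · tauto
    · exact ⟨Or.inl (hl h₁ he).1, Or.inl (hl h₁ he).2⟩
    · exact ⟨Or.inr (hr h₂ he).1, Or.inr (hr h₂ he).2⟩

theorem filter_add_of_disjoint {p : OEdge X → Prop} [DecidablePred p] {G₁ G₂ : OGraph X}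
    (h₁ : ∀ e ∈ G₁, p e) (h₂ : ∀ e ∈ G₂, ¬ p e) : (G₁ + G₂).filter p = G₁ := by
  rw [Multiset.filter_add, Multiset.filter_eq_self.2 h₁, Multiset.filter_eq_nil.2 h₂, add_zero]

variable [LinearOrder X] [Fintype X]

open RGraph

theorem orientedCopy_mem_matchings (T : BTree X) (h : T.leaves.Nodup) :
    T.toRGraph.orientedCopy ∈ T.matchings := by
  induction T with
  | leaf x => exact orientedCopy_single x
  | node c l r hl hr =>
    obtain ⟨h1, h2, h3⟩ := nodup_node.1 h
    have hl' := l.isArb_toRGraph h1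
    have hr' := r.isArb_toRGraph h2
    have ml : l.toRGraph.root ∈ l.leaves := by
      simpa [verts_toRGraph] using hl'.root_mem
    have mr : r.toRGraph.root ∈ r.leaves := by
      simpa [verts_toRGraph] using hr'.root_mem
    rw [toRGraph]
    rcases beats_or_beats c (hl'.root_ne hr' h3) with b | b
    · rw [join_eq_graft b, (graftable_root hl' hr' h3 b).orientedCopy_graft]
      exact ⟨_, _, hl h1, _, hr h2, rfl, Or.inl ⟨ml, mr⟩, rfl⟩
    · rw [join_comm, join_eq_graft b, (graftable_root hr' hl' h3.symm b).orientedCopy_graft,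
        add_comm]
      exact ⟨_, _, hl h1, _, hr h2, rfl, Or.inr ⟨mr, ml⟩, rfl⟩

/-- A tree whose oriented copy splits into two graphs on disjoint sets of vertices and an arrow
between them is a graft in a corresponding way. -/
theorem exists_graft_of_orientedCopy {G : RGraph X} (hG : G.IsArb) {S₁ S₂ : Finset X}
    (hd : Disjoint S₁ S₂) {e : OEdge X} {G₁ G₂ : OGraph X}
    (h₁ : ∀ f ∈ G₁, f.src ∈ S₁ ∧ f.dst ∈ S₁) (h₂ : ∀ f ∈ G₂, f.src ∈ S₂ ∧ f.dst ∈ S₂)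
    (he : e.src ∈ S₁ ∧ e.dst ∈ S₂) (hv : G.verts = S₁ ∪ S₂)
    (ho : G.orientedCopy = e ::ₘ (G₁ + G₂)) :
    ∃ p A B, Graftable e.color p A B ∧ G = graft e.color p A B ∧ A.verts = S₁ ∧ B.verts = S₂ ∧
      A.orientedCopy = G₁ ∧ B.orientedCopy = G₂ := by
  have a : G.Arrow e.color e.src e.dst := by
    rw [← mem_orientedCopy, ho]
    exact Multiset.mem_cons_self _ _
  obtain ⟨A, B, hg, -, hB, rfl⟩ := hG.exists_graft a
  have e' : (⟨e.src, B.root, e.color, hg.beats.ne⟩ : OEdge X) = e := OEdge.ext rfl hB rfl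
  rw [hg.orientedCopy_graft, e', Multiset.cons_inj_right] at ho
  have notboth : ∀ {x}, x ∈ S₁ → x ∉ S₂ := fun h => Finset.disjoint_left.1 hd h
  have cross : ∀ f, f ∈ A.orientedCopy ∨ f ∈ B.orientedCopy → (f.src ∈ S₁ ↔ f.dst ∈ S₁) := by
    intro f hf
    rw [← Multiset.mem_add, ho, Multiset.mem_add] at hf
    rcases hf with hf | hf
    · exact iff_of_true (h₁ f hf).1 (h₁ f hf).2
    · exact iff_of_false (fun h => notboth h (h₂ f hf).1) (fun h => notboth h (h₂ f hf).2)
  have same : ∀ {K : RGraph X} {x y : X}, (∀ f, f ∈ K.orientedCopy → (f.src ∈ S₁ ↔ f.dst ∈ S₁)) →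
      ReflTransGen K.Arr x y → (x ∈ S₁ ↔ y ∈ S₁) := by
    intro K x y hK t
    induction t with
    | refl => rfl
    | @tail u w _ a ih =>
      obtain ⟨c, hc⟩ := a
      exact ih.trans (hK ⟨u, w, c, Beats.ne hc.2⟩ (mem_orientedCopy.2 hc))
  have sA : A.verts ⊆ S₁ := fun v hv => (same (fun f hf => cross f (Or.inl hf))
    (hg.left.reach v hv)).1 ((same (fun f hf => cross f (Or.inl hf))
    (hg.left.reach _ hg.mem)).2 he.1)
  have sB : B.verts ⊆ S₂ := by
    intro v hvB
    have h1 : v ∉ S₁ := fun h => notboth ((same (fun f hf => cross f (Or.inr hf))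
      (hg.right.reach v hvB)).2 h) (hB ▸ he.2)
    have h2 : v ∈ S₁ ∪ S₂ := hv ▸ Finset.mem_union_right _ hvB
    exact (Finset.mem_union.1 h2).resolve_left h1
  have eA : A.verts = S₁ := by
    refine sA.antisymm fun v hv' => ?_
    have h2 : v ∈ A.verts ∪ B.verts := by
      have : v ∈ S₁ ∪ S₂ := Finset.mem_union_left _ hv'
      rwa [← hv] at this
    exact (Finset.mem_union.1 h2).resolve_right fun h => notboth hv' (sB h)
  have eB : B.verts = S₂ := by
    refine sB.antisymm fun v hv' => ?_
    have h2 : v ∈ A.verts ∪ B.verts := by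
      have : v ∈ S₁ ∪ S₂ := Finset.mem_union_right _ hv'
      rwa [← hv] at this
    exact (Finset.mem_union.1 h2).resolve_left fun h => notboth (sA h) hv'
  have oA : A.orientedCopy = G₁ := by
    rw [← filter_add_of_disjoint (p := fun f => f.src ∈ S₁) (G₁ := A.orientedCopy)
      (G₂ := B.orientedCopy), ho, filter_add_of_disjoint]
    · exact fun f hf => (h₁ f hf).1
    · exact fun f hf h => notboth h (h₂ f hf).1
    · exact fun f hf => sA (hg.left.src_mem (mem_orientedCopy.1 hf))
    · exact fun f hf h => notboth h (sB (hg.right.src_mem (mem_orientedCopy.1 hf)))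
  refine ⟨_, A, B, hg, rfl, eA, eB, oA, ?_⟩
  rwa [oA, add_right_inj] at ho

/-- If the oriented copy of `G` is a matching of `T`, then `G` is at most the rooted tree of `T`:
the edge of `G` at the top of `T` can be operated, and the two remaining parts of `G` are matchings
of the two factors of `T`. -/
theorem le_toRGraph_of_mem_matchings (T : BTree X) (h : T.leaves.Nodup) {G : RGraph X}
    (hG : G.IsArb) (hv : G.verts = T.leaves.toFinset) (ho : G.orientedCopy ∈ T.matchings) :
    G.Le T.toRGraph := by
  induction T generalizing G with
  | leaf x =>
    have : G.edges = ∅ := by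
      rw [Finset.eq_empty_iff_forall_notMem]
      rintro ⟨f, d⟩ hf
      induction f with
      | _ i j =>
        obtain ⟨h1, h2, h3⟩ := hG.edge_mem _ _ _ hf
        simp only [hv, leaves, List.toFinset_cons, List.toFinset_nil, insert_empty_eq,
          Finset.mem_singleton] at h1 h2
        exact h3 (h1.trans h2.symm)
    rw [hG.ext_edges (isArb_single x) (by simp [hv, leaves, single]) (by simp [this, single])]
    exact .refl
  | node c l r hl hr =>
    obtain ⟨h1, h2, h3⟩ := nodup_node.1 h
    have h3' := h3
    rw [verts_toRGraph, verts_toRGraph] at h3'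
    have hv' : G.verts = l.leaves.toFinset ∪ r.leaves.toFinset := by
      rw [hv, leaves, List.toFinset_append]
    obtain ⟨e, G₁, hG₁, G₂, hG₂, rfl, hc, ho⟩ := ho
    have m₁ : ∀ f ∈ G₁, f.src ∈ l.leaves.toFinset ∧ f.dst ∈ l.leaves.toFinset := fun f hf => by
      simpa using mem_leaves_of_mem_matchings hG₁ hf
    have m₂ : ∀ f ∈ G₂, f.src ∈ r.leaves.toFinset ∧ f.dst ∈ r.leaves.toFinset := fun f hf => by
      simpa using mem_leaves_of_mem_matchings hG₂ hf
    rcases hc with hc | hc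
    · obtain ⟨p, A, B, hg, rfl, vA, vB, rfl, rfl⟩ := exists_graft_of_orientedCopy hG h3' m₁ m₂
        (by simpa using hc) hv' ho
      exact ((le_operate hg).trans ((hl h1 hg.left vA hG₁).join_left hg.left hg.right hg.disj)).trans
        ((hr h2 hg.right vB hG₂).join_right (isArb_toRGraph l h1) hg.right
          (by rw [verts_toRGraph, ← vA]; exact hg.disj))
    · obtain ⟨p, A, B, hg, rfl, vA, vB, rfl, rfl⟩ := exists_graft_of_orientedCopy hG h3'.symm m₂ m₁
        (by simpa using hc) (by rw [hv', Finset.union_comm]) (by rw [ho, add_comm])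
      rw [toRGraph, join_comm]
      exact ((le_operate hg).trans ((hr h2 hg.left vA hG₂).join_left hg.left hg.right hg.disj)).trans
        ((hl h1 hg.right vB hG₁).join_right (isArb_toRGraph r h2) hg.right
          (by rw [verts_toRGraph, ← vA]; exact hg.disj))

end BTree

/-! ### Nadirs -/

namespace BTree

section Nadir

variable {X : Type*} [DecidableEq X]

theorem argmin_length_map_cons (b : Bool) (L : List (List Bool)) :
    (L.map (b :: ·)).argmin List.length = (L.argmin List.length).map (b :: ·) := by
  induction L with
  | nil => rfl
  | cons a L ih =>
    rw [List.map_cons, List.argmin_cons, List.argmin_cons, ih]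
    cases L.argmin List.length with
    | none => rfl
    | some m =>
      simp only [Option.map_some, List.length_cons, Nat.add_lt_add_iff_right]
      split_ifs <;> rfl

theorem argmin_length_of_nil_mem {L : List (List Bool)} (h : [] ∈ L) :
    L.argmin List.length = some [] := by
  cases hm : L.argmin List.length with
  | none => rw [List.argmin_eq_none] at hm; simp [hm] at h
  | some m =>
    have := List.le_of_mem_argmin h hm
    simp only [List.length_nil, Nat.le_zero, List.length_eq_zero_iff] at this
    rw [this]

theorem path_ne_nil (T : BTree X) (i j : X) : T.path i j ≠ [] := by
  induction T with
  | leaf x => simp [path]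
  | node c l r hl hr =>
    rw [path]
    split_ifs <;> simp [hl, hr]

theorem nadir_of_path_eq_map {T T' : BTree X} {i j : X} {b : Bool}
    (h : T.path i j = (T'.path i j).map (b :: ·)) : T.nadir i j = b :: T'.nadir i j := by
  rw [nadir, h, argmin_length_map_cons, nadir]
  cases hm : (T'.path i j).argmin List.length with
  | none => exact absurd (List.argmin_eq_none.1 hm) (path_ne_nil _ _ _)
  | some m => rfl

theorem counterclockwise_of_path_eq_map {T T' : BTree X} {i j : X} {b : Bool}
    (h : T.path i j = (T'.path i j).map (b :: ·)) :
    T.Counterclockwise i j ↔ T'.Counterclockwise i j := by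
  rw [Counterclockwise, nadir_of_path_eq_map h, h, Counterclockwise]
  have : [b :: T'.nadir i j ++ [true], b :: T'.nadir i j, b :: T'.nadir i j ++ [false]] =
    [T'.nadir i j ++ [true], T'.nadir i j, T'.nadir i j ++ [false]].map (b :: ·) := by simp
  rw [this]
  constructor
  · rintro ⟨s, t, e⟩
    rw [eq_comm, List.map_eq_append_iff] at e
    obtain ⟨u, v, huv, hu, rfl⟩ := e
    rw [List.map_eq_append_iff] at hu
    obtain ⟨u', w, rfl, rfl, hw⟩ := hu
    rw [List.map_injective_iff.2 (List.cons_injective) hw] at huv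
    exact ⟨u', v, huv.symm⟩
  · rintro ⟨s, t, e⟩
    exact ⟨s.map (b :: ·), t.map (b :: ·), by rw [← e]; simp⟩

variable {c : Color} {l r : BTree X} {i j : X}

theorem path_left (hi : i ∈ l.leaves) (hj : j ∈ l.leaves) :
    (node c l r).path i j = (l.path i j).map (false :: ·) := by
  rw [path, if_pos hi, if_pos hj]

theorem path_right (hi : i ∉ l.leaves) (hj : j ∉ l.leaves) :
    (node c l r).path i j = (r.path i j).map (true :: ·) := by
  rw [path, if_neg hi, if_neg hj]

theorem nadir_left (hi : i ∈ l.leaves) (hj : j ∈ l.leaves) :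
    (node c l r).nadir i j = false :: l.nadir i j :=
  nadir_of_path_eq_map (path_left hi hj)

theorem nadir_right (hi : i ∉ l.leaves) (hj : j ∉ l.leaves) :
    (node c l r).nadir i j = true :: r.nadir i j :=
  nadir_of_path_eq_map (path_right hi hj)

theorem nadir_left_right (hi : i ∈ l.leaves) (hj : j ∉ l.leaves) :
    (node c l r).nadir i j = [] := by
  rw [nadir, path, if_pos hi, if_neg hj, argmin_length_of_nil_mem (by simp)]
  rfl

theorem nadir_right_left (hi : i ∉ l.leaves) (hj : j ∈ l.leaves) :
    (node c l r).nadir i j = [] := by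
  rw [nadir, path, if_neg hi, if_pos hj, argmin_length_of_nil_mem (by simp)]
  rfl

theorem counterclockwise_left (hi : i ∈ l.leaves) (hj : j ∈ l.leaves) :
    (node c l r).Counterclockwise i j ↔ l.Counterclockwise i j :=
  counterclockwise_of_path_eq_map (path_left hi hj)

theorem counterclockwise_right (hi : i ∉ l.leaves) (hj : j ∉ l.leaves) :
    (node c l r).Counterclockwise i j ↔ r.Counterclockwise i j :=
  counterclockwise_of_path_eq_map (path_right hi hj)

theorem upPath_eq_append (T : BTree X) (i : X) : ∃ L, T.upPath i = L ++ [[]] := by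
  cases T with
  | leaf x => exact ⟨[], rfl⟩
  | node c l r =>
    rw [upPath]
    split_ifs
    exacts [⟨_, rfl⟩, ⟨_, rfl⟩]

theorem not_counterclockwise_left_right (hi : i ∈ l.leaves) (hj : j ∉ l.leaves) :
    ¬ (node c l r).Counterclockwise i j := by
  rw [Counterclockwise, nadir_left_right hi hj, path, if_pos hi, if_neg hj]
  rintro ⟨s, t, e⟩
  -- The vertex `[]` occurs in the path only once, after vertices in the left subtree.
  have h1 : (s ++ [[true]]) ++ [] :: ([[false]] ++ t) =
      (l.upPath i).map (false :: ·) ++ [] :: (r.upPath j).reverse.map (true :: ·) := by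
    simpa using e
  rcases List.append_eq_append_iff.1 h1 with ⟨u, hu, hu'⟩ | ⟨u, hu, hu'⟩
  · have hm : [true] ∈ (l.upPath i).map (false :: ·) := by rw [hu]; simp
    simp at hm
  · cases u with
    | nil =>
      rw [List.append_nil] at hu
      have hm : [true] ∈ (l.upPath i).map (false :: ·) := by rw [← hu]; simp
      simp at hm
    | cons a u =>
      rw [List.cons_append, List.cons.injEq] at hu'
      have hm : [] ∈ (r.upPath j).reverse.map (true :: ·) := by rw [hu'.2]; simp
      simp at hm

theorem counterclockwise_right_left (hi : i ∉ l.leaves) (hj : j ∈ l.leaves) :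
    (node c l r).Counterclockwise i j := by
  rw [Counterclockwise, nadir_right_left hi hj, path, if_neg hi, if_pos hj]
  obtain ⟨L, hL⟩ := r.upPath_eq_append i
  obtain ⟨M, hM⟩ := l.upPath_eq_append j
  rw [hL, hM]
  exact ⟨L.map (true :: ·), M.reverse.map (false :: ·), by simp⟩

theorem nadir_comm (T : BTree X) (hi : i ∈ T.leaves) (hj : j ∈ T.leaves) :
    T.nadir i j = T.nadir j i := by
  induction T with
  | leaf x =>
    simp only [leaves, List.mem_singleton] at hi hj
    rw [hi, hj]
  | node c l r hl hr =>
    rw [leaves, List.mem_append] at hi hj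
    by_cases hi' : i ∈ l.leaves <;> by_cases hj' : j ∈ l.leaves
    · rw [nadir_left hi' hj', nadir_left hj' hi', hl hi' hj']
    · rw [nadir_left_right hi' hj', nadir_right_left hj' hi']
    · rw [nadir_left_right hj' hi', nadir_right_left hi' hj']
    · rw [nadir_right hi' hj', nadir_right hj' hi',
        hr (hi.resolve_left hi') (hj.resolve_left hj')]

theorem counterclockwise_swap (T : BTree X) (hi : i ∈ T.leaves) (hj : j ∈ T.leaves)
    (hne : i ≠ j) : T.Counterclockwise j i ↔ ¬ T.Counterclockwise i j := by
  induction T with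
  | leaf x =>
    simp only [leaves, List.mem_singleton] at hi hj
    exact absurd (hi.trans hj.symm) hne
  | node c l r hl hr =>
    rw [leaves, List.mem_append] at hi hj
    by_cases hi' : i ∈ l.leaves <;> by_cases hj' : j ∈ l.leaves
    · rw [counterclockwise_left hi' hj', counterclockwise_left hj' hi', hl hi' hj']
    · exact iff_of_true (counterclockwise_right_left hj' hi')
        (not_counterclockwise_left_right hi' hj')
    · exact iff_of_false (not_counterclockwise_left_right hj' hi')
        (not_not.2 (counterclockwise_right_left hi' hj'))
    · rw [counterclockwise_right hi' hj', counterclockwise_right hj' hi',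
        hr (hi.resolve_left hi') (hj.resolve_left hj')]

/-- Of the three leaves, `i` and `j` meet first: the paths between `k` and these two have the same
nadir and pass it in the same direction. -/
def MeetFirst (T : BTree X) (i j k : X) : Prop :=
  T.nadir j k = T.nadir k i ∧ T.nadir i j ≠ T.nadir j k ∧
    (T.Counterclockwise k i ↔ ¬ T.Counterclockwise j k)

theorem meetFirst_cases (T : BTree X) {k : X} (hi : i ∈ T.leaves) (hj : j ∈ T.leaves)
    (hk : k ∈ T.leaves) (hij : i ≠ j) :
    T.MeetFirst i j k ∨ T.MeetFirst j k i ∨ T.MeetFirst k i j := by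
  induction T with
  | leaf x =>
    simp only [leaves, List.mem_singleton] at hi hj
    exact absurd (hi.trans hj.symm) hij
  | node c l r hl hr =>
    rw [leaves, List.mem_append] at hi hj hk
    by_cases hi' : i ∈ l.leaves <;> by_cases hj' : j ∈ l.leaves <;> by_cases hk' : k ∈ l.leaves
    · simpa [MeetFirst, nadir_left, counterclockwise_left, hi', hj', hk'] using hl hi' hj' hk'
    · simp [MeetFirst, nadir_left, nadir_left_right, nadir_right_left,
        not_counterclockwise_left_right, counterclockwise_right_left, hi', hj', hk']
    · simp [MeetFirst, nadir_left, nadir_left_right, nadir_right_left,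
        not_counterclockwise_left_right, counterclockwise_right_left, hi', hj', hk']
    · simp [MeetFirst, nadir_right, nadir_left_right, nadir_right_left,
        not_counterclockwise_left_right, counterclockwise_right_left, hi', hj', hk']
    · simp [MeetFirst, nadir_left, nadir_left_right, nadir_right_left,
        not_counterclockwise_left_right, counterclockwise_right_left, hi', hj', hk']
    · simp [MeetFirst, nadir_right, nadir_left_right, nadir_right_left,
        not_counterclockwise_left_right, counterclockwise_right_left, hi', hj', hk']
    · simp [MeetFirst, nadir_right, nadir_left_right, nadir_right_left,
        not_counterclockwise_left_right, counterclockwise_right_left, hi', hj', hk']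
    · simpa [MeetFirst, nadir_right, counterclockwise_right, hi', hj', hk'] using
        hr (hi.resolve_left hi') (hj.resolve_left hj') (hk.resolve_left hk')

end Nadir

/-! ### The pairing as a product of signs -/

section Nodes

variable {X : Type*}

/-- The internal vertices of a tree with their colours. -/
def nodes : BTree X → Multiset (List Bool × Color)
  | leaf _ => 0
  | node c l r => ([], c) ::ₘ
      (l.nodes.map (fun v => (false :: v.1, v.2)) + r.nodes.map (fun v => (true :: v.1, v.2)))

theorem mem_nodes {T : BTree X} {v : List Bool} {c : Color} :
    (v, c) ∈ T.nodes ↔ T.colorAt v = some c := by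
  induction T generalizing v with
  | leaf x => simp [nodes, colorAt]
  | node d l r hl hr =>
    rcases v with _ | ⟨_ | _, v⟩
    · simp [nodes, colorAt, eq_comm]
    · simp [nodes, colorAt, hl]
    · simp [nodes, colorAt, hr]

theorem nodup_nodes_fst (T : BTree X) : (T.nodes.map Prod.fst).Nodup := by
  induction T with
  | leaf x => simp [nodes]
  | node d l r hl hr =>
    have e : (node d l r).nodes.map Prod.fst = [] ::ₘ ((l.nodes.map Prod.fst).map (false :: ·) +
        (r.nodes.map Prod.fst).map (true :: ·)) := by
      simp [nodes, Multiset.map_map]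
    rw [e, Multiset.nodup_cons, Multiset.nodup_add]
    refine ⟨by simp, hl.map List.cons_injective, hr.map List.cons_injective, ?_⟩
    rw [Multiset.disjoint_left]
    intro v hv hv'
    obtain ⟨a, -, rfl⟩ := Multiset.mem_map.1 hv
    obtain ⟨b, -, h⟩ := Multiset.mem_map.1 hv'
    simp at h

variable [DecidableEq X]

/-- The nadir of an edge and the colour of the edge. -/
def mark (T : BTree X) (e : OEdge X) : List Bool × Color := (T.nadir e.src e.dst, e.color)

open Classical in
/-- The contribution of an edge to the sign of the pairing. -/
noncomputable def sgn (R : Type*) [CommRing R] (T : BTree X) (e : OEdge X) : R :=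
  if T.Counterclockwise e.src e.dst then -1 else 1

/-- The condition in the definition of the pairing says that the marks of the edges are the internal
vertices with their colours, each of them exactly once. -/
theorem bijOn_iff (T : BTree X) (G : OGraph X) :
    (Set.BijOn (fun e : G => T.nadir e.1.src e.1.dst) Set.univ T.internal ∧
      ∀ e ∈ G, T.colorAt (T.nadir e.src e.dst) = some e.color) ↔ G.map T.mark = T.nodes := by
  have hmap : (Finset.univ.val.map fun e : G => T.nadir e.1.src e.1.dst) =
      G.map fun e => T.nadir e.src e.dst := by
    conv_rhs => rw [← Multiset.map_univ_coe G]
    rw [Multiset.map_map]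
    rfl
  have hfst : (G.map T.mark).map Prod.fst = G.map fun e => T.nadir e.src e.dst := by
    rw [Multiset.map_map]
    rfl
  have hinj : Set.InjOn (fun e : G => T.nadir e.1.src e.1.dst) Set.univ ↔
      (G.map fun e => T.nadir e.src e.dst).Nodup := by
    rw [← hmap, Multiset.nodup_map_iff_inj_on Finset.univ.nodup]
    simp [Set.InjOn]
  have hnodes : T.nodes.Nodup := T.nodup_nodes_fst.of_map _
  constructor
  · rintro ⟨⟨-, h2, h3⟩, h4⟩
    have hn : (G.map T.mark).Nodup := by
      refine Multiset.Nodup.of_map Prod.fst ?_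
      rw [hfst, ← hinj]
      exact h2
    rw [Multiset.Nodup.ext hn hnodes]
    rintro ⟨v, c⟩
    rw [mem_nodes, Multiset.mem_map]
    constructor
    · rintro ⟨e, he, h⟩
      rw [mark, Prod.mk.injEq] at h
      rw [← h.1, ← h.2]
      exact h4 e he
    · intro hv
      obtain ⟨e, -, he⟩ := h3 (show v ∈ T.internal by simp [internal, hv])
      refine ⟨e.1, Multiset.coe_mem, ?_⟩
      have := h4 e.1 Multiset.coe_mem
      simp only at he
      rw [he, hv, Option.some_inj] at this
      rw [mark, he, this]
  · intro h
    have h4 : ∀ e ∈ G, T.colorAt (T.nadir e.src e.dst) = some e.color := by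
      intro e he
      rw [← mem_nodes, ← h]
      exact Multiset.mem_map_of_mem T.mark he
    refine ⟨⟨?_, ?_, ?_⟩, h4⟩
    · intro e _
      simp [internal, h4 e.1 Multiset.coe_mem]
    · rw [hinj, ← hfst, h]
      exact T.nodup_nodes_fst
    · intro v hv
      obtain ⟨c, hc⟩ := Option.ne_none_iff_exists'.1 hv
      rw [← mem_nodes, ← h, Multiset.mem_map] at hc
      obtain ⟨e, he, hm⟩ := hc
      rw [← Multiset.map_univ_coe G, Multiset.mem_map] at he
      obtain ⟨e', -, rfl⟩ := he
      exact ⟨e', trivial, (Prod.mk.injEq _ _ _ _ ▸ hm).1⟩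

open Classical in
theorem pairing_eq (R : Type*) [CommRing R] (T : BTree X) (G : OGraph X) :
    pairing R G T = if G.map T.mark = T.nodes then (G.map (T.sgn R)).prod else 0 := by
  have hs : (-1 : R) ^ G.countP (fun e => T.Counterclockwise e.src e.dst) =
      (G.map (T.sgn R)).prod := by
    induction G using Multiset.induction with
    | empty => simp
    | cons e G ih =>
      rw [Multiset.map_cons, Multiset.prod_cons, ← ih, sgn]
      split_ifs with h
      · rw [Multiset.countP_cons_of_pos
          (p := fun e : OEdge X => T.Counterclockwise e.src e.dst) _ h, pow_succ']
      · rw [Multiset.countP_cons_of_neg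
          (p := fun e : OEdge X => T.Counterclockwise e.src e.dst) _ h, one_mul]
  rw [pairing, hs]
  exact if_congr (T.bijOn_iff G) rfl rfl

end Nodes

end BTree

/-! ### The pairing vanishes on the relations between graphs -/

section EilSide

variable (R : Type*) [CommRing R] {X : Type*} [DecidableEq X]

/-- The pairing with a fixed tree, as a linear form in the graph. -/
noncomputable def pairingForm (T : BTree X) : Gam R X →ₗ[R] R :=
  Finsupp.linearCombination R fun G => pairing R G T

variable {R}

theorem pairingForm_gr (T : BTree X) (G : OGraph X) :
    pairingForm R T (gr R G) = pairing R G T := by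
  simp [pairingForm, gr]

namespace BTree

theorem sgn_of_not_iff {T : BTree X} {e f : OEdge X}
    (h : T.Counterclockwise e.src e.dst ↔ ¬ T.Counterclockwise f.src f.dst) :
    T.sgn R e = - T.sgn R f := by
  rw [sgn, sgn]
  split_ifs with h1 h2 h2
  · exact absurd h2 (h.1 h1)
  · rfl
  · simp
  · exact absurd (h.2 h2) h1

theorem pairing_eq_zero_of_not_nodup {T : BTree X} {G : OGraph X}
    (h : ¬ ((G.map T.mark).map Prod.fst).Nodup) : pairing R G T = 0 := by
  rw [pairing_eq, if_neg]
  intro h'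
  exact h (h' ▸ T.nodup_nodes_fst)

/-- Two graphs that agree up to two edges with the same marks but with opposite signs have opposite
pairings with the tree. -/
theorem pairing_add_pairing_eq_zero {T : BTree X} {G : OGraph X} {e f e' f' : OEdge X}
    (h : (T.mark e = T.mark e' ∧ T.mark f = T.mark f') ∨
      (T.mark e = T.mark f' ∧ T.mark f = T.mark e'))
    (hs : T.sgn R e * T.sgn R f = - (T.sgn R e' * T.sgn R f')) :
    pairing R (e ::ₘ f ::ₘ G) T + pairing R (e' ::ₘ f' ::ₘ G) T = 0 := by
  have hm : (e ::ₘ f ::ₘ G).map T.mark = (e' ::ₘ f' ::ₘ G).map T.mark := by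
    simp only [Multiset.map_cons]
    rcases h with ⟨h1, h2⟩ | ⟨h1, h2⟩
    · rw [h1, h2]
    · rw [h1, h2, Multiset.cons_swap]
  rw [pairing_eq, pairing_eq, hm]
  split_ifs
  · simp only [Multiset.map_cons, Multiset.prod_cons]
    linear_combination hs * (G.map (T.sgn R)).prod
  · simp

theorem pairing_cons_flip {T : BTree X} (hT : T.IsMultilinear) (G : OGraph X) (e : OEdge X) :
    pairing R (e ::ₘ G) T + pairing R (e.flip ::ₘ G) T = 0 := by
  have hm : T.mark e.flip = T.mark e := by
    rw [mark, mark, OEdge.flip, T.nadir_comm (hT.2 _) (hT.2 _)]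
  have hs : T.sgn R e.flip = - T.sgn R e :=
    sgn_of_not_iff (T.counterclockwise_swap (hT.2 _) (hT.2 _) e.ne)
  rw [pairing_eq, pairing_eq]
  simp only [Multiset.map_cons, Multiset.prod_cons, hm, hs]
  split_ifs <;> ring

variable {T : BTree X} {i j k : X}

theorem MeetFirst.pairing_eq_zero (h : T.MeetFirst i j k) (G : OGraph X) (c d : Color)
    (hjk : j ≠ k) (hki : k ≠ i) : pairing R (addTwo G c d j k i hjk hki) T = 0 := by
  refine pairing_eq_zero_of_not_nodup fun hn => ?_
  simp only [addTwo, Multiset.map_cons, Multiset.nodup_cons, Multiset.mem_cons, mark] at hn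
  exact hn.1 (Or.inl h.1)

theorem MeetFirst.pairing_add_pairing (h : T.MeetFirst i j k) (G : OGraph X) (c d : Color)
    (hij : i ≠ j) (hjk : j ≠ k) (hki : k ≠ i) :
    pairing R (addTwo G c d i j k hij hjk) T + pairing R (addTwo G d c k i j hki hij) T = 0 := by
  refine pairing_add_pairing_eq_zero (Or.inr ⟨rfl, ?_⟩) ?_
  · rw [mark, mark, h.1]
  · have hs : T.sgn R ⟨k, i, d, hki⟩ = - T.sgn R ⟨j, k, d, hjk⟩ := sgn_of_not_iff h.2.2
    rw [hs]
    ring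

theorem MeetFirst.cyclic (h : T.MeetFirst i j k) (G : OGraph X) (c d : Color)
    (hij : i ≠ j) (hjk : j ≠ k) (hki : k ≠ i) :
    pairing R (addTwo G c d i j k hij hjk) T + pairing R (addTwo G c d j k i hjk hki) T +
      pairing R (addTwo G c d k i j hki hij) T +
      (pairing R (addTwo G d c i j k hij hjk) T + pairing R (addTwo G d c j k i hjk hki) T +
      pairing R (addTwo G d c k i j hki hij) T) = 0 := by
  have h1 := h.pairing_add_pairing (R := R) G c d hij hjk hki
  have h2 := h.pairing_add_pairing (R := R) G d c hij hjk hki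
  rw [h.pairing_eq_zero, h.pairing_eq_zero]
  linear_combination h1 + h2

/-- Both Jacobi relations for graphs, the pure ones (for `c = d`) counted twice. -/
theorem pairing_cyclic (hT : T.IsMultilinear) (G : OGraph X) (c d : Color)
    (hij : i ≠ j) (hjk : j ≠ k) (hki : k ≠ i) :
    pairing R (addTwo G c d i j k hij hjk) T + pairing R (addTwo G c d j k i hjk hki) T +
      pairing R (addTwo G c d k i j hki hij) T +
      (pairing R (addTwo G d c i j k hij hjk) T + pairing R (addTwo G d c j k i hjk hki) T +
      pairing R (addTwo G d c k i j hki hij) T) = 0 := by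
  rcases T.meetFirst_cases (hT.2 i) (hT.2 j) (hT.2 k) hij with h | h | h
  · exact h.cyclic G c d hij hjk hki
  · linear_combination h.cyclic (R := R) G c d hjk hki hij
  · linear_combination h.cyclic (R := R) G c d hki hij hjk

theorem pairing_cyclic_self (hT : T.IsMultilinear) (G : OGraph X) (c : Color)
    (hij : i ≠ j) (hjk : j ≠ k) (hki : k ≠ i) :
    pairing R (addTwo G c c i j k hij hjk) T + pairing R (addTwo G c c j k i hjk hki) T +
      pairing R (addTwo G c c k i j hki hij) T = 0 := by
  rcases T.meetFirst_cases (hT.2 i) (hT.2 j) (hT.2 k) hij with h | h | h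
  · linear_combination h.pairing_add_pairing (R := R) G c c hij hjk hki +
      h.pairing_eq_zero (R := R) G c c hjk hki
  · linear_combination h.pairing_add_pairing (R := R) G c c hjk hki hij +
      h.pairing_eq_zero (R := R) G c c hki hij
  · linear_combination h.pairing_add_pairing (R := R) G c c hki hij hjk +
      h.pairing_eq_zero (R := R) G c c hij hjk

theorem pairing_of_hasMultipleEdge (hT : T.IsMultilinear) {G : OGraph X}
    (h : G.HasMultipleEdge) : pairing R G T = 0 := by
  classical
  obtain ⟨i, j, hc⟩ := h
  refine pairing_eq_zero_of_not_nodup fun hn => ?_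
  rw [Multiset.countP_eq_card_filter] at hc
  have hrep : ((G.filter fun e => (e.src = i ∧ e.dst = j) ∨ (e.src = j ∧ e.dst = i)).map
      T.mark).map Prod.fst = Multiset.replicate (G.filter fun e =>
        (e.src = i ∧ e.dst = j) ∨ (e.src = j ∧ e.dst = i)).card (T.nadir i j) := by
    rw [Multiset.eq_replicate]
    refine ⟨by simp, fun v hv => ?_⟩
    simp only [Multiset.mem_map, Multiset.mem_filter] at hv
    obtain ⟨a, ⟨e, ⟨-, h | h⟩, rfl⟩, rfl⟩ := hv
    · rw [mark, h.1, h.2]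
    · rw [mark, h.1, h.2, T.nadir_comm (hT.2 _) (hT.2 _)]
  have hle := Multiset.nodup_of_le (Multiset.map_le_map (f := Prod.fst) (Multiset.map_le_map
    (f := T.mark) (Multiset.filter_le (fun e : OEdge X =>
      (e.src = i ∧ e.dst = j) ∨ (e.src = j ∧ e.dst = i)) G))) hn
  rw [hrep, Multiset.nodup_iff_count_le_one] at hle
  have := hle (T.nadir i j)
  rw [Multiset.count_replicate_self] at this
  refine absurd hc (not_lt.2 (le_of_eq_of_le ?_ this))
  congr!

/-- If every internal vertex of a tree is the nadir of an edge of the graph `G`, then all leaves of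
the tree are connected by edges of `G`. -/
theorem reachable_of_colorAt (T : BTree X) (hT : T.leaves.Nodup) (G : OGraph X)
    (h : ∀ v, T.colorAt v ≠ none → ∃ e ∈ G, e.src ∈ T.leaves ∧ e.dst ∈ T.leaves ∧
      T.nadir e.src e.dst = v) :
    ∀ i ∈ T.leaves, ∀ j ∈ T.leaves, (SimpleGraph.fromRel fun i j : X =>
      ∃ e ∈ G, e.src = i ∧ e.dst = j).Reachable i j := by
  induction T with
  | leaf x =>
    intro i hi j hj
    simp only [leaves, List.mem_singleton] at hi hj
    rw [hi, hj]
  | node c l r hl hr =>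
    obtain ⟨nl, nr, hd⟩ := List.nodup_append'.1 hT
    have nadir_cases : ∀ {x y}, x ∈ (node c l r).leaves → y ∈ (node c l r).leaves →
        (x ∈ l.leaves ∧ y ∈ l.leaves ∧ (node c l r).nadir x y = false :: l.nadir x y) ∨
        (x ∈ r.leaves ∧ y ∈ r.leaves ∧ (node c l r).nadir x y = true :: r.nadir x y) ∨
        (((x ∈ l.leaves ∧ y ∈ r.leaves) ∨ (x ∈ r.leaves ∧ y ∈ l.leaves)) ∧
          (node c l r).nadir x y = []) := by
      intro x y hx hy
      rw [leaves, List.mem_append] at hx hy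
      by_cases hx' : x ∈ l.leaves <;> by_cases hy' : y ∈ l.leaves
      · exact Or.inl ⟨hx', hy', nadir_left hx' hy'⟩
      · exact Or.inr (Or.inr ⟨Or.inl ⟨hx', hy.resolve_left hy'⟩, nadir_left_right hx' hy'⟩)
      · exact Or.inr (Or.inr ⟨Or.inr ⟨hx.resolve_left hx', hy'⟩, nadir_right_left hx' hy'⟩)
      · exact Or.inr (Or.inl ⟨hx.resolve_left hx', hy.resolve_left hy', nadir_right hx' hy'⟩)
    have Hl := hl nl fun v hv => by
      obtain ⟨e, he, h1, h2, h3⟩ := h (false :: v) hv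
      rcases nadir_cases h1 h2 with ⟨a, b, e'⟩ | ⟨-, -, e'⟩ | ⟨-, e'⟩
      · rw [e', List.cons.injEq] at h3
        exact ⟨e, he, a, b, h3.2⟩
      all_goals simp [e'] at h3
    have Hr := hr nr fun v hv => by
      obtain ⟨e, he, h1, h2, h3⟩ := h (true :: v) hv
      rcases nadir_cases h1 h2 with ⟨-, -, e'⟩ | ⟨a, b, e'⟩ | ⟨-, e'⟩
      · simp [e'] at h3
      · rw [e', List.cons.injEq] at h3
        exact ⟨e, he, a, b, h3.2⟩
      · simp [e'] at h3
    -- The edge at the root connects the leaves on the left to the leaves on the right.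
    have Hlr : ∀ i ∈ l.leaves, ∀ j ∈ r.leaves, (SimpleGraph.fromRel fun i j : X =>
        ∃ e ∈ G, e.src = i ∧ e.dst = j).Reachable i j := by
      intro i hi j hj
      obtain ⟨e, he, h1, h2, h3⟩ := h [] (by simp [colorAt])
      have hadj : (SimpleGraph.fromRel fun i j : X =>
          ∃ e ∈ G, e.src = i ∧ e.dst = j).Adj e.src e.dst :=
        (SimpleGraph.fromRel_adj _ _ _).2 ⟨e.ne, Or.inl ⟨e, he, rfl, rfl⟩⟩
      rcases nadir_cases h1 h2 with ⟨-, -, e'⟩ | ⟨-, -, e'⟩ | ⟨⟨a, b⟩ | ⟨a, b⟩, -⟩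
      · simp [e'] at h3
      · simp [e'] at h3
      · exact ((Hl _ hi _ a).trans hadj.reachable).trans (Hr _ b _ hj)
      · exact ((Hl _ hi _ b).trans hadj.symm.reachable).trans (Hr _ a _ hj)
    intro i hi j hj
    rw [leaves, List.mem_append] at hi hj
    rcases hi with hi | hi <;> rcases hj with hj | hj
    · exact Hl i hi j hj
    · exact Hlr i hi j hj
    · exact (Hlr j hj i hi).symm
    · exact Hr i hi j hj

theorem pairing_of_not_isConnected (hT : T.IsMultilinear) {G : OGraph X}
    (h : ¬ G.IsConnected) : pairing R G T = 0 := by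
  rw [pairing_eq, if_neg]
  intro hm
  refine h ?_
  have hne : Nonempty X := by
    obtain ⟨x, hx⟩ : ∃ x, x ∈ T.leaves := List.exists_mem_of_length_pos T.leaves_length_pos
    exact ⟨x⟩
  refine @SimpleGraph.Connected.mk _ _ (fun i j => ?_) hne
  refine T.reachable_of_colorAt hT.1 G (fun v hv => ?_) i (hT.2 i) j (hT.2 j)
  obtain ⟨c, hc⟩ := Option.ne_none_iff_exists'.1 hv
  rw [← mem_nodes, ← hm, Multiset.mem_map] at hc
  obtain ⟨e, he, hv⟩ := hc
  exact ⟨e, he, hT.2 _, hT.2 _, congrArg Prod.fst hv⟩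

end BTree

theorem eilRelations_le_ker_pairingForm {T : BTree X} (hT : T.IsMultilinear) :
    eilRelations R X ≤ LinearMap.ker (pairingForm R T) := by
  rw [eilRelations, Submodule.span_le]
  rintro x ((((⟨G, e, rfl⟩ | ⟨G, c, i, j, k, hij, hjk, hki, rfl⟩) |
    ⟨G, i, j, k, hij, hjk, hki, rfl⟩) | ⟨G, h, rfl⟩) | ⟨G, h, rfl⟩)
  all_goals simp only [SetLike.mem_coe, LinearMap.mem_ker, map_add, cyclicSum, pairingForm_gr]
  · exact BTree.pairing_cons_flip hT G e
  · exact BTree.pairing_cyclic_self hT G c hij hjk hki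
  · exact BTree.pairing_cyclic hT G _ _ hij hjk hki
  · exact BTree.pairing_of_hasMultipleEdge hT h
  · exact BTree.pairing_of_not_isConnected hT h

end EilSide

/-! ### Matchings and marks -/

namespace BTree

variable {X : Type*} {c : Color} {l r : BTree X}

/-- The edge `e` connects a leaf of `l` to a leaf of `r`. -/
def Crosses (l r : BTree X) (e : OEdge X) : Prop :=
  (e.src ∈ l.leaves ∧ e.dst ∈ r.leaves) ∨ (e.src ∈ r.leaves ∧ e.dst ∈ l.leaves)

theorem mem_matchings_node {G : OGraph X} : G ∈ (node c l r).matchings ↔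
    ∃ e : OEdge X, ∃ G₁ ∈ l.matchings, ∃ G₂ ∈ r.matchings, e.color = c ∧ Crosses l r e ∧
      G = e ::ₘ (G₁ + G₂) := Iff.rfl

section Disjoint

variable (hd : l.leaves.Disjoint r.leaves) {e : OEdge X}

include hd

theorem Crosses.not_left (h : Crosses l r e) : ¬ (e.src ∈ l.leaves ∧ e.dst ∈ l.leaves) := by
  rintro ⟨h1, h2⟩
  rcases h with ⟨-, h⟩ | ⟨h, -⟩
  · exact hd h2 h
  · exact hd h1 h

theorem Crosses.not_right (h : Crosses l r e) : ¬ (e.src ∈ r.leaves ∧ e.dst ∈ r.leaves) := by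
  rintro ⟨h1, h2⟩
  rcases h with ⟨h, -⟩ | ⟨-, h⟩
  · exact hd h h1
  · exact hd h h2

omit hd in
theorem leaves_cases (hs : e.src ∈ (node c l r).leaves) (ht : e.dst ∈ (node c l r).leaves) :
    Crosses l r e ∨ (e.src ∈ l.leaves ∧ e.dst ∈ l.leaves) ∨
      (e.src ∈ r.leaves ∧ e.dst ∈ r.leaves) := by
  rw [leaves, List.mem_append] at hs ht
  rw [Crosses]
  tauto

variable [DecidableEq X]

theorem Crosses.mark_eq (h : Crosses l r e) : (node c l r).mark e = ([], e.color) := by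
  rw [mark]
  rcases h with ⟨h1, h2⟩ | ⟨h1, h2⟩
  · rw [nadir_left_right h1 fun h => hd h h2]
  · rw [nadir_right_left (fun h => hd h h1) h2]

omit hd in
theorem mark_left (h : e.src ∈ l.leaves ∧ e.dst ∈ l.leaves) :
    (node c l r).mark e = (false :: (l.mark e).1, (l.mark e).2) := by
  rw [mark, nadir_left h.1 h.2, mark]

theorem mark_right (h : e.src ∈ r.leaves ∧ e.dst ∈ r.leaves) :
    (node c l r).mark e = (true :: (r.mark e).1, (r.mark e).2) := by
  rw [mark, nadir_right (fun h' => hd h' h.1) (fun h' => hd h' h.2), mark]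

omit hd in
theorem sgn_left (R : Type*) [CommRing R] (h : e.src ∈ l.leaves ∧ e.dst ∈ l.leaves) :
    (node c l r).sgn R e = l.sgn R e := by
  rw [sgn, sgn, counterclockwise_left h.1 h.2]

theorem sgn_right (R : Type*) [CommRing R] (h : e.src ∈ r.leaves ∧ e.dst ∈ r.leaves) :
    (node c l r).sgn R e = r.sgn R e := by
  rw [sgn, sgn, counterclockwise_right (fun h' => hd h' h.1) (fun h' => hd h' h.2)]

end Disjoint

/-- The recursive description of the matchings agrees with the condition in the definition of the
pairing. -/
theorem mem_matchings_iff [DecidableEq X] (T : BTree X) (hT : T.leaves.Nodup) {G : OGraph X}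
    (hG : ∀ e ∈ G, e.src ∈ T.leaves ∧ e.dst ∈ T.leaves) :
    G ∈ T.matchings ↔ G.map T.mark = T.nodes := by
  classical
  induction T generalizing G with
  | leaf x => simp [matchings, nodes]
  | node c l r hl hr =>
    obtain ⟨nl, nr, hd⟩ := List.nodup_append'.1 hT
    have mapl : ∀ G₁ : OGraph X, (∀ e ∈ G₁, e.src ∈ l.leaves ∧ e.dst ∈ l.leaves) →
        G₁.map (node c l r).mark = (G₁.map l.mark).map fun v => (false :: v.1, v.2) := by
      intro G₁ h
      rw [Multiset.map_map]
      exact Multiset.map_congr rfl fun e he => mark_left (h e he)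
    have mapr : ∀ G₂ : OGraph X, (∀ e ∈ G₂, e.src ∈ r.leaves ∧ e.dst ∈ r.leaves) →
        G₂.map (node c l r).mark = (G₂.map r.mark).map fun v => (true :: v.1, v.2) := by
      intro G₂ h
      rw [Multiset.map_map]
      exact Multiset.map_congr rfl fun e he => mark_right hd (h e he)
    constructor
    · rintro ⟨e, G₁, h₁, G₂, h₂, rfl, hc, rfl⟩
      have i₁ := fun e he => mem_leaves_of_mem_matchings (e := e) h₁ he
      have i₂ := fun e he => mem_leaves_of_mem_matchings (e := e) h₂ he
      rw [Multiset.map_cons, Multiset.map_add, Crosses.mark_eq hd hc, mapl _ i₁, mapr _ i₂,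
        (hl nl i₁).1 h₁, (hr nr i₂).1 h₂, nodes]
    · intro h
      have h0 : ([], c) ∈ G.map (node c l r).mark := by
        rw [h, nodes]; exact Multiset.mem_cons_self _ _
      obtain ⟨e, he, hm⟩ := Multiset.mem_map.1 h0
      obtain ⟨G', rfl⟩ := Multiset.exists_cons_of_mem he
      rw [Multiset.map_cons, hm, nodes, Multiset.cons_inj_right] at h
      have hin := fun f hf => hG f (Multiset.mem_cons_of_mem hf)
      have hsplit : ∀ f ∈ G', (f.src ∈ l.leaves ∧ f.dst ∈ l.leaves) ∨
          (f.src ∈ r.leaves ∧ f.dst ∈ r.leaves) := by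
        intro f hf
        refine (leaves_cases (hin f hf).1 (hin f hf).2).resolve_left fun hc => ?_
        have hf' : (node c l r).mark f ∈ G'.map (node c l r).mark := Multiset.mem_map_of_mem _ hf
        rw [h, Crosses.mark_eq hd hc] at hf'
        simp at hf'
      have hec : Crosses l r e := by
        rcases leaves_cases (hG e he).1 (hG e he).2 with h | h | h
        · exact h
        · simp [mark_left h] at hm
        · simp [mark_right hd h] at hm
      set p : OEdge X → Prop := fun f => f.src ∈ l.leaves ∧ f.dst ∈ l.leaves with hp
      have i₁ : ∀ f ∈ G'.filter p, f.src ∈ l.leaves ∧ f.dst ∈ l.leaves :=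
        fun f hf => (Multiset.mem_filter.1 hf).2
      have i₂ : ∀ f ∈ G'.filter fun f => ¬ p f, f.src ∈ r.leaves ∧ f.dst ∈ r.leaves :=
        fun f hf => (hsplit f (Multiset.mem_filter.1 hf).1).resolve_left
          (Multiset.mem_filter.1 hf).2
      have hG' := Multiset.filter_add_not p G'
      rw [← hG', Multiset.map_add, mapl _ i₁, mapr _ i₂] at h
      -- Vertices in the two subtrees are told apart by the first turn of their addresses.
      have hleft := congrArg (Multiset.filter fun v : List Bool × Color => v.1.head? = some false) h
      have hright := congrArg (Multiset.filter fun v : List Bool × Color => v.1.head? = some true) h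
      have fl : ∀ (b : Bool) (M : Multiset (List Bool × Color)),
          (M.map fun v => (b :: v.1, v.2)).filter (fun v => v.1.head? = some b) =
            M.map fun v => (b :: v.1, v.2) := by
        intro b M
        refine Multiset.filter_eq_self.2 fun v hv => ?_
        obtain ⟨w, -, rfl⟩ := Multiset.mem_map.1 hv
        rfl
      have fr : ∀ (b b' : Bool) (M : Multiset (List Bool × Color)), b ≠ b' →
          (M.map fun v => (b :: v.1, v.2)).filter (fun v => v.1.head? = some b') = 0 := by
        intro b b' M hb
        refine Multiset.filter_eq_nil.2 fun v hv => ?_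
        obtain ⟨w, -, rfl⟩ := Multiset.mem_map.1 hv
        simpa using hb
      have inj : ∀ b : Bool, Function.Injective fun v : List Bool × Color => (b :: v.1, v.2) := by
        rintro b ⟨v, d⟩ ⟨v', d'⟩ h
        simpa using h
      rw [Multiset.filter_add, Multiset.filter_add, fl, fl, fr true false _ (by simp),
        fr true false _ (by simp), add_zero, add_zero,
        (Multiset.map_injective (inj false)).eq_iff] at hleft
      rw [Multiset.filter_add, Multiset.filter_add, fl, fl, fr false true _ (by simp),
        fr false true _ (by simp), zero_add, zero_add,
        (Multiset.map_injective (inj true)).eq_iff] at hright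
      exact ⟨e, _, (hl nl i₁).2 hleft, _, (hr nr i₂).2 hright, congrArg Prod.snd hm, hec,
        by rw [hG']⟩

end BTree

/-! ### The generating function of the pairings with a tree -/

section GenFun

variable (R : Type*) [CommRing R] {X : Type*} [DecidableEq X] [Fintype X]

/-- The signed sum of all edges of colour `c` between the letters of `m` and the letters of `m'`,
counted with multiplicity: plus for the edges from `m` to `m'`, minus for the reversed ones. This
is biadditive and antisymmetric in `m` and `m'`. -/
noncomputable def crossSum (c : Color) (m m' : Multiset X) : AddMonoidAlgebra R (OGraph X) :=
  ∑ e : OEdge X with e.color = c, AddMonoidAlgebra.single {e}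
    (((m.count e.src * m'.count e.dst - m'.count e.src * m.count e.dst : ℤ)) : R)

theorem crossSum_add_left (c : Color) (m₁ m₂ m' : Multiset X) :
    crossSum R c (m₁ + m₂) m' = crossSum R c m₁ m' + crossSum R c m₂ m' := by
  rw [crossSum, crossSum, crossSum, ← Finset.sum_add_distrib]
  refine Finset.sum_congr rfl fun e _ => ?_
  rw [← AddMonoidAlgebra.single_add]
  congr 1
  simp only [Multiset.count_add]
  push_cast
  ring

theorem crossSum_swap (c : Color) (m m' : Multiset X) :
    crossSum R c m' m = - crossSum R c m m' := by
  rw [crossSum, crossSum, ← Finset.sum_neg_distrib]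
  refine Finset.sum_congr rfl fun e _ => ?_
  rw [← AddMonoidAlgebra.single_neg]
  congr 1
  push_cast
  ring

theorem crossSum_add_right (c : Color) (m m₁ m₂ : Multiset X) :
    crossSum R c m (m₁ + m₂) = crossSum R c m m₁ + crossSum R c m m₂ := by
  rw [crossSum_swap, crossSum_add_left, crossSum_swap R c m m₁, crossSum_swap R c m m₂]
  ring

namespace BTree

/-- The generating function of the pairings of all graphs with the tree `T`: the product, over the
internal vertices, of the signed sums of the edges from the left to the right. -/
noncomputable def genFun : BTree X → AddMonoidAlgebra R (OGraph X)
  | leaf _ => 1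
  | node c l r => crossSum R c (l.leaves : Multiset X) (r.leaves : Multiset X) *
      (l.genFun * r.genFun)

variable {c : Color} {l r : BTree X}

theorem crossSum_leaves (nl : l.leaves.Nodup) (nr : r.leaves.Nodup)
    (hd : l.leaves.Disjoint r.leaves) [DecidablePred (Crosses l r)] :
    crossSum R c (l.leaves : Multiset X) (r.leaves : Multiset X) =
      ∑ e : OEdge X with e.color = c ∧ Crosses l r e,
        AddMonoidAlgebra.single {e} ((node c l r).sgn R e) := by
  rw [crossSum, ← Finset.filter_filter, Finset.sum_filter (Crosses l r)]
  refine Finset.sum_congr rfl fun e _ => ?_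
  simp only [Multiset.coe_count, nl.count, nr.count]
  by_cases h1 : e.src ∈ l.leaves <;> by_cases h2 : e.dst ∈ l.leaves <;>
    by_cases h3 : e.src ∈ r.leaves <;> by_cases h4 : e.dst ∈ r.leaves
  all_goals first
    | exact absurd h3 (hd h1)
    | exact absurd h4 (hd h2)
    | skip
  all_goals simp [Crosses, h1, h2, h3, h4, sgn, not_counterclockwise_left_right,
    counterclockwise_right_left]

open Classical in
/-- The generating function is the sum of all matchings with their signs; no two terms of the expanded
product belong to the same graph, because the letters of `T` are distinct. -/
theorem exists_genFun_eq_sum (T : BTree X) (hT : T.leaves.Nodup) :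
    ∃ m : Finset (OGraph X), (∀ G, G ∈ m ↔ G ∈ T.matchings) ∧
      T.genFun R = ∑ G ∈ m, AddMonoidAlgebra.single G (G.map (T.sgn R)).prod := by
  induction T with
  | leaf x => exact ⟨{0}, by simp [matchings], by simp [genFun, AddMonoidAlgebra.one_def]⟩
  | node c l r hl hr =>
    obtain ⟨nl, nr, hd⟩ := List.nodup_append'.1 hT
    obtain ⟨m₁, h₁, e₁⟩ := hl nl
    obtain ⟨m₂, h₂, e₂⟩ := hr nr
    set E : Finset (OEdge X) := Finset.univ.filter fun e => e.color = c ∧ Crosses l r e with hE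
    let f : OEdge X × OGraph X × OGraph X → OGraph X := fun x => x.1 ::ₘ (x.2.1 + x.2.2)
    have key : ∀ x ∈ E ×ˢ m₁ ×ˢ m₂, x.1.color = c ∧ Crosses l r x.1 ∧
        (∀ e ∈ x.2.1, e.src ∈ l.leaves ∧ e.dst ∈ l.leaves) ∧
        (∀ e ∈ x.2.2, e.src ∈ r.leaves ∧ e.dst ∈ r.leaves) := by
      intro x hx
      simp only [Finset.mem_product, h₁, h₂, hE, Finset.mem_filter, Finset.mem_univ,
        true_and] at hx
      exact ⟨hx.1.1, hx.1.2, fun e he => mem_leaves_of_mem_matchings hx.2.1 he,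
        fun e he => mem_leaves_of_mem_matchings hx.2.2 he⟩
    refine ⟨(E ×ˢ m₁ ×ˢ m₂).image f, fun G => ?_, ?_⟩
    · rw [Finset.mem_image, mem_matchings_node]
      simp only [Finset.mem_product, h₁, h₂, hE, Finset.mem_filter, Finset.mem_univ, true_and,
        Prod.exists, f]
      constructor
      · rintro ⟨e, G₁, G₂, ⟨⟨hc, hx⟩, g₁, g₂⟩, rfl⟩
        exact ⟨e, G₁, g₁, G₂, g₂, hc, hx, rfl⟩
      · rintro ⟨e, G₁, g₁, G₂, g₂, hc, hx, rfl⟩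
        exact ⟨e, G₁, G₂, ⟨⟨hc, hx⟩, g₁, g₂⟩, rfl⟩
    · rw [Finset.sum_image]
      · rw [genFun, crossSum_leaves R nl nr hd, e₁, e₂, Finset.sum_mul_sum, Finset.sum_mul_sum,
          Finset.sum_product]
        refine Finset.sum_congr rfl fun e he => ?_
        rw [Finset.sum_product]
        refine Finset.sum_congr rfl fun G₁ hG₁ => ?_
        rw [Finset.mul_sum]
        refine Finset.sum_congr rfl fun G₂ hG₂ => ?_
        obtain ⟨-, -, i₁, i₂⟩ := key (e, G₁, G₂) (by simp [he, hG₁, hG₂])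
        rw [AddMonoidAlgebra.single_mul_single, AddMonoidAlgebra.single_mul_single]
        simp only [f, Multiset.map_cons, Multiset.map_add, Multiset.prod_cons, Multiset.prod_add,
          Multiset.singleton_add]
        rw [Multiset.map_congr rfl fun e he => sgn_left (c := c) (r := r) R (i₁ e he),
          Multiset.map_congr rfl fun e he => sgn_right (c := c) hd R (i₂ e he)]
      · -- The three components are recovered from the positions of the edges.
        intro x hx y hy hxy
        have recover : ∀ x ∈ E ×ˢ m₁ ×ˢ m₂, (f x).filter (Crosses l r) = {x.1} ∧
            (f x).filter (fun e => e.src ∈ l.leaves ∧ e.dst ∈ l.leaves) = x.2.1 ∧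
            (f x).filter (fun e => e.src ∈ r.leaves ∧ e.dst ∈ r.leaves) = x.2.2 := by
          intro x hx
          obtain ⟨-, hc, i₁, i₂⟩ := key x hx
          have z₁ : x.2.1.filter (Crosses l r) = 0 :=
            Multiset.filter_eq_nil.2 fun e he h => Crosses.not_left hd h (i₁ e he)
          have z₂ : x.2.2.filter (Crosses l r) = 0 :=
            Multiset.filter_eq_nil.2 fun e he h => Crosses.not_right hd h (i₂ e he)
          refine ⟨?_, ?_, ?_⟩
          · rw [Multiset.filter_cons_of_pos _ hc, Multiset.filter_add, z₁, z₂]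
            rfl
          · rw [Multiset.filter_cons_of_neg
              (p := fun e : OEdge X => e.src ∈ l.leaves ∧ e.dst ∈ l.leaves) _ (Crosses.not_left hd hc), filter_add_of_disjoint i₁]
            exact fun e he h => hd h.1 (i₂ e he).1
          · rw [Multiset.filter_cons_of_neg
              (p := fun e : OEdge X => e.src ∈ r.leaves ∧ e.dst ∈ r.leaves) _ (Crosses.not_right hd hc), add_comm,
              filter_add_of_disjoint i₂]
            exact fun e he h => hd (i₁ e he).1 h.1
        obtain ⟨a1, a2, a3⟩ := recover x hx
        obtain ⟨b1, b2, b3⟩ := recover y hy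
        rw [hxy] at a1 a2 a3
        exact Prod.ext (Multiset.singleton_inj.1 (a1.symm.trans b1))
          (Prod.ext (a2.symm.trans b2) (a3.symm.trans b3))

/-- The coefficients of the generating function are the pairings. -/
theorem coeff_genFun {T : BTree X} (hT : T.IsMultilinear) (G : OGraph X) :
    (T.genFun R).coeff G = pairing R G T := by
  classical
  obtain ⟨m, hm, e⟩ := T.exists_genFun_eq_sum R hT.1
  have hiff := (hm G).trans (T.mem_matchings_iff hT.1 fun e _ => ⟨hT.2 _, hT.2 _⟩)
  rw [e, pairing_eq, AddMonoidAlgebra.coeff_sum, Finsupp.finsetSum_apply]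
  simp only [AddMonoidAlgebra.coeff_single, Finsupp.single_apply, Finset.sum_ite_eq']
  exact if_congr hiff rfl rfl

omit [Fintype X] in
theorem pairing_eq_zero_of_notMem {T : BTree X} (hT : T.IsMultilinear) {G : OGraph X}
    (h : G ∉ T.matchings) : pairing R G T = 0 := by
  classical
  rw [pairing_eq, if_neg]
  rwa [← T.mem_matchings_iff hT.1 fun e _ => ⟨hT.2 _, hT.2 _⟩]

omit [Fintype X] in
theorem pairing_of_mem {T : BTree X} (hT : T.IsMultilinear) {G : OGraph X}
    (h : G ∈ T.matchings) : pairing R G T = 1 ∨ pairing R G T = -1 := by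
  rw [pairing, if_pos]
  · exact neg_one_pow_eq_or R _
  · rwa [bijOn_iff, ← T.mem_matchings_iff hT.1 fun e _ => ⟨hT.2 _, hT.2 _⟩]

end BTree

end GenFun

/-! ### The pairing vanishes on the relations between bracket monomials -/

section Bracket

variable (R : Type*) [CommRing R] {X : Type*}

/-- The bracket `br c` as a bilinear map. -/
noncomputable def brBilin (c : Color) : FreeMag R X →ₗ[R] FreeMag R X →ₗ[R] FreeMag R X :=
  Finsupp.linearCombination R fun s =>
    Finsupp.linearCombination R fun t => Finsupp.single (BTree.node c s t) 1

variable {R}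

theorem br_eq (c : Color) (x y : FreeMag R X) : br c x y = brBilin R c x y := by
  simp only [br, brBilin, Finsupp.linearCombination_apply, Finsupp.sum, LinearMap.coe_sum,
    Finset.sum_apply, LinearMap.smul_apply, Finset.smul_sum, Finsupp.smul_single, smul_eq_mul,
    mul_one]

theorem brBilin_single (c : Color) (s t : BTree X) (a b : R) :
    brBilin R c (Finsupp.single s a) (Finsupp.single t b) =
      Finsupp.single (BTree.node c s t) (a * b) := by
  simp [brBilin]

variable (R) [DecidableEq X] [Fintype X]

/-- Every monomial is sent to its generating function, placed at its multiset of letters. -/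
noncomputable def genFunMap :
    FreeMag R X →ₗ[R] Multiset X →₀ AddMonoidAlgebra R (OGraph X) :=
  Finsupp.linearCombination R fun T => Finsupp.single (T.leaves : Multiset X) (T.genFun R)

/-- The operation that corresponds to the bracket with the monomial `s` on the left. -/
noncomputable def genFunBr (c : Color) (s : BTree X) :
    (Multiset X →₀ AddMonoidAlgebra R (OGraph X)) →ₗ[R]
      Multiset X →₀ AddMonoidAlgebra R (OGraph X) :=
  Finsupp.lsum R fun m => Finsupp.lsingle ((s.leaves : Multiset X) + m) ∘ₗ
    LinearMap.mulLeft R (crossSum R c (s.leaves : Multiset X) m * s.genFun R)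

variable {R}

theorem genFunMap_single (T : BTree X) (a : R) : genFunMap R (Finsupp.single T a) =
    Finsupp.single (T.leaves : Multiset X) (a • T.genFun R) := by
  simp [genFunMap]

omit [DecidableEq X] [Fintype X] in
theorem coe_leaves_node (c : Color) (l r : BTree X) : ((BTree.node c l r).leaves : Multiset X) =
    (l.leaves : Multiset X) + (r.leaves : Multiset X) := by
  rw [BTree.leaves, Multiset.coe_add]

theorem genFunMap_brBilin_single (c : Color) (s : BTree X) (a : R) (x : FreeMag R X) :
    genFunMap R (brBilin R c (Finsupp.single s a) x) = a • genFunBr R c s (genFunMap R x) := by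
  induction x using Finsupp.induction_linear with
  | zero => simp
  | add x y hx hy => simp only [map_add, hx, hy, smul_add]
  | single t b =>
    rw [brBilin_single, genFunMap_single, genFunMap_single, genFunBr, coe_leaves_node]
    simp only [Finsupp.lsum_single, LinearMap.comp_apply, Finsupp.lsingle_apply,
      LinearMap.mulLeft_apply, BTree.genFun, Finsupp.smul_single]
    congr 1
    rw [mul_smul_comm, smul_smul, mul_assoc]

theorem genFunMap_antisymm (c : Color) (x y : FreeMag R X) :
    genFunMap R (brBilin R c x y) + genFunMap R (brBilin R c y x) = 0 := by
  induction x using Finsupp.induction_linear with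
  | zero => simp
  | add x x' hx hx' =>
    simp only [map_add, LinearMap.add_apply]
    rw [add_add_add_comm, hx, hx', add_zero]
  | single s a =>
    induction y using Finsupp.induction_linear with
    | zero => simp
    | add y y' hy hy' =>
      simp only [map_add, LinearMap.add_apply]
      rw [add_add_add_comm, hy, hy', add_zero]
    | single t b =>
      simp only [brBilin_single, genFunMap_single, coe_leaves_node]
      rw [add_comm (t.leaves : Multiset X), ← Finsupp.single_add, BTree.genFun, BTree.genFun,
        crossSum_swap R c (s.leaves : Multiset X), mul_comm b a, mul_comm (t.genFun R), ← smul_add]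
      simp

/-- The sum of the three cyclic rotations of the iterated bracket of `x`, `y`, `z`. -/
noncomputable def jacobiator {R X : Type*} [CommRing R] (c d : Color) (x y z : FreeMag R X) :
    FreeMag R X :=
  brBilin R c x (brBilin R d y z) + brBilin R c y (brBilin R d z x) +
    brBilin R c z (brBilin R d x y)

/-- The generating function of the jacobiator of three monomials. -/
theorem genFunMap_jacobiator_single (c d : Color) (s t u : BTree X) (a b e : R) :
    genFunMap R (jacobiator c d (Finsupp.single s a) (Finsupp.single t b) (Finsupp.single u e)) =
      Finsupp.single ((s.leaves : Multiset X) + (t.leaves : Multiset X) + (u.leaves : Multiset X))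
        ((a * b * e) •
        (((crossSum R c (s.leaves : Multiset X) (t.leaves : Multiset X) -
            crossSum R c (u.leaves : Multiset X) (s.leaves : Multiset X)) *
            crossSum R d (t.leaves : Multiset X) (u.leaves : Multiset X) +
          (crossSum R c (t.leaves : Multiset X) (u.leaves : Multiset X) -
            crossSum R c (s.leaves : Multiset X) (t.leaves : Multiset X)) *
            crossSum R d (u.leaves : Multiset X) (s.leaves : Multiset X) +
          (crossSum R c (u.leaves : Multiset X) (s.leaves : Multiset X) -
            crossSum R c (t.leaves : Multiset X) (u.leaves : Multiset X)) *
            crossSum R d (s.leaves : Multiset X) (t.leaves : Multiset X)) *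
          (s.genFun R * t.genFun R * u.genFun R))) := by
  simp only [jacobiator, brBilin_single, map_add, genFunMap_single, coe_leaves_node, BTree.genFun,
    crossSum_add_right]
  generalize (s.leaves : Multiset X) = S
  generalize (t.leaves : Multiset X) = T
  generalize (u.leaves : Multiset X) = U
  rw [show S + (T + U) = S + T + U by abel, show T + (U + S) = S + T + U by abel,
    show U + (S + T) = S + T + U by abel, ← Finsupp.single_add, ← Finsupp.single_add]
  congr 1
  rw [show b * (e * a) = a * b * e by ring, show e * (a * b) = a * b * e by ring,
    show a * (b * e) = a * b * e by ring, ← smul_add, ← smul_add]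
  congr 1
  rw [crossSum_swap R c U S, crossSum_swap R c S T, crossSum_swap R c T U]
  ring

/-- A rotation invariant function of three arguments which is additive in the first one vanishes if
it vanishes on monomials. -/
theorem eq_zero_of_rotation_invariant {R X M : Type*} [CommRing R] [AddCommGroup M]
    (f : FreeMag R X → FreeMag R X → FreeMag R X → M)
    (add : ∀ x x' y z, f (x + x') y z = f x y z + f x' y z) (rot : ∀ x y z, f x y z = f y z x)
    (single : ∀ s a t b u e, f (Finsupp.single s a) (Finsupp.single t b) (Finsupp.single u e) = 0)
    (x y z : FreeMag R X) : f x y z = 0 := by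
  have zero : ∀ y z, f 0 y z = 0 := fun y z => by simpa using add 0 0 y z
  induction x using Finsupp.induction_linear with
  | zero => exact zero y z
  | add x x' hx hx' => rw [add, hx, hx', add_zero]
  | single s a =>
    rw [rot]
    induction y using Finsupp.induction_linear with
    | zero => exact zero _ _
    | add y y' hy hy' => rw [add, hy, hy', add_zero]
    | single t b =>
      rw [rot]
      induction z using Finsupp.induction_linear with
      | zero => exact zero _ _
      | add z z' hz hz' => rw [add, hz, hz', add_zero]
      | single u e => rw [rot, single]

theorem jacobiator_add {R X : Type*} [CommRing R] (c d : Color) (x x' y z : FreeMag R X) :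
    jacobiator c d (x + x') y z = jacobiator c d x y z + jacobiator c d x' y z := by
  simp only [jacobiator, map_add, LinearMap.add_apply]
  abel

theorem jacobiator_rotate {R X : Type*} [CommRing R] (c d : Color) (x y z : FreeMag R X) :
    jacobiator c d x y z = jacobiator c d y z x := by
  simp only [jacobiator]
  abel

theorem genFunMap_jacobiator_self (c : Color) (x y z : FreeMag R X) :
    genFunMap R (jacobiator c c x y z) = 0 := by
  refine eq_zero_of_rotation_invariant (fun x y z => genFunMap R (jacobiator c c x y z))
    (fun x x' y z => by rw [jacobiator_add, map_add])
    (fun x y z => by rw [jacobiator_rotate]) (fun s a t b u e => ?_) x y z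
  rw [genFunMap_jacobiator_single, Finsupp.single_eq_zero]
  convert smul_zero _
  ring

theorem genFunMap_jacobiator (c d : Color) (x y z : FreeMag R X) :
    genFunMap R (jacobiator c d x y z) + genFunMap R (jacobiator d c x y z) = 0 := by
  refine eq_zero_of_rotation_invariant (fun x y z => genFunMap R (jacobiator c d x y z) +
    genFunMap R (jacobiator d c x y z))
    (fun x x' y z => by simp only [jacobiator_add, map_add]; abel)
    (fun x y z => by rw [jacobiator_rotate c, jacobiator_rotate d]) (fun s a t b u e => ?_) x y z
  rw [genFunMap_jacobiator_single, genFunMap_jacobiator_single, ← Finsupp.single_add,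
    ← smul_add, Finsupp.single_eq_zero]
  convert smul_zero _
  ring

variable (R X) in
theorem compatibleIdeal_le_ker_genFunMap :
    compatibleIdeal R X ≤ LinearMap.ker (genFunMap R) := by
  have left : ∀ c a x, genFunMap R (X := X) x = 0 → genFunMap R (brBilin R c a x) = 0 := by
    intro c a x hx
    induction a using Finsupp.induction_linear with
    | zero => simp
    | add a a' h h' => rw [map_add, LinearMap.add_apply, map_add, h, h', add_zero]
    | single s a => rw [genFunMap_brBilin_single, hx, map_zero, smul_zero]
  refine sInf_le ⟨?_, ?_, ?_, ?_, ?_⟩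
  all_goals simp only [LinearMap.mem_ker, br_eq]
  · exact left
  · intro c a x hx
    have h := genFunMap_antisymm c a x
    rwa [left c a x hx, zero_add] at h
  · intro c x y
    rw [map_add, genFunMap_antisymm]
  · exact genFunMap_jacobiator_self
  · intro x y z
    have h := genFunMap_jacobiator .red .blue x y z
    rw [← map_add, jacobiator, jacobiator] at h
    rw [← h]
    congr 1
    abel

/-- The pairing with a fixed graph, as a linear form on the free algebra with two compatible
brackets. -/
noncomputable def liePairingForm (G : OGraph X) : FreeLie2 R X →ₗ[R] R :=
  (Finsupp.lapply G ∘ₗ (AddMonoidAlgebra.coeffLinearEquiv R).toLinearMap ∘ₗ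
    Finsupp.lapply (Finset.univ : Finset X).val) ∘ₗ
    (compatibleIdeal R X).liftQ (genFunMap R) (compatibleIdeal_le_ker_genFunMap R X)

theorem liePairingForm_monomial {T : BTree X} (hT : T.IsMultilinear) (G : OGraph X) :
    liePairingForm G (monomial R X T) = pairing R G T := by
  have hu : (T.leaves : Multiset X) = (Finset.univ : Finset X).val := by
    rw [Multiset.Nodup.ext (Multiset.coe_nodup.2 hT.1) Finset.univ.nodup]
    intro x
    simp [hT.2 x]
  rw [← BTree.coeff_genFun R hT, liePairingForm, monomial]
  simp [genFunMap_single, hu]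

end Bracket

/-! ### The monomials of trees span the multilinear part -/

section LieSpan

variable (R : Type*) [CommRing R]

theorem isCompatibleIdeal_compatibleIdeal (X : Type*) :
    IsCompatibleIdeal R X (compatibleIdeal R X) where
  br_left c a x hx := Submodule.mem_sInf.2 fun I hI =>
    hI.br_left c a x (Submodule.mem_sInf.1 hx I hI)
  br_right c a x hx := Submodule.mem_sInf.2 fun I hI =>
    hI.br_right c a x (Submodule.mem_sInf.1 hx I hI)
  antisymm c x y := Submodule.mem_sInf.2 fun _ hI => hI.antisymm c x y
  jacobi c x y z := Submodule.mem_sInf.2 fun _ hI => hI.jacobi c x y z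
  mixed x y z := Submodule.mem_sInf.2 fun _ hI => hI.mixed x y z

section Relations

variable {X : Type*}

theorem monomial_swap (c : Color) (S T : BTree X) :
    monomial R X (.node c S T) = -monomial R X (.node c T S) := by
  have h := (isCompatibleIdeal_compatibleIdeal R X).antisymm c
    (Finsupp.single S 1) (Finsupp.single T 1)
  simp only [br_eq, brBilin_single, mul_one] at h
  rw [eq_neg_iff_add_eq_zero, monomial, monomial, ← map_add]
  exact (Submodule.Quotient.mk_eq_zero _).2 h

theorem monomial_jacobi (c : Color) (S T U : BTree X) :
    monomial R X (.node c S (.node c T U)) + monomial R X (.node c T (.node c U S)) +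
      monomial R X (.node c U (.node c S T)) = 0 := by
  have h := (isCompatibleIdeal_compatibleIdeal R X).jacobi c
    (Finsupp.single S 1) (Finsupp.single T 1) (Finsupp.single U 1)
  simp only [br_eq, brBilin_single, mul_one] at h
  simp only [monomial, ← map_add]
  exact (Submodule.Quotient.mk_eq_zero _).2 h

theorem monomial_mixed (S T U : BTree X) :
    monomial R X (.node .red S (.node .blue T U)) + monomial R X (.node .red T (.node .blue U S)) +
      monomial R X (.node .red U (.node .blue S T)) +
      monomial R X (.node .blue S (.node .red T U)) +
      monomial R X (.node .blue T (.node .red U S)) +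
      monomial R X (.node .blue U (.node .red S T)) = 0 := by
  have h := (isCompatibleIdeal_compatibleIdeal R X).mixed
    (Finsupp.single S 1) (Finsupp.single T 1) (Finsupp.single U 1)
  simp only [br_eq, brBilin_single, mul_one] at h
  simp only [monomial, ← map_add]
  exact (Submodule.Quotient.mk_eq_zero _).2 h

theorem compatibleIdeal_le_comap_brBilin (c : Color) (S : BTree X) : compatibleIdeal R X ≤
    (compatibleIdeal R X).comap ((brBilin R c).flip (Finsupp.single S 1)) := by
  intro x hx
  have := (isCompatibleIdeal_compatibleIdeal R X).br_right c (Finsupp.single S 1) x hx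
  rwa [br_eq] at this

/-- The bracket of colour `c` with the monomial `S` on the right. -/
noncomputable def bracketRight (c : Color) (S : BTree X) : FreeLie2 R X →ₗ[R] FreeLie2 R X :=
  (compatibleIdeal R X).mapQ (compatibleIdeal R X) _ (compatibleIdeal_le_comap_brBilin R c S)

theorem bracketRight_monomial (c : Color) (S T : BTree X) :
    bracketRight R c S (monomial R X T) = monomial R X (.node c T S) := by
  rw [bracketRight, monomial, Submodule.mkQ_apply, Submodule.mapQ_apply, LinearMap.flip_apply,
    brBilin_single, one_mul]
  rfl

theorem monomial_swap_left (c d : Color) (S T U : BTree X) :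
    monomial R X (.node d (.node c S T) U) = -monomial R X (.node d (.node c T S) U) := by
  rw [← bracketRight_monomial, monomial_swap, map_neg, bracketRight_monomial]

end Relations

variable {X : Type*} [LinearOrder X]

/-- The span of the monomials whose trees are strictly smaller than `G` in the operation order. -/
noncomputable def below (G : RGraph X) : Submodule R (FreeLie2 R X) :=
  Submodule.span R (monomial R X '' {T | T.leaves.Nodup ∧ T.toRGraph.Lt G})

/-- Congruence up to sign modulo the monomials whose trees are smaller than `G`. -/
def CongBelow (G : RGraph X) (S T : BTree X) : Prop :=
  monomial R X S - monomial R X T ∈ below R G ∨ monomial R X S + monomial R X T ∈ below R G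

variable {R} {G : RGraph X} {S T U : BTree X} {c d : Color}

theorem CongBelow.refl : CongBelow R G S S := Or.inl (by simp)

theorem CongBelow.symm (h : CongBelow R G S T) : CongBelow R G T S := by
  rcases h with h | h
  · exact Or.inl (by simpa using neg_mem h)
  · exact Or.inr (by simpa [add_comm] using h)

theorem CongBelow.trans (h : CongBelow R G S T) (h' : CongBelow R G T U) : CongBelow R G S U := by
  rcases h with h | h <;> rcases h' with h' | h'
  · exact Or.inl (by simpa using add_mem h h')
  · exact Or.inr (by convert add_mem h h' using 1; abel)
  · exact Or.inr (by convert sub_mem h h' using 1; abel)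
  · exact Or.inl (by convert sub_mem h h' using 1; abel)

theorem congBelow_swap : CongBelow R G (.node c S T) (.node c T S) :=
  Or.inr (by rw [monomial_swap]; simp)

theorem bracketRight_mem_below [Finite X] {x : FreeLie2 R X} (hT : T.leaves.Nodup)
    (hd : Disjoint G.verts T.toRGraph.verts) (hx : x ∈ below R G) :
    bracketRight R c T x ∈ below R (G.join c T.toRGraph) := by
  revert x
  change below R G ≤ (below R (G.join c T.toRGraph)).comap (bracketRight R c T)
  refine Submodule.span_le.2 ?_
  rintro _ ⟨S, ⟨hS, hl⟩, rfl⟩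
  have hS' := S.isArb_toRGraph hS
  have hd' : Disjoint S.toRGraph.verts T.toRGraph.verts := (hl.1.isArb_and_verts hS').2 ▸ hd
  refine Submodule.subset_span ⟨.node c S T, ⟨?_, ?_⟩, (bracketRight_monomial R c T S).symm⟩
  · exact BTree.nodup_node.2 ⟨hS, hT, hd'⟩
  · exact hl.join_left hS' (T.isArb_toRGraph hT) hd'

theorem CongBelow.node_left [Finite X] (h : CongBelow R G S T) (hU : U.leaves.Nodup)
    (hd : Disjoint G.verts U.toRGraph.verts) :
    CongBelow R (G.join c U.toRGraph) (.node c S U) (.node c T U) := by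
  rcases h with h | h
  · refine Or.inl ?_
    simpa only [map_sub, bracketRight_monomial] using
      bracketRight_mem_below (c := c) hU hd h
  · refine Or.inr ?_
    simpa only [map_add, bracketRight_monomial] using
      bracketRight_mem_below (c := c) hU hd h

theorem CongBelow.node_right [Finite X] (h : CongBelow R G S T) (hU : U.leaves.Nodup)
    (hd : Disjoint G.verts U.toRGraph.verts) :
    CongBelow R (U.toRGraph.join c G) (.node c U S) (.node c U T) := by
  rw [RGraph.join_comm]
  exact congBelow_swap.trans ((h.node_left hU hd).trans congBelow_swap)

end LieSpan

section Swap

variable {R : Type*} [CommRing R] {X : Type*} [LinearOrder X] {c d : Color}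

open RGraph

/-- If `K` is joined below the root of `A`, then no edge connects the root of `K` to the root of a tree
`B` that is joined later. -/
theorem notMem_edges_join_join {A K B : RGraph X} (hA : A.IsArb) (hK : K.IsArb) (hB : B.IsArb)
    (hAK : Disjoint A.verts K.verts) (hAB : Disjoint A.verts B.verts)
    (hKB : Disjoint K.verts B.verts) (b : Beats c A.root K.root) (e : Color) :
    (s(K.root, B.root), e) ∉ (join d (join c A K) B).edges := by
  have h1 := Finset.disjoint_right.1 hAK hK.root_mem
  have h2 := Finset.disjoint_right.1 hAB hB.root_mem
  have h3 := Finset.disjoint_left.1 hKB hK.root_mem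
  have h4 := Finset.disjoint_right.1 hKB hB.root_mem
  have h5 : A.root ≠ K.root := fun h => h1 (h ▸ hA.root_mem)
  have h6 : A.root ≠ B.root := fun h => h2 (h ▸ hA.root_mem)
  have h7 : K.root ≠ B.root := fun h => h3 (h ▸ hB.root_mem)
  intro h
  simp only [join, Finset.mem_insert, Finset.mem_union, Prod.mk.injEq, Sym2.eq_iff] at h
  rcases h with ⟨h, -⟩ | (⟨h, -⟩ | h | h) | h
  · have : (join c A K).root = A.root := root_join b
    simp only [join] at this
    rw [this] at h
    rcases h with ⟨h, -⟩ | ⟨h, -⟩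
    exacts [h5 h.symm, h7 h]
  · rcases h with ⟨h, -⟩ | ⟨-, h⟩
    exacts [h5 h.symm, h6 h.symm]
  · exact h1 (hA.mem_verts_of_mem h (Sym2.mem_mk_left _ _))
  · exact h4 (hK.mem_verts_of_mem h (Sym2.mem_mk_right _ _))
  · exact h3 (hB.mem_verts_of_mem h (Sym2.mem_mk_left _ _))

variable {A K B : BTree X}

theorem join_join_comm {A K B : RGraph X} (b : Beats c A.root K.root) (b' : Beats d A.root B.root) :
    join d (join c A K) B = join c (join d A B) K := by
  rw [join_eq_graft b, join_eq_graft (A := graft c A.root A K) b', join_eq_graft b',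
    join_eq_graft (A := graft d A.root A B) b]
  exact graft_graft_comm c d _ _ _ _ _

theorem le_join_join {A K B : RGraph X} (hA : A.IsArb) (hK : K.IsArb) (hB : B.IsArb)
    (hAK : Disjoint A.verts K.verts) (hAB : Disjoint A.verts B.verts)
    (hKB : Disjoint K.verts B.verts) (b : Beats c A.root K.root) (b' : Beats c A.root B.root) :
    Le (join c A (join c K B)) (join c (join c A K) B) := by
  rw [join_comm]
  rcases beats_or_beats c (hK.root_ne hB hKB) with h | h
  · have := join_join_le (d := c) hK hB hA hKB hAK.symm hAB.symm h
    rwa [join_comm c K A] at this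
  · rw [join_comm c K B, join_join_comm b b', join_comm c A B]
    exact join_join_le (d := c) hB hK hA hKB.symm hAB.symm hAK.symm h

/-- A criterion for the terms of the Jacobi and mixed Jacobi identities to be smaller. -/
theorem monomial_mem_below (hA : A.leaves.Nodup) (hK : K.leaves.Nodup) (hB : B.leaves.Nodup)
    (hAK : Disjoint A.toRGraph.verts K.toRGraph.verts)
    (hAB : Disjoint A.toRGraph.verts B.toRGraph.verts)
    (hKB : Disjoint K.toRGraph.verts B.toRGraph.verts)
    (b : Beats c A.toRGraph.root K.toRGraph.root) {T : BTree X} (hT : T.leaves.Nodup)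
    (hle : T.toRGraph.Le (join d (join c A.toRGraph K.toRGraph) B.toRGraph)) (e : Color)
    (he : (s(K.toRGraph.root, B.toRGraph.root), e) ∈ T.toRGraph.edges) :
    monomial R X T ∈ below R (join d (join c A.toRGraph K.toRGraph) B.toRGraph) :=
  Submodule.subset_span ⟨T, ⟨hT, hle, fun heq =>
    notMem_edges_join_join (d := d) (A.isArb_toRGraph hA) (K.isArb_toRGraph hK)
      (B.isArb_toRGraph hB) hAK hAB hKB b e (heq.symm ▸ he)⟩, rfl⟩

theorem congBelow_node_node_self (hA : A.leaves.Nodup) (hK : K.leaves.Nodup) (hB : B.leaves.Nodup)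
    (hAK : Disjoint A.toRGraph.verts K.toRGraph.verts)
    (hAB : Disjoint A.toRGraph.verts B.toRGraph.verts)
    (hKB : Disjoint K.toRGraph.verts B.toRGraph.verts)
    (b : Beats c A.toRGraph.root K.toRGraph.root) (b' : Beats c A.toRGraph.root B.toRGraph.root) :
    CongBelow R (join c (join c A.toRGraph K.toRGraph) B.toRGraph)
      (.node c (.node c A K) B) (.node c (.node c A B) K) := by
  have gA := A.isArb_toRGraph hA
  have gK := K.isArb_toRGraph hK
  have gB := B.isArb_toRGraph hB
  have hmem : monomial R X (.node c A (.node c K B)) ∈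
      below R (join c (join c A.toRGraph K.toRGraph) B.toRGraph) := by
    refine monomial_mem_below hA hK hB hAK hAB hKB b ?_
      (le_join_join gA gK gB hAK hAB hKB b b') c ?_
    · exact BTree.nodup_node.2 ⟨hA, BTree.nodup_node.2 ⟨hK, hB, hKB⟩,
        Finset.disjoint_union_right.2 ⟨hAK, hAB⟩⟩
    · simp [BTree.toRGraph, join]
  left
  have h := monomial_jacobi R c A K B
  rw [monomial_swap R c K, monomial_swap_left, monomial_swap R c B (.node c A K), neg_neg] at h
  convert hmem using 1
  rw [← sub_eq_zero, ← neg_eq_zero, ← h]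
  abel

theorem congBelow_node_node_red_blue (hA : A.leaves.Nodup) (hK : K.leaves.Nodup)
    (hB : B.leaves.Nodup) (hAK : Disjoint A.toRGraph.verts K.toRGraph.verts)
    (hAB : Disjoint A.toRGraph.verts B.toRGraph.verts)
    (hKB : Disjoint K.toRGraph.verts B.toRGraph.verts)
    (b : Beats .red A.toRGraph.root K.toRGraph.root)
    (b' : Beats .blue A.toRGraph.root B.toRGraph.root) :
    CongBelow R (join .blue (join .red A.toRGraph K.toRGraph) B.toRGraph)
      (.node .blue (.node .red A K) B) (.node .red (.node .blue A B) K) := by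
  have gA := A.isArb_toRGraph hA
  have gK := K.isArb_toRGraph hK
  have gB := B.isArb_toRGraph hB
  have lt : B.toRGraph.root < K.toRGraph.root :=
    (beats_blue.1 b').trans (beats_red.1 b)
  have bK : Beats .blue K.toRGraph.root B.toRGraph.root := beats_blue.2 lt
  have bB : Beats .red B.toRGraph.root K.toRGraph.root := beats_red.2 lt
  have hAKB := Finset.disjoint_union_right.2 ⟨hAK, hAB⟩
  have hKBA := Finset.disjoint_union_right.2 ⟨hKB, hAK.symm⟩
  have hBAK := Finset.disjoint_union_right.2 ⟨hAB.symm, hKB.symm⟩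
  -- Each of the four terms arises by postponing joins, in one or two steps.
  have l1 : Le (join .red A.toRGraph (join .blue K.toRGraph B.toRGraph))
      (join .blue (join .red A.toRGraph K.toRGraph) B.toRGraph) := by
    have := join_join_le (d := .red) gK gB gA hKB hAK.symm hAB.symm bK
    rwa [join_comm .red (join .blue K.toRGraph _), join_comm .red K.toRGraph] at this
  have l2 : Le (join .blue A.toRGraph (join .red K.toRGraph B.toRGraph))
      (join .blue (join .red A.toRGraph K.toRGraph) B.toRGraph) := by
    have := join_join_le (d := .blue) gB gK gA hKB.symm hAB.symm hAK.symm bB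
    rwa [join_comm .blue (join .red B.toRGraph _), join_comm .red B.toRGraph,
      join_comm .blue B.toRGraph, ← join_join_comm b b'] at this
  have l3 : Le (join .red B.toRGraph (join .blue A.toRGraph K.toRGraph))
      (join .blue (join .red A.toRGraph K.toRGraph) B.toRGraph) := by
    have := join_join_le (d := .red) gK gA gB hAK.symm hKB hAB (c := .blue) 
      (beats_blue.2 (beats_red.1 b))
    rw [join_comm .red (join .blue K.toRGraph _), join_comm .blue K.toRGraph,
      join_comm .blue (join .red _ _)] at this
    exact this.trans l2
  have l4 : Le (join .blue K.toRGraph (join .red B.toRGraph A.toRGraph))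
      (join .blue (join .red A.toRGraph K.toRGraph) B.toRGraph) := by
    have := join_join_le (d := .blue) gB gA gK hAB.symm hKB.symm hAK (c := .red)
      (beats_red.2 (beats_blue.1 b'))
    rw [join_comm .blue (join .red B.toRGraph _), join_comm .blue B.toRGraph,
      join_comm .red (join .blue _ _)] at this
    exact this.trans l1
  have h1 : monomial R X (.node .red A (.node .blue K B)) ∈
      below R (join .blue (join .red A.toRGraph K.toRGraph) B.toRGraph) := by
    refine monomial_mem_below hA hK hB hAK hAB hKB b ?_ l1 .blue ?_
    · exact BTree.nodup_node.2 ⟨hA, BTree.nodup_node.2 ⟨hK, hB, hKB⟩, hAKB⟩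
    · simp [BTree.toRGraph, join]
  have h2 : monomial R X (.node .blue A (.node .red K B)) ∈
      below R (join .blue (join .red A.toRGraph K.toRGraph) B.toRGraph) := by
    refine monomial_mem_below hA hK hB hAK hAB hKB b ?_ l2 .red ?_
    · exact BTree.nodup_node.2 ⟨hA, BTree.nodup_node.2 ⟨hK, hB, hKB⟩, hAKB⟩
    · simp [BTree.toRGraph, join]
  have h3 : monomial R X (.node .red B (.node .blue A K)) ∈
      below R (join .blue (join .red A.toRGraph K.toRGraph) B.toRGraph) := by
    refine monomial_mem_below hA hK hB hAK hAB hKB b ?_ l3 .red ?_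
    · exact BTree.nodup_node.2 ⟨hB, BTree.nodup_node.2 ⟨hA, hK, hAK⟩, hBAK⟩
    · have : max A.toRGraph.root K.toRGraph.root = K.toRGraph.root :=
        max_eq_right (beats_red.1 b).le
      simp [BTree.toRGraph, join, this]
  have h4 : monomial R X (.node .blue K (.node .red B A)) ∈
      below R (join .blue (join .red A.toRGraph K.toRGraph) B.toRGraph) := by
    refine monomial_mem_below hA hK hB hAK hAB hKB b ?_ l4 .blue ?_
    · exact BTree.nodup_node.2 ⟨hK, BTree.nodup_node.2 ⟨hB, hA, hAB.symm⟩, hKBA⟩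
    · have : min B.toRGraph.root A.toRGraph.root = B.toRGraph.root :=
        min_eq_left (beats_blue.1 b').le
      simp [BTree.toRGraph, join, this]
  left
  have h := monomial_mixed R A K B
  rw [monomial_swap R .red K (.node .blue B A), monomial_swap_left,
    monomial_swap R .blue B (.node .red A K), neg_neg] at h
  convert add_mem (add_mem h1 h2) (add_mem h3 h4) using 1
  rw [← sub_eq_zero, ← neg_eq_zero, ← h]
  abel

/-- Two subtrees of the root may be joined in either order, up to sign and smaller trees: the other
terms of the Jacobi or mixed Jacobi identity contain an edge between the roots of the two subtrees,
and they are smaller because they are obtained by postponing joins. -/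
theorem congBelow_node_node (hA : A.leaves.Nodup) (hK : K.leaves.Nodup) (hB : B.leaves.Nodup)
    (hAK : Disjoint A.toRGraph.verts K.toRGraph.verts)
    (hAB : Disjoint A.toRGraph.verts B.toRGraph.verts)
    (hKB : Disjoint K.toRGraph.verts B.toRGraph.verts)
    (b : Beats c A.toRGraph.root K.toRGraph.root) (b' : Beats d A.toRGraph.root B.toRGraph.root) :
    CongBelow R (join d (join c A.toRGraph K.toRGraph) B.toRGraph)
      (.node d (.node c A K) B) (.node c (.node d A B) K) := by
  cases c <;> cases d
  · exact congBelow_node_node_self hA hK hB hAK hAB hKB b b'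
  · exact congBelow_node_node_red_blue hA hK hB hAK hAB hKB b b'
  · rw [join_join_comm b b']
    exact (congBelow_node_node_red_blue hA hB hK hAB hAK hKB.symm b' b).symm
  · exact congBelow_node_node_self hA hK hB hAK hAB hKB b b'

end Swap

section Span

variable {R : Type*} [CommRing R] {X : Type*} [LinearOrder X] [Finite X]

open RGraph

omit [Finite X] in
theorem exists_node_beats {c : Color} {S T : BTree X} (h : (BTree.node c S T).leaves.Nodup)
    (G : RGraph X) : ∃ A K : BTree X, (BTree.node c A K).leaves.Nodup ∧
      Beats c A.toRGraph.root K.toRGraph.root ∧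
      (BTree.node c A K).toRGraph = (BTree.node c S T).toRGraph ∧
      CongBelow R G (.node c S T) (.node c A K) := by
  obtain ⟨hS, hT, hd⟩ := BTree.nodup_node.1 h
  rcases beats_or_beats c ((S.isArb_toRGraph hS).root_ne (T.isArb_toRGraph hT) hd) with b | b
  · exact ⟨S, T, h, b, rfl, .refl⟩
  · exact ⟨T, S, BTree.nodup_node.2 ⟨hT, hS, hd.symm⟩, b, join_comm _ _ _, congBelow_swap⟩

omit [Finite X] in
theorem length_leaves_eq {T : BTree X} (h : T.leaves.Nodup) :
    T.leaves.length = T.toRGraph.verts.card := by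
  rw [BTree.verts_toRGraph, List.toFinset_card_of_nodup h]

omit [Finite X] in
theorem RGraph.Graftable.eq_and_eq {A K A' K' : RGraph X} {c : Color} {p : X} (h : Graftable c p A K)
    (h' : Graftable c p A' K') (hr : K.root = K'.root) (e : graft c p A K = graft c p A' K') :
    A = A' ∧ K = K' := by
  have hroot : A.root = A'.root :=
    congrArg RGraph.root (a₁ := graft c p A K) (a₂ := graft c p A' K') e
  constructor
  · rw [← h.side_left, e, hr, hroot, h'.side_left]
  · rw [← h.side_right, e, hr, h'.side_right]

/-- Up to sign and smaller trees, a monomial is determined by its tree: the subtree joined last by the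
one monomial can be moved to this place in the other one. -/
theorem congBelow_of_toRGraph_eq {T T' : BTree X} (hT : T.leaves.Nodup) (hT' : T'.leaves.Nodup)
    (h : T.toRGraph = T'.toRGraph) : CongBelow R T.toRGraph T T' := by
  induction hN : T.leaves.length using Nat.strong_induction_on generalizing T T' with
  | _ N ih =>
    have hlen : T.leaves.length = T'.leaves.length := by
      rw [length_leaves_eq hT, length_leaves_eq hT', h]
    rcases T with x | ⟨c, S, S'⟩
    · rcases T' with x' | ⟨c', U, U'⟩
      · have : x = x' := congrArg RGraph.root h
        exact this ▸ .refl
      · have h1 := U.leaves_length_pos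
        have h2 := U'.leaves_length_pos
        simp only [BTree.leaves, List.length_append, List.length_singleton] at hlen
        omega
    rcases T' with x' | ⟨d, U, U'⟩
    · have h1 := S.leaves_length_pos
      have h2 := S'.leaves_length_pos
      simp only [BTree.leaves, List.length_append, List.length_singleton] at hlen
      omega
    obtain ⟨A, K, hAK, b, e, hc⟩ := exists_node_beats (R := R) hT (BTree.node c S S').toRGraph
    obtain ⟨A', B, hAB, b', e', hc'⟩ := exists_node_beats (R := R) hT' (BTree.node c S S').toRGraph
    refine (hc.trans ?_).trans hc'.symm
    have hN' : (BTree.node c A K).leaves.length = N := by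
      rw [length_leaves_eq hAK, e, ← length_leaves_eq hT, hN]
    rw [← e] at h ⊢
    rw [← e'] at h
    clear hc hc' e e' hlen hN hT hT'
    obtain ⟨hA, hK, hdK⟩ := BTree.nodup_node.1 hAK
    obtain ⟨hA', hB, hdB⟩ := BTree.nodup_node.1 hAB
    have lA : A.leaves.length < N := by
      have := K.leaves_length_pos
      simp only [BTree.leaves, List.length_append] at hN'
      omega
    have lK : K.leaves.length < N := by
      have := A.leaves_length_pos
      simp only [BTree.leaves, List.length_append] at hN'
      omega
    have gK := graftable_root (A.isArb_toRGraph hA) (K.isArb_toRGraph hK) hdK b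
    have gB := graftable_root (A'.isArb_toRGraph hA') (B.isArb_toRGraph hB) hdB b'
    have hg : graft c A.toRGraph.root A.toRGraph K.toRGraph =
        graft d A'.toRGraph.root A'.toRGraph B.toRGraph := by
      rw [← join_eq_graft b, ← join_eq_graft b']
      exact h
    have hroot : A.toRGraph.root = A'.toRGraph.root :=
      congrArg RGraph.root (a₁ := graft c _ A.toRGraph _) (a₂ := graft d _ A'.toRGraph _) hg
    rw [← hroot] at gB hg b'
    have aB := gB.arrow
    rw [← hg, graft_arrow gK] at aB
    rcases aB with aB | aB | ⟨rfl, -, hr⟩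
    · -- The subtree `B` hangs below the root of `A`; let `A₀` be the rest of `A`.
      obtain ⟨A₀, B', gA, hr, hrB, hA₀⟩ := (A.isArb_toRGraph hA).exists_graft aB
      obtain ⟨n₀, t₀⟩ := gA.left.bMonomial_spec
      set a := A₀.bMonomial with ha
      have hsub : A₀.verts ⊆ A.toRGraph.verts := by
        rw [hA₀]; exact Finset.subset_union_left
      have g₁ : Graftable c A.toRGraph.root A₀ K.toRGraph :=
        ⟨gA.left, gK.right, Finset.disjoint_of_subset_left hsub hdK, hr ▸ gA.left.root_mem, b⟩
      have hsub' : B'.verts ⊆ A.toRGraph.verts := by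
        rw [hA₀]; exact Finset.subset_union_right
      have g₂ : Graftable d A.toRGraph.root (graft c A.toRGraph.root A₀ K.toRGraph) B' := by
        refine ⟨g₁.isArb, gA.right, ?_, Finset.mem_union_left _ g₁.mem, gA.beats⟩
        exact Finset.disjoint_union_left.2
          ⟨gA.disj, (Finset.disjoint_of_subset_left hsub' hdK).symm⟩
      have hg' : graft d A.toRGraph.root (graft c A.toRGraph.root A₀ K.toRGraph) B' =
          graft d A.toRGraph.root A'.toRGraph B.toRGraph := by
        rw [graft_graft_comm, ← hA₀, hg]
      obtain ⟨e₁, e₂⟩ := g₂.eq_and_eq gB hrB hg'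
      subst e₂
      have bA : Beats d a.toRGraph.root B.toRGraph.root := by rw [t₀, hr]; exact b'
      have bK : Beats c a.toRGraph.root K.toRGraph.root := by rw [t₀, hr]; exact b
      rw [← t₀] at gA g₁ e₁ hA₀
      rw [← hr, ← t₀] at e₁ hA₀
      rw [← join_eq_graft bK] at e₁
      rw [← join_eq_graft bA] at hA₀
      have n₁ : (BTree.node d a B).leaves.Nodup := BTree.nodup_node.2 ⟨n₀, hB, gA.disj⟩
      have n₂ : (BTree.node c a K).leaves.Nodup := BTree.nodup_node.2 ⟨n₀, hK, g₁.disj⟩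
      have c₁ := (ih _ lA hA n₁ hA₀ rfl).node_left (c := c) hK hdK
      have lA' : A'.leaves.length < N := by
        have h1 := B.leaves_length_pos
        rw [length_leaves_eq hAK, h, ← length_leaves_eq hAB] at hN'
        simp only [BTree.leaves, List.length_append] at hN'
        omega
      have c₂ := (ih _ lA' hA' n₂ e₁.symm rfl).node_left (c := d) hB hdB
      have c₃ := congBelow_node_node (R := R) n₀ hK hB g₁.disj gA.disj
        (Finset.disjoint_of_subset_left hsub' hdK).symm bK bA
      have hG : (BTree.node c A K).toRGraph =
          join d (join c a.toRGraph K.toRGraph) B.toRGraph := by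
        rw [h, BTree.toRGraph, ← e₁]
      change CongBelow R (BTree.node c A K).toRGraph _ _ at c₁
      change CongBelow R (BTree.node d A' B).toRGraph _ _ at c₂
      rw [← h] at c₂
      rw [← hG] at c₃
      exact (c₁.trans c₃.symm).trans c₂.symm
    · exact absurd ((K.isArb_toRGraph hK).src_mem aB) (gK.not_mem gK.mem)
    · obtain ⟨e₁, e₂⟩ := gK.eq_and_eq gB hr.symm hg
      refine ((ih _ lA hA hA' e₁ rfl).node_left hK hdK).trans ?_
      have := (ih _ lK hK hB e₂ rfl).node_right (c := d) hA' (e₁ ▸ hdK.symm)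
      rwa [← e₁] at this

/-- All monomials with distinct letters reduce to the monomials `b_H`, by induction along the operation
order, which has no infinite descending chains as there are finitely many trees. -/
theorem monomial_mem_span {T : BTree X} (hT : T.leaves.Nodup) : monomial R X T ∈
    Submodule.span R {m | ∃ H : RGraph X, H.IsArb ∧ H.verts = T.toRGraph.verts ∧
      m = monomial R X H.bMonomial} := by
  have key : ∀ G : {G : RGraph X // G.IsArb}, ∀ T : BTree X, T.leaves.Nodup → T.toRGraph = G.1 →
      monomial R X T ∈ Submodule.span R {m | ∃ H : RGraph X, H.IsArb ∧ H.verts = G.1.verts ∧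
        m = monomial R X H.bMonomial} := by
    have : Finite (RGraph X) := Finite.of_injective
      (fun G : RGraph X => (G.verts, G.root, G.edges)) fun G H h => by
        simp only [Prod.mk.injEq] at h
        exact RGraph.ext h.1 h.2.1 h.2.2
    have hwf : WellFounded fun H G : {G : RGraph X // G.IsArb} => H.1.Lt G.1 := by
      have : IsTrans {G : RGraph X // G.IsArb} fun H G => H.1.Lt G.1 :=
        ⟨fun a b c h h' => ⟨h.1.trans h'.1, fun e => h.2 (h.1.antisymm (e ▸ h'.1) a.2)⟩⟩
      have : Std.Irrefl fun H G : {G : RGraph X // G.IsArb} => H.1.Lt G.1 :=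
        ⟨fun a h => h.2 rfl⟩
      exact Finite.wellFounded_of_trans_of_irrefl _
    intro G
    induction G using hwf.induction with
    | _ G ih =>
      rintro T hT hG
      have hle : below R T.toRGraph ≤ Submodule.span R {m | ∃ H : RGraph X, H.IsArb ∧
          H.verts = G.1.verts ∧ m = monomial R X H.bMonomial} := by
        refine Submodule.span_le.2 ?_
        rintro _ ⟨S, ⟨hS, hl⟩, rfl⟩
        rw [hG] at hl
        have := ih ⟨S.toRGraph, S.isArb_toRGraph hS⟩ hl S hS rfl
        rwa [← (hl.1.isArb_and_verts (S.isArb_toRGraph hS)).2] at this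
      have hb := G.2.bMonomial_spec
      have hmem : monomial R X G.1.bMonomial ∈ Submodule.span R {m | ∃ H : RGraph X, H.IsArb ∧
          H.verts = G.1.verts ∧ m = monomial R X H.bMonomial} :=
        Submodule.subset_span ⟨G.1, G.2, rfl, rfl⟩
      rcases congBelow_of_toRGraph_eq (R := R) hT hb.1 (hG.trans hb.2.symm) with h | h
      · simpa using add_mem (hle h) hmem
      · simpa using sub_mem (hle h) hmem
  exact key ⟨T.toRGraph, T.isArb_toRGraph hT⟩ T hT rfl

end Span

/-! ### Products of edges over trees -/

/-- A family of elements `a c i j` of a commutative ring that satisfies the relations between edges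
in `Eil₂`, apart from the vanishing of disconnected graphs. The value on loops is zero, so that the
relations hold without any assumption that `i`, `j`, `k` are distinct. -/
structure IsEdgeSystem {X A : Type*} [CommRing A] (a : Color → X → X → A) : Prop where
  loop : ∀ c i, a c i i = 0
  swap : ∀ c i j, a c i j = -a c j i
  double : ∀ c d i j, a c i j * a d i j = 0
  arnold : ∀ c i j k, a c i j * a c j k + a c j k * a c k i + a c k i * a c i j = 0
  mixed : ∀ c d i j k, c ≠ d →
    a c i j * a d j k + a c j k * a d k i + a c k i * a d i j +
      (a d i j * a c j k + a d j k * a c k i + a d k i * a c i j) = 0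

/-- `IsTreeProd a S t` says that `t` is the product of the edges of a tree with vertex set `S`: a
tree is a single vertex, or it consists of two disjoint trees and an edge between them. -/
inductive IsTreeProd {X A : Type*} [DecidableEq X] [CommRing A] (a : Color → X → X → A) :
    Finset X → A → Prop
  | single (x : X) : IsTreeProd a {x} 1
  | join {S T : Finset X} {s t : A} {u v : X} (c : Color) (hs : IsTreeProd a S s)
      (ht : IsTreeProd a T t) (hd : Disjoint S T) (hu : u ∈ S) (hv : v ∈ T) :
      IsTreeProd a (S ∪ T) (a c u v * s * t)

section TreeProd

variable {X A : Type*} [DecidableEq X] [CommRing A] {a : Color → X → X → A} {S T : Finset X} {s t : A}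
  {c : Color} {u v m : X}

theorem IsTreeProd.add_leaf (ht : IsTreeProd a T t) (hu : u ∉ T) (hv : v ∈ T) :
    IsTreeProd a (insert u T) (a c u v * t) := by
  have := IsTreeProd.join c (IsTreeProd.single u) ht (Finset.disjoint_singleton_left.2 hu)
    (Finset.mem_singleton_self u) hv
  rwa [mul_one] at this

/-- A tree with more than one vertex has an edge at every vertex; removing it leaves two trees. -/
theorem IsTreeProd.elim (ha : IsEdgeSystem a) (ht : IsTreeProd a S t) (hm : m ∈ S) {P : A → Prop}
    (neg : ∀ x, P x → P (-x)) (single : S = {m} → P 1)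
    (edge : ∀ c p S₁ S₂ γ δ, IsTreeProd a S₁ γ → IsTreeProd a S₂ δ → p ∈ S₁ → m ∈ S₂ →
      Disjoint S₁ S₂ → S = S₁ ∪ S₂ → P (a c m p * γ * δ)) : P t := by
  have key : (S = {m} ∧ t = 1) ∨ ∃ c p S₁ S₂ γ δ, IsTreeProd a S₁ γ ∧ IsTreeProd a S₂ δ ∧
      p ∈ S₁ ∧ m ∈ S₂ ∧ Disjoint S₁ S₂ ∧ S = S₁ ∪ S₂ ∧
      (t = a c m p * γ * δ ∨ t = -(a c m p * γ * δ)) := by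
    clear neg single edge
    induction ht with
    | single x => exact Or.inl ⟨by rw [Finset.mem_singleton.1 hm], rfl⟩
    | @join S T s t u v c hs ht hd hu hv ihs iht =>
      right
      rcases Finset.mem_union.1 hm with hm | hm
      · by_cases hmu : m = u
        · subst hmu
          exact ⟨c, v, T, S, t, s, ht, hs, hv, hm, hd.symm, Finset.union_comm _ _,
            Or.inl (by ring)⟩
        rcases ihs hm with ⟨rfl, -⟩ | ⟨d, p, S₁, S₂, γ, δ, h₁, h₂, hp, hm₂, hd', rfl, e⟩
        · exact absurd (Finset.mem_singleton.1 hu).symm hmu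
        rw [Finset.disjoint_union_left] at hd
        rcases Finset.mem_union.1 hu with hu | hu
        · refine ⟨d, p, S₁ ∪ T, S₂, _, δ, .join c h₁ ht hd.1 hu hv, h₂,
            Finset.mem_union_left _ hp, hm₂, Finset.disjoint_union_left.2 ⟨hd', hd.2.symm⟩,
            Finset.union_right_comm _ _ _, ?_⟩
          rcases e with rfl | rfl
          exacts [Or.inl (by ring), Or.inr (by ring)]
        · refine ⟨d, p, S₁, S₂ ∪ T, γ, _, h₁, .join c h₂ ht hd.2 hu hv, hp,
            Finset.mem_union_left _ hm₂, Finset.disjoint_union_right.2 ⟨hd', hd.1⟩,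
            Finset.union_assoc _ _ _, ?_⟩
          rcases e with rfl | rfl
          exacts [Or.inl (by ring), Or.inr (by ring)]
      · by_cases hmv : m = v
        · subst hmv
          refine ⟨c, u, S, T, s, t, hs, ht, hu, hm, hd, rfl, Or.inr ?_⟩
          rw [ha.swap c u m]
          ring
        rcases iht hm with ⟨rfl, -⟩ | ⟨d, p, S₁, S₂, γ, δ, h₁, h₂, hp, hm₂, hd', rfl, e⟩
        · exact absurd (Finset.mem_singleton.1 hv).symm hmv
        rw [Finset.disjoint_union_right] at hd
        rcases Finset.mem_union.1 hv with hv | hv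
        · refine ⟨d, p, S ∪ S₁, S₂, _, δ, .join c hs h₁ hd.1 hu hv, h₂,
            Finset.mem_union_right _ hp, hm₂, Finset.disjoint_union_left.2 ⟨hd.2, hd'⟩,
            (Finset.union_assoc _ _ _).symm, ?_⟩
          rcases e with rfl | rfl
          exacts [Or.inl (by ring), Or.inr (by ring)]
        · refine ⟨d, p, S₁, S ∪ S₂, γ, _, h₁, .join c hs h₂ hd.2 hu hv, hp,
            Finset.mem_union_right _ hm₂, Finset.disjoint_union_right.2 ⟨hd.1.symm, hd'⟩,
            Finset.union_left_comm _ _ _, ?_⟩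
          rcases e with rfl | rfl
          exacts [Or.inl (by ring), Or.inr (by ring)]
  rcases key with ⟨h, rfl⟩ | ⟨d, p, S₁, S₂, γ, δ, h₁, h₂, hp, hm₂, hd', h, rfl | rfl⟩
  · exact single h
  · exact edge _ _ _ _ _ _ h₁ h₂ hp hm₂ hd' h
  · exact neg _ (edge _ _ _ _ _ _ h₁ h₂ hp hm₂ hd' h)

theorem IsTreeProd.eq_one (ht : IsTreeProd a {m} t) : t = 1 := by
  generalize hS : ({m} : Finset X) = S at ht
  cases ht with
  | single x => rfl
  | @join S T s t u v c hs ht hd hu hv =>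
    have hu' := Finset.mem_union_left T hu
    have hv' := Finset.mem_union_right S hv
    rw [← hS, Finset.mem_singleton] at hu' hv'
    exact absurd (hu'.trans hv'.symm ▸ hv) (Finset.disjoint_left.1 hd hu)

/-- Adding an edge to a tree gives zero. Arnold's relation moves one end of a leaf edge along the
tree; if the colours do not fit, the mixed relation exchanges the colours of two adjacent edges. -/
theorem IsTreeProd.mul_edge (ha : IsEdgeSystem a) (ht : IsTreeProd a S t) (hu : u ∈ S) (hv : v ∈ S)
    (c : Color) : t * a c u v = 0 := by
  induction hN : S.card using Nat.strong_induction_on generalizing S t u v with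
  | _ N ih =>
    subst hN
    -- the case of a leaf `u` whose edge has the colour `c`
    have leaf : ∀ {S₁ γ p}, IsTreeProd a S₁ γ → p ∈ S₁ → v ∈ S₁ → S₁.card < S.card →
        a c u p * γ * a c u v = 0 := by
      intro S₁ γ p h₁ hp hv hlt
      have h0 := ih _ hlt h₁ hp hv rfl
      linear_combination (-γ) * ha.arnold c u p v + (a c u p + a c v u) * h0 +
        (γ * a c u p) * ha.swap c u v
    refine ht.elim ha hu (P := fun t => t * a c u v = 0) (fun x hx => by rw [neg_mul, hx, neg_zero])
      ?_ ?_
    · rintro rfl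
      rw [Finset.mem_singleton.1 hv, ha.loop, mul_zero]
    intro d p S₁ S₂ γ δ h₁ h₂ hp hu₂ hd hS
    have hcard : S.card = S₁.card + S₂.card := by rw [hS, Finset.card_union_of_disjoint hd]
    have hpos₁ : 0 < S₁.card := Finset.card_pos.2 ⟨p, hp⟩
    have hpos₂ : 0 < S₂.card := Finset.card_pos.2 ⟨u, hu₂⟩
    have hu₁ : u ∉ S₁ := Finset.disjoint_right.1 hd hu₂
    rw [hS] at hv
    rcases Finset.mem_union.1 hv with hv | hv
    swap
    · rw [mul_assoc, ih _ (by omega) h₂ hu₂ hv rfl, mul_zero]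
    by_cases hS₂ : S₂.card = 1
    swap
    · have := ih _ (by rw [Finset.card_insert_of_notMem hu₁]; omega) (h₁.add_leaf (c := d) hu₁ hp)
        (Finset.mem_insert_self u S₁) (Finset.mem_insert_of_mem hv) rfl
      rw [mul_right_comm, this, zero_mul]
    obtain ⟨u', hu'⟩ := Finset.card_eq_one.1 hS₂
    obtain rfl : u = u' := by rwa [hu', Finset.mem_singleton] at hu₂
    rw [hu'] at h₂
    rw [h₂.eq_one, mul_one]
    -- now `u` is a leaf, attached to `p` by an edge of colour `d`
    by_cases hdc : d = c
    · subst hdc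
      exact leaf h₁ hp hv (by omega)
    refine h₁.elim ha hp (P := fun γ => a d u p * γ * a c u v = 0)
      (fun x hx => by rw [mul_neg, neg_mul, hx, neg_zero]) ?_ ?_
    · intro e
      rw [e, Finset.mem_singleton] at hv
      rw [hv, mul_one, ha.double]
    intro e q T₁ T₂ γ' δ' k₁ k₂ hq hp₂ hd' hT
    have hcard' : S₁.card = T₁.card + T₂.card := by rw [hT, Finset.card_union_of_disjoint hd']
    have hpos₁ : 0 < T₁.card := Finset.card_pos.2 ⟨q, hq⟩
    have hpos₂ : 0 < T₂.card := Finset.card_pos.2 ⟨p, hp₂⟩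
    have hu₁' : u ∉ T₁ := fun h => hu₁ (hT ▸ Finset.mem_union_left _ h)
    have hu₂' : u ∉ T₂ := fun h => hu₁ (hT ▸ Finset.mem_union_right _ h)
    have hp₁ : p ∉ T₁ := Finset.disjoint_right.1 hd' hp₂
    rw [hT] at hv
    rcases Finset.mem_union.1 hv with hv | hv
    swap
    · have := ih _ (by rw [Finset.card_insert_of_notMem hu₂']; omega) (k₂.add_leaf (c := d) hu₂' hp₂)
        (Finset.mem_insert_self u T₂) (Finset.mem_insert_of_mem hv) rfl
      linear_combination (a e p q * γ') * this
    have hkp := k₁.add_leaf (c := e) hp₁ hq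
    by_cases hT₂ : T₂.card = 1
    swap
    · have hu₃ : u ∉ insert p T₁ := by
        rw [Finset.mem_insert, not_or]
        exact ⟨fun h => hu₁ (h ▸ hp), hu₁'⟩
      have := ih _ (by
          rw [Finset.card_insert_of_notMem hu₃, Finset.card_insert_of_notMem hp₁]; omega)
        (hkp.add_leaf (c := d) hu₃ (Finset.mem_insert_self p T₁))
        (Finset.mem_insert_self u _) (Finset.mem_insert_of_mem (Finset.mem_insert_of_mem hv)) rfl
      linear_combination δ' * this
    obtain ⟨p', hp'⟩ := Finset.card_eq_one.1 hT₂
    obtain rfl : p = p' := by rwa [hp', Finset.mem_singleton] at hp₂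
    rw [hp'] at k₂
    rw [k₂.eq_one, mul_one]
    -- now `p` has exactly two edges, to `u` and to `q`; an edge from `u` to `q` may replace them
    have hz : ∀ f, a f u q * γ' * a c u v = 0 := fun f =>
      ih _ (by rw [Finset.card_insert_of_notMem hu₁']; omega) (k₁.add_leaf (c := f) hu₁' hq)
        (Finset.mem_insert_self u T₁) (Finset.mem_insert_of_mem hv) rfl
    by_cases hed : e = d
    · subst hed
      linear_combination (γ' * a c u v) * ha.arnold e u p q + (a e p q + a e u p) * hz e -
        (γ' * a c u v) * (a e p q + a e u p) * ha.swap e q u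
    -- the colours are `d` and `c`; after they are exchanged, the edge at the leaf `u` fits
    obtain rfl : e = c := by
      cases c <;> cases d <;> cases e <;> simp_all
    have hl := leaf (k₁.add_leaf (c := d) hp₁ hq) (Finset.mem_insert_self p T₁)
      (Finset.mem_insert_of_mem hv) (by rw [Finset.card_insert_of_notMem hp₁]; omega)
    linear_combination (γ' * a e u v) * ha.mixed d e u p q hdc - hl +
      (a d p q + a d u p) * hz e + (a e p q + a e u p) * hz d -
      (γ' * a e u v) * ((a d p q + a d u p) * ha.swap e q u + (a e p q + a e u p) * ha.swap d q u)

end TreeProd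

/-! ### The products over the oriented copies span all products over trees -/

section

open RGraph

section TreeSpan

variable {X A : Type*} [LinearOrder X] [Fintype X] [CommRing A] (a : Color → X → X → A)

/-- The product of the edges of a multigraph. -/
def edgeProd {X A : Type*} [CommRing A] (a : Color → X → X → A) (Γ : OGraph X) : A :=
  (Γ.map fun e => a e.color e.src e.dst).prod

variable {a} {G H K : RGraph X} {c : Color} {p m : X}

theorem RGraph.Graftable.edgeProd_graft (h : Graftable c p G H) :
    edgeProd a (graft c p G H).orientedCopy = a c p H.root * edgeProd a G.orientedCopy * edgeProd a H.orientedCopy := by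
  rw [h.orientedCopy_graft]
  simp only [edgeProd, Multiset.map_cons, Multiset.prod_cons, Multiset.map_add,
    Multiset.prod_add, mul_assoc]

theorem edgeProd_single (x : X) : edgeProd a (RGraph.single x).orientedCopy = 1 := by
  rw [orientedCopy_single, edgeProd, Multiset.map_zero, Multiset.prod_zero]

theorem edgeProd_merge (hG : G.IsArb) (hH : H.IsArb)
    (hv : ∀ x, x ∈ G.verts → x ∈ H.verts → x = H.root) :
    edgeProd a (merge G H).orientedCopy = edgeProd a G.orientedCopy * edgeProd a H.orientedCopy := by
  rw [orientedCopy_merge hG hH hv]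
  simp only [edgeProd, Multiset.map_add, Multiset.prod_add]

theorem isTreeProd_edgeProd (hG : G.IsArb) : IsTreeProd a G.verts (edgeProd a G.orientedCopy) := by
  have key : ∀ T : BTree X, T.leaves.Nodup →
      IsTreeProd a T.toRGraph.verts (edgeProd a T.toRGraph.orientedCopy) := by
    intro T hT
    induction T with
    | leaf x =>
      rw [BTree.toRGraph, edgeProd_single]
      exact .single x
    | node c S T hS hT' =>
      obtain ⟨nS, nT, hd⟩ := BTree.nodup_node.1 hT
      have gS := S.isArb_toRGraph nS
      have gT := T.isArb_toRGraph nT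
      rw [BTree.toRGraph]
      rcases beats_or_beats c (gS.root_ne gT hd) with b | b
      · rw [join_eq_graft b, (graftable_root gS gT hd b).edgeProd_graft]
        exact .join c (hS nS) (hT' nT) hd gS.root_mem gT.root_mem
      · rw [join_comm, join_eq_graft b, (graftable_root gT gS hd.symm b).edgeProd_graft]
        exact .join c (hT' nT) (hS nS) hd.symm gT.root_mem gS.root_mem
  have := key _ hG.bMonomial_spec.1
  rwa [hG.bMonomial_spec.2] at this

/-- The span of the products over the oriented copies of the trees with vertex set `S`. -/
def treeSpan (R : Type*) {X A : Type*} [LinearOrder X] [Fintype X] [CommRing R] [CommRing A]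
    [Algebra R A] (a : Color → X → X → A) (S : Finset X) : Submodule R A :=
  Submodule.span R {t | ∃ G : RGraph X, G.IsArb ∧ G.verts = S ∧ t = edgeProd a G.orientedCopy}

variable {R : Type*} [CommRing R] [Algebra R A] {S T : Finset X} {s t x : A}

theorem edgeProd_mem_treeSpan (hG : G.IsArb) (hv : G.verts = S) :
    edgeProd a G.orientedCopy ∈ treeSpan R a S :=
  Submodule.subset_span ⟨G, hG, hv, rfl⟩

/-- To show that multiplication by `x` maps one span into another, it suffices to consider trees. -/
theorem mul_mem_of_mem_treeSpan {V : Submodule R A} (ht : t ∈ treeSpan R a S)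
    (h : ∀ G : RGraph X, G.IsArb → G.verts = S → x * edgeProd a G.orientedCopy ∈ V) :
    x * t ∈ V := by
  have : treeSpan R a S ≤ V.comap (LinearMap.mulLeft R x) := by
    refine Submodule.span_le.2 ?_
    rintro _ ⟨G, hG, hv, rfl⟩
    exact h G hG hv
  exact this ht

/-- The minimal vertex is a child only along blue edges. -/
theorem mul_blue_mem_treeSpan (hm : ∀ y ∈ S, m < y) (hp : p ∈ S) (ht : t ∈ treeSpan R a S) :
    a .blue p m * t ∈ treeSpan R a (insert m S) := by
  refine mul_mem_of_mem_treeSpan ht fun G hG hv => ?_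
  subst hv
  have g : Graftable .blue p G (RGraph.single m) :=
    ⟨hG, isArb_single m, Finset.disjoint_singleton_right.2 fun h => (hm m h).false, hp,
      beats_blue.2 (hm p hp)⟩
  have := g.edgeProd_graft (a := a)
  rw [edgeProd_single, mul_one] at this
  rw [← show _ = a .blue p m * _ from this]
  exact edgeProd_mem_treeSpan g.isArb (by ext; simp [graft, RGraph.single])

omit [Fintype X] in
/-- If `m` is not the root of a tree with minimal vertex `m`, then it hangs at a blue edge. -/
theorem exists_graft_blue (hG : G.IsArb) (hm : ∀ y ∈ G.verts, m ≤ y) (hmG : m ∈ G.verts)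
    (hr : G.root ≠ m) : ∃ p G₁ G₂, Graftable .blue p G₁ G₂ ∧ G₂.root = m ∧
      G = graft .blue p G₁ G₂ := by
  rcases ReflTransGen.cases_tail (hG.reach m hmG) with e | ⟨p, -, c, hc⟩
  · exact absurd e.symm hr
  obtain ⟨G₁, G₂, h, -, h₂, e⟩ := hG.exists_graft hc
  rcases hc.2 with ⟨rfl, l⟩ | ⟨rfl, l⟩
  · exact absurd l (hm p (hG.src_mem hc)).not_gt
  · exact ⟨p, G₁, G₂, h, h₂, e⟩

section Inductive

variable (ha : IsEdgeSystem a) {N : ℕ}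
  (ih : ∀ (S : Finset X) (t : A), S.card < N → IsTreeProd a S t → t ∈ treeSpan R a S)
include ha ih

/-- If both trees have a parent of `m`, then Arnold's relation replaces one of the two edges to `m` by
an edge between the parents. What is above `m` then is a tree on fewer vertices, which is a combination
of avoiding trees by induction, and everything below `m` is attached to each of these again. -/
theorem edgeProd_mul_mem_treeSpan (hG : G.IsArb) (hH : H.IsArb) (hmG : m ∈ G.verts)
    (hmH : m ∈ H.verts) (hGH : ∀ x ∈ G.verts, x ∈ H.verts → x = m)
    (hm : ∀ y ∈ G.verts ∪ H.verts, m ≤ y) (hN : (G.verts ∪ H.verts).card ≤ N) :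
    edgeProd a G.orientedCopy * edgeProd a H.orientedCopy ∈ treeSpan R a (G.verts ∪ H.verts) := by
  by_cases hrH : H.root = m
  · rw [← edgeProd_merge hG hH fun x h h' => (hGH x h h').trans hrH.symm]
    exact edgeProd_mem_treeSpan (isArb_merge hG hH (fun x h h' => (hGH x h h').trans hrH.symm)
      (hrH ▸ hmG)) rfl
  by_cases hrG : G.root = m
  · rw [mul_comm, Finset.union_comm,
      ← edgeProd_merge hH hG fun x h h' => (hGH x h' h).trans hrG.symm]
    exact edgeProd_mem_treeSpan (isArb_merge hH hG (fun x h h' => (hGH x h' h).trans hrG.symm)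
      (hrG ▸ hmH)) rfl
  obtain ⟨p, G₁, G₂, gG, rfl, rfl⟩ := exists_graft_blue hG
    (fun y hy => hm y (Finset.mem_union_left _ hy)) hmG hrG
  obtain ⟨q, H₁, H₂, gH, hr, rfl⟩ := exists_graft_blue hH
    (fun y hy => hm y (Finset.mem_union_right _ hy)) hmH hrH
  have vG : (graft .blue p G₁ G₂).verts = G₁.verts ∪ G₂.verts := rfl
  have vH : (graft .blue q H₁ H₂).verts = H₁.verts ∪ H₂.verts := rfl
  rw [vG, vH] at hm hN hGH ⊢
  rw [vG] at hmG
  rw [vH] at hmH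
  have hm₁ : G₂.root ∉ G₁.verts := gG.not_mem' gG.right.root_mem
  have hm₂ : G₂.root ∉ H₁.verts := hr ▸ gH.not_mem' gH.right.root_mem
  have hGH' : ∀ {x}, x ∈ G₁.verts ∨ x ∈ G₂.verts → x ∈ H₁.verts ∨ x ∈ H₂.verts →
      x = G₂.root := fun h h' => hGH _ (Finset.mem_union.2 h) (Finset.mem_union.2 h')
  have hd : Disjoint G₁.verts H₁.verts := Finset.disjoint_left.2 fun x h h' =>
    hm₁ (hGH' (.inl h) (.inl h') ▸ h)
  -- the tree `M` consists of everything below `m`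
  have hv₂ : ∀ x, x ∈ G₂.verts → x ∈ H₂.verts → x = H₂.root := fun x h h' =>
    (hGH' (.inr h) (.inr h')).trans hr.symm
  have hM : (merge G₂ H₂).IsArb := isArb_merge gG.right gH.right hv₂ (hr ▸ gG.right.root_mem)
  have tree := IsTreeProd.join .blue (isTreeProd_edgeProd (a := a) gG.left)
    (isTreeProd_edgeProd (a := a) gH.left) hd gG.mem gH.mem
  have hsub : G₁.verts ∪ H₁.verts ⊆ (G₁.verts ∪ G₂.verts) ∪ (H₁.verts ∪ H₂.verts) := by
    intro x; simp only [Finset.mem_union]; tauto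
  have hK := ih _ _ ((Finset.card_lt_card ⟨hsub, fun h => by
    have : G₂.root ∈ G₁.verts ∪ H₁.verts := h (Finset.mem_union_left _ hmG)
    exact (Finset.mem_union.1 this).elim hm₁ hm₂⟩).trans_le hN) tree
  have attach : ∀ r ∈ G₁.verts ∪ H₁.verts,
      a .blue r G₂.root * (edgeProd a G₂.orientedCopy * edgeProd a H₂.orientedCopy) *
        (a .blue p q * edgeProd a G₁.orientedCopy * edgeProd a H₁.orientedCopy) ∈
      treeSpan R a ((G₁.verts ∪ G₂.verts) ∪ (H₁.verts ∪ H₂.verts)) := by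
    intro r hrm
    refine mul_mem_of_mem_treeSpan hK fun K hK hv => ?_
    have g : Graftable .blue r K (merge G₂ H₂) := by
      refine ⟨hK, hM, ?_, hv ▸ hrm, beats_blue.2 (lt_of_le_of_ne (hm r (hsub hrm)) ?_)⟩
      · rw [hv, merge, Finset.disjoint_left]
        intro x h h'
        rw [Finset.mem_union] at h h'
        rcases h with h | h <;> rcases h' with h' | h'
        · exact gG.not_mem h h'
        · exact hm₁ (hGH' (.inl h) (.inr h') ▸ h)
        · exact hm₂ (hGH' (.inr h') (.inl h) ▸ h)
        · exact gH.not_mem h h'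
      · intro e
        change G₂.root = r at e
        rw [← e, Finset.mem_union] at hrm
        exact hrm.elim hm₁ hm₂
    have := g.edgeProd_graft (a := a)
    rw [edgeProd_merge gG.right gH.right hv₂] at this
    rw [mul_right_comm, ← show _ = a .blue r G₂.root * _ * _ from this]
    refine edgeProd_mem_treeSpan g.isArb ?_
    change K.verts ∪ (G₂.verts ∪ H₂.verts) = _
    rw [hv]
    ext x; simp only [Finset.mem_union]; tauto
  have h₁ := attach q (Finset.mem_union_right _ gH.mem)
  have h₂ := attach p (Finset.mem_union_left _ gG.mem)
  rw [gG.edgeProd_graft, gH.edgeProd_graft, hr]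
  convert sub_mem h₁ h₂ using 1
  linear_combination (edgeProd a G₁.orientedCopy * edgeProd a H₁.orientedCopy *
    edgeProd a G₂.orientedCopy * edgeProd a H₂.orientedCopy) *
    ((a .blue p q + a .blue q G₂.root) * ha.swap .blue G₂.root p - ha.arnold .blue G₂.root p q)

/-- Two trees that share their minimal vertex only may be merged. -/
theorem mul_mem_treeSpan (hmS : m ∈ S) (hmT : m ∈ T) (hST : ∀ x ∈ S, x ∈ T → x = m)
    (hm : ∀ y ∈ S ∪ T, m ≤ y) (hN : (S ∪ T).card ≤ N) (hs : s ∈ treeSpan R a S)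
    (ht : t ∈ treeSpan R a T) : s * t ∈ treeSpan R a (S ∪ T) := by
  refine mul_mem_of_mem_treeSpan ht fun H hH hv => ?_
  rw [mul_comm]
  refine mul_mem_of_mem_treeSpan hs fun G hG hv' => ?_
  subst hv hv'
  rw [mul_comm]
  exact edgeProd_mul_mem_treeSpan ha ih hG hH hmS hmT hST hm hN

/-- The case of a red edge at the minimal vertex `m`: the other end `p` of this edge is moved to the
parent `q` of `p`, until it reaches the root, above which `m` can be put. All other terms of the
relations contain two edges at `m`, or a blue edge at the leaf `m`. -/
theorem mul_red_mem_treeSpan (hm : ∀ y ∈ S, m < y) (hN : S.card < N) (hp : p ∈ S)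
    (ht : t ∈ treeSpan R a S) : a .red m p * t ∈ treeSpan R a (insert m S) := by
  refine mul_mem_of_mem_treeSpan ht fun G hG hv => ?_
  subst hv
  have hmG : m ∉ G.verts := fun h => (hm m h).false
  induction hG.reach p hp with
  | refl =>
    have g : Graftable .red m (RGraph.single m) G :=
      ⟨isArb_single m, hG, Finset.disjoint_singleton_left.2 hmG, Finset.mem_singleton_self m,
        beats_red.2 (hm _ hp)⟩
    have := g.edgeProd_graft (a := a)
    rw [edgeProd_single, mul_one] at this
    rw [← show _ = a .red m _ * _ from this]
    exact edgeProd_mem_treeSpan g.isArb rfl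
  | @tail q p _ hqp hq =>
    obtain ⟨e, he⟩ := hqp
    have hq := hq (hG.src_mem he)
    obtain ⟨G₁, G₂, g, -, rfl, rfl⟩ := hG.exists_graft he
    have hG₁ := isTreeProd_edgeProd (a := a) g.left
    have hG₂ := isTreeProd_edgeProd (a := a) g.right
    have hv : (graft e q G₁ G₂).verts = G₁.verts ∪ G₂.verts := rfl
    rw [hv] at hm hN hq hp hmG ⊢
    rw [g.edgeProd_graft] at hq ⊢
    have hm₁ : m ∉ G₁.verts := fun h => hmG (Finset.mem_union_left _ h)
    have hm₂ : m ∉ G₂.verts := fun h => hmG (Finset.mem_union_right _ h)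
    have hc : (G₁.verts ∪ G₂.verts).card = G₁.verts.card + G₂.verts.card :=
      Finset.card_union_of_disjoint g.disj
    have hpos₁ : 0 < G₁.verts.card := Finset.card_pos.2 ⟨_, g.mem⟩
    have hpos₂ : 0 < G₂.verts.card := Finset.card_pos.2 ⟨_, g.right.root_mem⟩
    -- both parts of the tree attached to `m`
    have both : ∀ c d, (a c m q * edgeProd a G₁.orientedCopy) *
        (a d m G₂.root * edgeProd a G₂.orientedCopy) ∈
        treeSpan R a (insert m (G₁.verts ∪ G₂.verts)) := by
      intro c d
      rw [Finset.insert_union_distrib]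
      refine mul_mem_treeSpan ha ih (m := m) (Finset.mem_insert_self _ _)
        (Finset.mem_insert_self _ _) ?_ ?_ ?_ (ih _ _ ?_ (hG₁.add_leaf hm₁ g.mem))
        (ih _ _ ?_ (hG₂.add_leaf hm₂ g.right.root_mem))
      · intro x h h'
        rw [Finset.mem_insert] at h h'
        rcases h with h | h
        · exact h
        rcases h' with h' | h'
        · exact h'
        exact absurd h' (g.not_mem h)
      · intro y hy
        rw [← Finset.insert_union_distrib, Finset.mem_insert] at hy
        rcases hy with rfl | hy
        exacts [le_rfl, (hm y hy).le]
      · rwa [← Finset.insert_union_distrib, Finset.card_insert_of_notMem hmG]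
      · rw [Finset.card_insert_of_notMem hm₁]; omega
      · rw [Finset.card_insert_of_notMem hm₂]; omega
    cases e with
    | red =>
      convert sub_mem hq (both .red .red) using 1
      linear_combination (edgeProd a G₁.orientedCopy * edgeProd a G₂.orientedCopy) *
        ((a .red q G₂.root + a .red m q) * ha.swap .red m G₂.root - ha.arnold .red m q G₂.root)
    | blue =>
      have tree := IsTreeProd.join .red hG₁ hG₂ g.disj g.mem g.right.root_mem
      have hb : ∀ r ∈ G₁.verts ∪ G₂.verts, a .blue r m *
          (a .red q G₂.root * edgeProd a G₁.orientedCopy * edgeProd a G₂.orientedCopy) ∈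
          treeSpan R a (insert m (G₁.verts ∪ G₂.verts)) :=
        fun r hr => mul_blue_mem_treeSpan hm hr (ih _ _ hN tree)
      convert sub_mem (add_mem hq (sub_mem (hb _ hp) (hb q (Finset.mem_union_left _ g.mem))))
        (add_mem (both .red .blue) (both .blue .red)) using 1
      linear_combination (edgeProd a G₁.orientedCopy * edgeProd a G₂.orientedCopy) *
        ((a .blue q G₂.root + a .blue m q) * ha.swap .red m G₂.root +
          a .red q G₂.root * ha.swap .blue q m + a .red m q * ha.swap .blue m G₂.root -
          ha.mixed .red .blue m q G₂.root (by simp))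

end Inductive

/-- The products over all trees lie in the span of the products over oriented copies. -/
theorem IsTreeProd.mem_treeSpan (ha : IsEdgeSystem a) (ht : IsTreeProd a S t) :
    t ∈ treeSpan R a S := by
  induction hN : S.card using Nat.strong_induction_on generalizing S t with
  | _ N ih =>
    subst hN
    have ih' : ∀ (S' : Finset X) (t : A), S'.card < S.card → IsTreeProd a S' t →
      t ∈ treeSpan R a S' := fun S' t h h' => ih _ h h' rfl
    have hne : S.Nonempty := by
      cases ht with
      | single x => exact Finset.singleton_nonempty x
      | join c _ _ _ hu _ => exact ⟨_, Finset.mem_union_left _ hu⟩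
    have hmS := S.min'_mem hne
    have hmle : ∀ y ∈ S, S.min' hne ≤ y := fun y hy => S.min'_le y hy
    generalize S.min' hne = m at hmS hmle
    refine ht.elim ha hmS (P := fun t => t ∈ treeSpan R a S) (fun _ => neg_mem) ?_ ?_
    · intro e
      rw [← edgeProd_single (a := a) m]
      exact edgeProd_mem_treeSpan (isArb_single m) e.symm
    intro c p S₁ S₂ γ δ h₁ h₂ hp hm₂ hd hS
    have hcard : S.card = S₁.card + S₂.card := by rw [hS, Finset.card_union_of_disjoint hd]
    have hpos₁ : 0 < S₁.card := Finset.card_pos.2 ⟨p, hp⟩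
    have hpos₂ : 0 < S₂.card := Finset.card_pos.2 ⟨m, hm₂⟩
    have hm₁ : m ∉ S₁ := Finset.disjoint_right.1 hd hm₂
    by_cases hS₂ : S₂.card = 1
    · obtain ⟨m', hm'⟩ := Finset.card_eq_one.1 hS₂
      obtain rfl : m = m' := by rwa [hm', Finset.mem_singleton] at hm₂
      rw [hm'] at h₂
      have hlt : ∀ y ∈ S₁, m < y := fun y hy => lt_of_le_of_ne
        (hmle y (hS ▸ Finset.mem_union_left _ hy)) fun h => hm₁ (h ▸ hy)
      have hγ := ih' S₁ γ (by omega) h₁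
      rw [h₂.eq_one, mul_one, hS, hm', Finset.union_comm, ← Finset.insert_eq]
      cases c with
      | red => exact mul_red_mem_treeSpan ha ih' hlt (by omega) hp hγ
      | blue =>
        rw [ha.swap, neg_mul]
        exact neg_mem (mul_blue_mem_treeSpan hlt hp hγ)
    · have hins : insert m S₁ ∪ S₂ = S := by
        rw [hS, Finset.insert_union, Finset.insert_eq_of_mem (Finset.mem_union_right _ hm₂)]
      rw [← hins]
      refine mul_mem_treeSpan ha ih' (Finset.mem_insert_self m S₁) hm₂ ?_ ?_ ?_
        (ih' _ _ ?_ (h₁.add_leaf hm₁ hp)) (ih' _ _ ?_ h₂)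
      · intro x h h'
        rcases Finset.mem_insert.1 h with h | h
        · exact h
        · exact absurd h' (Finset.disjoint_left.1 hd h)
      · rwa [hins]
      · rw [hins]
      · rw [Finset.card_insert_of_notMem hm₁]; omega
      · omega

end TreeSpan

end

/-! ### The ring of graphs -/

section

open RGraph

section GraphRing

variable (R : Type*) [CommRing R] (X : Type*)

/-- The largest ideal of the ring of graphs (with disjoint union as multiplication) contained in
the submodule `eilRelations`. Apart from disconnected graphs, all the defining relations lie in
it. -/
noncomputable def edgeIdeal : Ideal (AddMonoidAlgebra R (OGraph X)) where
  carrier := {x | ∀ y, (y * x).coeff ∈ eilRelations R X}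
  zero_mem' y := by rw [mul_zero, AddMonoidAlgebra.coeff_zero]; exact zero_mem _
  add_mem' hx hx' y := by
    rw [mul_add, AddMonoidAlgebra.coeff_add]
    exact add_mem (hx y) (hx' y)
  smul_mem' z x hx y := by
    rw [smul_eq_mul, ← mul_assoc]
    exact hx _

variable {R X}

theorem coeff_mem_of_mem_edgeIdeal {x : AddMonoidAlgebra R (OGraph X)} (hx : x ∈ edgeIdeal R X) :
    x.coeff ∈ eilRelations R X := by
  simpa using hx 1

theorem mem_edgeIdeal {x : AddMonoidAlgebra R (OGraph X)} (h : ∀ Γ : OGraph X,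
    (AddMonoidAlgebra.single Γ 1 * x).coeff ∈ eilRelations R X) : x ∈ edgeIdeal R X := by
  intro y
  induction y using AddMonoidAlgebra.induction_linear with
  | zero => rw [zero_mul, AddMonoidAlgebra.coeff_zero]; exact zero_mem _
  | add y y' hy hy' =>
    rw [add_mul, AddMonoidAlgebra.coeff_add]
    exact add_mem hy hy'
  | single Γ r =>
    have : AddMonoidAlgebra.single Γ r = r • AddMonoidAlgebra.single Γ (1 : R) := by
      rw [AddMonoidAlgebra.smul_single, smul_eq_mul, mul_one]
    rw [this, smul_mul_assoc, AddMonoidAlgebra.coeff_smul]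
    exact Submodule.smul_mem _ r (h Γ)

theorem coeff_single_mul_single (Γ Γ' : OGraph X) :
    (AddMonoidAlgebra.single Γ (1 : R) * AddMonoidAlgebra.single Γ' 1).coeff =
      gr R (Γ' + Γ) := by
  rw [AddMonoidAlgebra.single_mul_single, AddMonoidAlgebra.coeff_single, mul_one, gr, add_comm]

variable (R X) in
/-- The ring of graphs modulo the relations between edges. -/
abbrev GraphRing : Type _ := AddMonoidAlgebra R (OGraph X) ⧸ edgeIdeal R X

variable (R) in
/-- The class of a graph in the ring of graphs. -/
noncomputable def graphClass (Γ : OGraph X) : GraphRing R X :=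
  Ideal.Quotient.mk (edgeIdeal R X) (AddMonoidAlgebra.single Γ 1)

open Classical in
variable (R) in
/-- The class of a single edge, which is zero for loops by convention. -/
noncomputable def edgeClass (c : Color) (i j : X) : GraphRing R X :=
  if h : i ≠ j then graphClass R {⟨i, j, c, h⟩} else 0

theorem edgeClass_of_ne (c : Color) {i j : X} (h : i ≠ j) :
    edgeClass R c i j = graphClass R {⟨i, j, c, h⟩} := dif_pos h

theorem edgeClass_self (c : Color) (i : X) : edgeClass R c i i = 0 := dif_neg (by simp)

theorem graphClass_mul (Γ Γ' : OGraph X) :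
    graphClass R Γ * graphClass R Γ' = graphClass R (Γ + Γ') := by
  rw [graphClass, graphClass, graphClass, ← map_mul, AddMonoidAlgebra.single_mul_single, mul_one]

theorem graphClass_eq_edgeProd (Γ : OGraph X) : graphClass R Γ = edgeProd (edgeClass R) Γ := by
  induction Γ using Multiset.induction with
  | empty =>
    rw [edgeProd, Multiset.map_zero, Multiset.prod_zero, graphClass, ← AddMonoidAlgebra.one_def,
      map_one]
  | cons e Γ ih =>
    rw [← Multiset.singleton_add, ← graphClass_mul, ih, edgeProd, edgeProd, Multiset.map_add,
      Multiset.prod_add, Multiset.map_singleton, Multiset.prod_singleton, edgeClass_of_ne _ e.ne]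

theorem edgeClass_mul_edgeClass (c d : Color) {i j k : X} (hij : i ≠ j) (hjk : j ≠ k) :
    edgeClass R c i j * edgeClass R d j k = graphClass R (addTwo 0 c d i j k hij hjk) := by
  rw [edgeClass_of_ne c hij, edgeClass_of_ne d hjk, graphClass_mul]
  rfl

theorem isEdgeSystem_edgeClass : IsEdgeSystem (edgeClass R (X := X)) := by
  have loop : ∀ (c : Color) (i : X), edgeClass R c i i = 0 := edgeClass_self
  have swap : ∀ (c : Color) (i j : X), edgeClass R c i j = -edgeClass R c j i := by
    intro c i j
    by_cases h : i = j
    · rw [h, edgeClass_self, neg_zero]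
    rw [eq_neg_iff_add_eq_zero, edgeClass_of_ne c h, edgeClass_of_ne c (Ne.symm h), graphClass,
      graphClass, ← map_add, Ideal.Quotient.eq_zero_iff_mem]
    refine mem_edgeIdeal fun Γ => ?_
    rw [mul_add, AddMonoidAlgebra.coeff_add, coeff_single_mul_single, coeff_single_mul_single]
    exact Submodule.subset_span (.inl (.inl (.inl (.inl ⟨Γ, ⟨i, j, c, h⟩, rfl⟩))))
  have double : ∀ (c d : Color) (i j : X), edgeClass R c i j * edgeClass R d i j = 0 := by
    intro c d i j
    by_cases h : i = j
    · rw [h, edgeClass_self, zero_mul]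
    rw [edgeClass_of_ne c h, edgeClass_of_ne d h, graphClass_mul, graphClass,
      Ideal.Quotient.eq_zero_iff_mem]
    refine mem_edgeIdeal fun Γ => ?_
    rw [coeff_single_mul_single]
    refine Submodule.subset_span (.inl (.inr ⟨_, ⟨i, j, ?_⟩, rfl⟩))
    classical
    rw [Multiset.countP_add, Multiset.countP_add, ← Multiset.cons_zero, ← Multiset.cons_zero,
      Multiset.countP_cons_of_pos _ (by exact .inl ⟨rfl, rfl⟩),
      Multiset.countP_cons_of_pos _ (by exact .inl ⟨rfl, rfl⟩)]
    omega
  have cyclic : ∀ (c d : Color) (Γ : OGraph X) (i j k : X) (hij : i ≠ j) (hjk : j ≠ k)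
      (hki : k ≠ i), (AddMonoidAlgebra.single Γ (1 : R) *
        (AddMonoidAlgebra.single (addTwo 0 c d i j k hij hjk) 1 +
          AddMonoidAlgebra.single (addTwo 0 c d j k i hjk hki) 1 +
          AddMonoidAlgebra.single (addTwo 0 c d k i j hki hij) 1)).coeff =
      cyclicSum R Γ c d i j k hij hjk hki := by
    intro c d Γ i j k hij hjk hki
    simp only [mul_add, AddMonoidAlgebra.coeff_add, coeff_single_mul_single, cyclicSum, addTwo,
      Multiset.cons_add, zero_add]
  -- if two of the vertices coincide, then only products of parallel edges remain
  have mixed : ∀ i j k : X,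
      edgeClass R .blue i j * edgeClass R .red j k + edgeClass R .blue j k * edgeClass R .red k i +
        edgeClass R .blue k i * edgeClass R .red i j +
      (edgeClass R .red i j * edgeClass R .blue j k + edgeClass R .red j k * edgeClass R .blue k i +
        edgeClass R .red k i * edgeClass R .blue i j) = 0 := by
    intro i j k
    by_cases hij : i = j
    · subst hij
      linear_combination (edgeClass R .red i k + edgeClass R .red k i) * loop .blue i +
        (edgeClass R .blue i k + edgeClass R .blue k i) * loop .red i +
        edgeClass R .blue i k * swap .red k i + edgeClass R .red i k * swap .blue k i -
        2 * double .blue .red i k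
    by_cases hjk : j = k
    · subst hjk
      linear_combination (edgeClass R .red i j + edgeClass R .red j i) * loop .blue j +
        (edgeClass R .blue i j + edgeClass R .blue j i) * loop .red j +
        edgeClass R .blue i j * swap .red j i + edgeClass R .red i j * swap .blue j i -
        2 * double .blue .red i j
    by_cases hki : k = i
    · subst hki
      linear_combination (edgeClass R .red k j + edgeClass R .red j k) * loop .blue k +
        (edgeClass R .blue k j + edgeClass R .blue j k) * loop .red k +
        edgeClass R .blue k j * swap .red j k + edgeClass R .red k j * swap .blue j k -
        2 * double .blue .red k j
    simp only [edgeClass_mul_edgeClass _ _ hij hjk, edgeClass_mul_edgeClass _ _ hjk hki,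
      edgeClass_mul_edgeClass _ _ hki hij]
    simp only [graphClass, ← map_add]
    rw [Ideal.Quotient.eq_zero_iff_mem]
    refine mem_edgeIdeal fun Γ => ?_
    rw [mul_add, AddMonoidAlgebra.coeff_add, cyclic, cyclic]
    exact Submodule.subset_span (.inl (.inl (.inr ⟨Γ, i, j, k, hij, hjk, hki, rfl⟩)))
  refine ⟨loop, swap, double, fun c i j k => ?_, fun c d i j k hcd => ?_⟩
  · by_cases hij : i = j
    · subst hij
      linear_combination (edgeClass R c i k + edgeClass R c k i) * loop c i +
        edgeClass R c i k * swap c k i - double c c i k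
    by_cases hjk : j = k
    · subst hjk
      linear_combination (edgeClass R c i j + edgeClass R c j i) * loop c j +
        edgeClass R c i j * swap c j i - double c c i j
    by_cases hki : k = i
    · subst hki
      linear_combination (edgeClass R c k j + edgeClass R c j k) * loop c k +
        edgeClass R c k j * swap c j k - double c c k j
    rw [edgeClass_mul_edgeClass _ _ hij hjk, edgeClass_mul_edgeClass _ _ hjk hki,
      edgeClass_mul_edgeClass _ _ hki hij]
    simp only [graphClass, ← map_add]
    rw [Ideal.Quotient.eq_zero_iff_mem]
    refine mem_edgeIdeal fun Γ => ?_
    rw [cyclic]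
    exact Submodule.subset_span (.inl (.inl (.inl (.inr ⟨Γ, c, i, j, k, hij, hjk, hki, rfl⟩))))
  · have h := mixed i j k
    cases c <;> cases d
    · exact absurd rfl hcd
    · rw [add_comm]; exact h
    · exact h
    · exact absurd rfl hcd

end GraphRing

/-! ### Connected graphs -/

section Connected

variable {X A : Type*} [LinearOrder X] [Fintype X] [CommRing A] {a : Color → X → X → A}

/-- A connected graph contains a spanning tree. -/
theorem exists_spanning_tree {Γ : OGraph X} (hΓ : Γ.IsConnected) (a : Color → X → X → A) :
    ∃ Γ₁ Γ₂, Γ = Γ₁ + Γ₂ ∧ IsTreeProd a Finset.univ (edgeProd a Γ₁) := by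
  have key : ∀ k, k + 1 ≤ Fintype.card X → ∃ (S : Finset X) (Γ₁ Γ₂ : OGraph X), S.card = k + 1 ∧
      Γ = Γ₁ + Γ₂ ∧ (∀ e ∈ Γ₁, e.src ∈ S ∧ e.dst ∈ S) ∧ IsTreeProd a S (edgeProd a Γ₁) := by
    intro k hk
    induction k with
    | zero =>
      obtain ⟨x⟩ := hΓ.nonempty
      refine ⟨{x}, 0, Γ, by simp, by simp, by simp, ?_⟩
      rw [edgeProd, Multiset.map_zero, Multiset.prod_zero]
      exact .single x
    | succ k ih =>
      obtain ⟨S, Γ₁, Γ₂, hS, hΓ', hmem, ht⟩ := ih (by omega)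
      obtain ⟨u, hu⟩ : S.Nonempty := Finset.card_pos.1 (by omega)
      obtain ⟨v, hv⟩ : ∃ v, v ∉ S := by
        by_contra! h
        rw [Finset.eq_univ_iff_forall.2 h, Finset.card_univ] at hS
        omega
      obtain ⟨w⟩ := hΓ.preconnected u v
      obtain ⟨d, -, h₁, h₂⟩ := w.exists_boundary_dart (S : Set X) hu hv
      have hadj := d.adj
      rw [SimpleGraph.fromRel_adj] at hadj
      obtain ⟨e, he, hends⟩ : ∃ e ∈ Γ, (e.src = d.fst ∧ e.dst = d.snd) ∨
          (e.src = d.snd ∧ e.dst = d.fst) := by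
        rcases hadj.2 with ⟨e, he, h⟩ | ⟨e, he, h⟩
        exacts [⟨e, he, .inl h⟩, ⟨e, he, .inr h⟩]
      generalize d.fst = x at h₁ hends
      generalize d.snd = y at h₂ hends
      simp only [Finset.mem_coe] at h₁ h₂
      have he₂ : e ∈ Γ₂ := by
        rw [hΓ'] at he
        refine (Multiset.mem_add.1 he).resolve_left fun h => h₂ ?_
        rcases hends with ⟨-, rfl⟩ | ⟨rfl, -⟩
        exacts [(hmem e h).2, (hmem e h).1]
      obtain ⟨Γ₃, rfl⟩ := Multiset.exists_cons_of_mem he₂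
      have hprod : edgeProd a (e ::ₘ Γ₁) = a e.color e.src e.dst * edgeProd a Γ₁ := by
        rw [edgeProd, Multiset.map_cons, Multiset.prod_cons, edgeProd]
      refine ⟨insert y S, e ::ₘ Γ₁, Γ₃, by rw [Finset.card_insert_of_notMem h₂, hS], ?_, ?_, ?_⟩
      · rw [hΓ', Multiset.add_cons, Multiset.cons_add]
      · intro f hf
        rcases Multiset.mem_cons.1 hf with rfl | hf
        · rcases hends with ⟨rfl, rfl⟩ | ⟨rfl, rfl⟩ <;> simp [h₁]
        · exact ⟨Finset.mem_insert_of_mem (hmem f hf).1, Finset.mem_insert_of_mem (hmem f hf).2⟩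
      · rw [hprod]
        rcases hends with ⟨rfl, rfl⟩ | ⟨rfl, rfl⟩
        · have := IsTreeProd.join (a := a) e.color ht (.single e.dst)
            (Finset.disjoint_singleton_right.2 h₂) h₁ (Finset.mem_singleton_self _)
          rwa [mul_one, Finset.union_comm, ← Finset.insert_eq] at this
        · exact ht.add_leaf h₂ h₁
  obtain ⟨x⟩ := hΓ.nonempty
  have hpos : 0 < Fintype.card X := Fintype.card_pos_iff.2 ⟨x⟩
  obtain ⟨S, Γ₁, Γ₂, hS, hΓ', -, ht⟩ := key (Fintype.card X - 1) (by omega)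
  obtain rfl : S = Finset.univ := Finset.card_eq_iff_eq_univ S |>.1 (by omega)
  exact ⟨Γ₁, Γ₂, hΓ', ht⟩

theorem edgeProd_mem_treeSpan_univ (R : Type*) [CommRing R] [Algebra R A] (ha : IsEdgeSystem a)
    {Γ : OGraph X} (hΓ : Γ.IsConnected) : edgeProd a Γ ∈ treeSpan R a Finset.univ := by
  obtain ⟨Γ₁, Γ₂, rfl, ht⟩ := exists_spanning_tree hΓ a
  rcases Multiset.empty_or_exists_mem Γ₂ with rfl | ⟨e, he⟩
  · rw [add_zero]
    exact ht.mem_treeSpan ha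
  · obtain ⟨Γ₃, rfl⟩ := Multiset.exists_cons_of_mem he
    have h0 := ht.mul_edge ha (Finset.mem_univ e.src) (Finset.mem_univ e.dst) e.color
    have : edgeProd a (Γ₁ + e ::ₘ Γ₃) = 0 := by
      rw [edgeProd, Multiset.map_add, Multiset.prod_add, Multiset.map_cons, Multiset.prod_cons,
        ← mul_assoc]
      rw [edgeProd] at h0
      rw [h0, zero_mul]
    rw [this]
    exact zero_mem _

/-- The classes of the oriented copies span `Eil₂`. -/
theorem mkQ_gr_mem_span (R : Type*) [CommRing R] (Γ : OGraph X) :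
    (eilRelations R X).mkQ (gr R Γ) ∈ Submodule.span R {x | ∃ G : RGraph X, G.IsArb ∧
      G.verts = Finset.univ ∧ x = (eilRelations R X).mkQ (gr R G.orientedCopy)} := by
  by_cases hΓ : Γ.IsConnected
  swap
  · have : gr R Γ ∈ eilRelations R X := Submodule.subset_span (.inr ⟨Γ, hΓ, rfl⟩)
    rw [Submodule.mkQ_apply, (Submodule.Quotient.mk_eq_zero _).2 this]
    exact zero_mem _
  have h := edgeProd_mem_treeSpan_univ R (isEdgeSystem_edgeClass (R := R)) hΓ
  rw [← graphClass_eq_edgeProd] at h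
  set V := Submodule.span R {x | ∃ G : RGraph X, G.IsArb ∧ G.verts = Finset.univ ∧
    x = (eilRelations R X).mkQ (gr R G.orientedCopy)} with hV
  have zero_of : ∀ x ∈ edgeIdeal R X, (eilRelations R X).mkQ x.coeff ∈ V := by
    intro x hx
    have := coeff_mem_of_mem_edgeIdeal hx
    rw [Submodule.mkQ_apply, (Submodule.Quotient.mk_eq_zero _).2 this]
    exact zero_mem _
  -- membership in `V` may be checked on any representative of a class in the ring of graphs
  have key : ∀ z ∈ treeSpan R (edgeClass R (X := X)) Finset.univ,
      ∀ x, Ideal.Quotient.mk (edgeIdeal R X) x = z → (eilRelations R X).mkQ x.coeff ∈ V := by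
    intro z hz
    induction hz using Submodule.span_induction with
    | mem z hz =>
      obtain ⟨G, hG, hv, rfl⟩ := hz
      intro x hx
      rw [← graphClass_eq_edgeProd, graphClass, Ideal.Quotient.mk_eq_mk_iff_sub_mem] at hx
      have h1 := zero_of _ hx
      have h2 : (eilRelations R X).mkQ (gr R G.orientedCopy) ∈ V :=
        Submodule.subset_span ⟨G, hG, hv, rfl⟩
      rw [AddMonoidAlgebra.coeff_sub, map_sub, AddMonoidAlgebra.coeff_single] at h1
      simpa [gr] using add_mem h1 h2
    | zero =>
      intro x hx
      exact zero_of x (Ideal.Quotient.eq_zero_iff_mem.1 hx)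
    | add z z' _ _ hz hz' =>
      intro x hx
      obtain ⟨y, hy⟩ := Ideal.Quotient.mk_surjective z
      have := hz' (x - y) (by rw [map_sub, hx, hy, add_sub_cancel_left])
      rw [AddMonoidAlgebra.coeff_sub, map_sub] at this
      simpa using add_mem this (hz y hy)
    | smul r z _ hz =>
      intro x hx
      obtain ⟨y, hy⟩ := Ideal.Quotient.mk_surjective z
      have := zero_of (x - r • y) (by
        rw [← Ideal.Quotient.mk_eq_mk_iff_sub_mem, hx, ← hy]
        rfl)
      rw [AddMonoidAlgebra.coeff_sub, map_sub, AddMonoidAlgebra.coeff_smul, map_smul] at this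
      simpa using add_mem this (V.smul_mem r (hz y hy))
  exact key _ h _ rfl

end Connected

end

/-! ### Perfect pairings from triangular matrices -/

section

open RGraph

section LinearAlgebra

variable {R : Type*} [CommRing R] {ι : Type*} [Fintype ι]

open Classical in
theorem isUnit_det_of_partialOrder (r : ι → ι → Prop) [IsPartialOrder ι r] (M : Matrix ι ι R)
    (zero : ∀ i j, ¬ r i j → M i j = 0) (unit : ∀ i, IsUnit (M i i)) : IsUnit M.det := by
  obtain ⟨s, hs, hrs⟩ := extend_partialOrder r
  let _ : LinearOrder ι :=
    { le := s
      le_refl := hs.refl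
      le_trans := hs.trans
      le_antisymm := hs.antisymm
      le_total := hs.total
      toDecidableLE := Classical.decRel _ }
  have hM : M.IsUpperTriangular := fun i j hij => zero i j fun h => (not_le_of_gt hij) (hrs _ _ h)
  have hu : IsUnit (∏ i, M i i) := IsUnit.prod_iff.2 fun i _ => unit i
  rw [← Matrix.det_of_isUpperTriangular hM] at hu
  convert hu

variable {M N : Type*} [AddCommGroup M] [Module R M] [AddCommGroup N] [Module R N]

open Classical in
/-- A pairing of two spanning families with an invertible matrix identifies the first module with the
dual of the second one. -/
theorem bijective_of_isUnit_det (B : M →ₗ[R] N →ₗ[R] R) {v : ι → M} {w : ι → N}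
    (hv : Submodule.span R (Set.range v) = ⊤) (hw : Submodule.span R (Set.range w) = ⊤)
    (h : IsUnit (Matrix.of fun i j => B (v j) (w i)).det) : Function.Bijective B := by
  set P : Matrix ι ι R := Matrix.of fun i j => B (v j) (w i) with hP
  have apply_sum : ∀ a : ι → R, ∀ i, B (∑ j, a j • v j) (w i) = P.mulVec a i := by
    intro a i
    simp [hP, Matrix.mulVec, dotProduct, mul_comm]
  constructor
  · rw [← LinearMap.ker_eq_bot, Submodule.eq_bot_iff]
    intro x hx
    obtain ⟨a, rfl⟩ := (Submodule.mem_span_range_iff_exists_fun R).1 (hv ▸ Submodule.mem_top (x := x))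
    have : P.mulVec a = P.mulVec 0 := by
      funext i
      rw [← apply_sum, LinearMap.mem_ker.1 hx, Matrix.mulVec_zero]
      rfl
    rw [Matrix.mulVec_injective_of_isUnit ((Matrix.isUnit_iff_isUnit_det P).2 h) this]
    simp
  · intro f
    refine ⟨∑ j, (P⁻¹.mulVec fun i => f (w i)) j • v j, ?_⟩
    refine LinearMap.ext_on_range hw fun i => ?_
    rw [apply_sum, Matrix.mulVec_mulVec, Matrix.mul_nonsing_inv P h, Matrix.one_mulVec]

theorem isPerfPair_of_partialOrder (B : M →ₗ[R] N →ₗ[R] R) {v : ι → M} {w : ι → N}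
    (hv : Submodule.span R (Set.range v) = ⊤) (hw : Submodule.span R (Set.range w) = ⊤)
    (r : ι → ι → Prop) [IsPartialOrder ι r] (zero : ∀ i j, ¬ r i j → B (v j) (w i) = 0)
    (unit : ∀ i, IsUnit (B (v i) (w i))) : B.IsPerfPair := by
  classical
  have h := isUnit_det_of_partialOrder r (Matrix.of fun i j => B (v j) (w i)) zero unit
  refine ⟨bijective_of_isUnit_det B hv hw h, bijective_of_isUnit_det B.flip hw hv ?_⟩
  rw [← Matrix.det_transpose]
  exact h

end LinearAlgebra

/-! ### The induced pairing -/

section Induced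

variable (R : Type*) [CommRing R] {n : ℕ}

instance : Finite (GBar n) := by
  refine Finite.of_injective (fun G : GBar n => (G.1.verts, G.1.root, G.1.edges)) fun G H h => ?_
  simp only [Prod.mk.injEq] at h
  exact Subtype.ext (RGraph.ext h.1 h.2.1 h.2.2)

/-- The monomial `b_G`, as a multilinear tree. -/
noncomputable def basisTree (G : GBar n) : BT n :=
  ⟨G.1.bMonomial, G.2.1.isArb.bMonomial_spec.1, fun x => by
    rw [← List.mem_toFinset, ← BTree.verts_toRGraph, G.2.1.isArb.bMonomial_spec.2, G.2.2]
    exact Finset.mem_univ x⟩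

theorem toRGraph_basisTree (G : GBar n) : (basisTree G).1.toRGraph = G.1 :=
  G.2.1.isArb.bMonomial_spec.2

theorem pairing_basisTree_eq_zero {G H : GBar n} (h : ¬ LeOp G H) :
    pairing R G.1.orientedCopy (basisTree H).1 = 0 := by
  refine BTree.pairing_eq_zero_of_notMem R (basisTree H).2 fun hm => h (leOp_iff.2 ?_)
  rw [← toRGraph_basisTree H]
  refine BTree.le_toRGraph_of_mem_matchings _ (basisTree H).2.1 G.2.1.isArb ?_ hm
  rw [← BTree.verts_toRGraph, toRGraph_basisTree, G.2.2, H.2.2]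

theorem pairing_basisTree_self (G : GBar n) :
    pairing R G.1.orientedCopy (basisTree G).1 = 1 ∨
      pairing R G.1.orientedCopy (basisTree G).1 = -1 := by
  refine BTree.pairing_of_mem R (basisTree G).2 ?_
  have := BTree.orientedCopy_mem_matchings _ (basisTree G).2.1
  rwa [toRGraph_basisTree] at this

theorem span_lieClass_basisTree :
    Submodule.span R (Set.range fun G : GBar n => lieClass R (basisTree G)) = ⊤ := by
  refine Submodule.map_injective_of_injective (multilinearPart R (Fin n)).subtype_injective ?_
  rw [Submodule.map_top, Submodule.range_subtype, Submodule.map_span]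
  refine le_antisymm (Submodule.span_le.2 ?_) (Submodule.span_le.2 ?_)
  · rintro _ ⟨_, ⟨G, rfl⟩, rfl⟩
    exact (lieClass R (basisTree G)).2
  · rintro _ ⟨T, hT, rfl⟩
    refine Submodule.span_mono ?_ (monomial_mem_span hT.1)
    rintro _ ⟨H, hH, hv, rfl⟩
    refine ⟨_, ⟨⟨H, hH.isAvoidingTree, ?_⟩, rfl⟩, rfl⟩
    rw [hv, BTree.verts_toRGraph]
    ext x
    simp [hT.2 x]

theorem span_eilClass_orientedCopy :
    Submodule.span R (Set.range fun G : GBar n => eilClass R G.1.orientedCopy) = ⊤ := by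
  have hgr : Submodule.span R (Set.range fun Γ : OGraph (Fin n) => eilClass R Γ) = ⊤ := by
    have h1 : Submodule.span R (Set.range fun Γ : OGraph (Fin n) => gr R Γ) = ⊤ := by
      rw [← Finsupp.range_linearCombination, LinearMap.range_eq_top]
      intro x
      exact ⟨x, by simp [gr, Finsupp.linearCombination_apply]⟩
    have h2 := congrArg (Submodule.map (eilRelations R (Fin n)).mkQ) h1
    rw [Submodule.map_span, Submodule.map_top, Submodule.range_mkQ, ← Set.range_comp] at h2
    exact h2
  rw [eq_top_iff, ← hgr]
  refine Submodule.span_le.2 ?_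
  rintro _ ⟨Γ, rfl⟩
  refine Submodule.span_mono ?_ (mkQ_gr_mem_span R Γ)
  rintro _ ⟨G, hG, hv, rfl⟩
  exact ⟨⟨G, hG.isAvoidingTree, hv⟩, rfl⟩

/-- The pairing with multilinear elements, as a linear map on the free module on graphs. -/
noncomputable def gamPairing : Gam R (Fin n) →ₗ[R] Lie2 R n →ₗ[R] R :=
  Finsupp.linearCombination R fun G =>
    liePairingForm G ∘ₗ (multilinearPart R (Fin n)).subtype

theorem gamPairing_lieClass (x : Gam R (Fin n)) (T : BT n) :
    gamPairing R x (lieClass R T) = pairingForm R T.1 x := by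
  induction x using Finsupp.induction_linear with
  | zero => simp
  | add x y hx hy => rw [map_add, LinearMap.add_apply, hx, hy, map_add]
  | single G r =>
    have h1 : gamPairing R (Finsupp.single G r) (lieClass R T) =
        r • liePairingForm G (monomial R (Fin n) T.1) := by
      rw [gamPairing, Finsupp.linearCombination_single]
      rfl
    have h2 : (Finsupp.single G r : Gam R (Fin n)) = r • gr R G := by
      rw [gr, Finsupp.smul_single, smul_eq_mul, mul_one]
    rw [h1, h2, liePairingForm_monomial T.2, map_smul, pairingForm_gr]

theorem eilRelations_le_ker_gamPairing :
    eilRelations R (Fin n) ≤ LinearMap.ker (gamPairing R (n := n)) := by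
  intro x hx
  refine LinearMap.ext_on_range (span_lieClass_basisTree R) fun G => ?_
  rw [gamPairing_lieClass]
  exact eilRelations_le_ker_pairingForm (basisTree G).2 hx

/-- The bilinear form induced by the pairing of graphs and trees. -/
noncomputable def inducedPairing : Lie2 R n →ₗ[R] Eil2 R n →ₗ[R] R :=
  ((eilRelations R (Fin n)).liftQ (gamPairing R) (eilRelations_le_ker_gamPairing R)).flip

theorem isInducedPairing_inducedPairing : IsInducedPairing (inducedPairing R (n := n)) := by
  intro T G
  rw [inducedPairing, LinearMap.flip_apply, eilClass, Submodule.mkQ_apply, Submodule.liftQ_apply,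
    gamPairing_lieClass, pairingForm_gr]

variable {R}

theorem IsInducedPairing.unique {B B' : Lie2 R n →ₗ[R] Eil2 R n →ₗ[R] R} (h : IsInducedPairing B)
    (h' : IsInducedPairing B') : B = B' := by
  refine LinearMap.ext_on_range (span_lieClass_basisTree R) fun G => ?_
  refine LinearMap.ext_on_range (span_eilClass_orientedCopy R) fun H => ?_
  rw [h, h']

theorem IsInducedPairing.isPerfPair {B : Lie2 R n →ₗ[R] Eil2 R n →ₗ[R] R}
    (h : IsInducedPairing B) : B.IsPerfPair := by
  have := Fintype.ofFinite (GBar n)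
  have := isPartialOrder_leOp (n := n)
  refine isPerfPair_of_partialOrder B (span_lieClass_basisTree R) (span_eilClass_orientedCopy R)
    LeOp (fun G H hGH => ?_) fun G => ?_
  · rw [h, pairing_basisTree_eq_zero R hGH]
  · rw [h]
    rcases pairing_basisTree_self R G with e | e <;> rw [e]
    exacts [isUnit_one, isUnit_one.neg]

end Induced

end

end TwoBracket

theorem mainTheorem3 (R : Type*) [CommRing R] (n : ℕ) :
    (∃! B : TwoBracket.Lie2 R n →ₗ[R] TwoBracket.Eil2 R n →ₗ[R] R,
      TwoBracket.IsInducedPairing B) ∧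
    (∀ B : TwoBracket.Lie2 R n →ₗ[R] TwoBracket.Eil2 R n →ₗ[R] R,
      TwoBracket.IsInducedPairing B → B.IsPerfPair) ∧
    IsPartialOrder (TwoBracket.GBar n) TwoBracket.LeOp ∧
    ∃ b : TwoBracket.GBar n → TwoBracket.BT n, (∀ G, (b G).1 = G.1.bMonomial) ∧
      ∀ B : TwoBracket.Lie2 R n →ₗ[R] TwoBracket.Eil2 R n →ₗ[R] R,
        TwoBracket.IsInducedPairing B →
        ∀ L : LinearOrder (TwoBracket.GBar n), (∀ G H, TwoBracket.LeOp G H → L.le G H) →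
          (∀ G H, L.lt H G → B (TwoBracket.lieClass R (b H))
            (TwoBracket.eilClass R G.1.orientedCopy) = 0) ∧
          (∀ G, B (TwoBracket.lieClass R (b G)) (TwoBracket.eilClass R G.1.orientedCopy) = 1 ∨
            B (TwoBracket.lieClass R (b G)) (TwoBracket.eilClass R G.1.orientedCopy) = -1) := by
  refine ⟨⟨TwoBracket.inducedPairing R, TwoBracket.isInducedPairing_inducedPairing R,
    fun B hB => hB.unique (TwoBracket.isInducedPairing_inducedPairing R)⟩,
    fun B hB => hB.isPerfPair, TwoBracket.isPartialOrder_leOp,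
    TwoBracket.basisTree, fun G => rfl, fun B hB L hL => ⟨fun G H hlt => ?_, fun G => ?_⟩⟩
  · rw [hB]
    exact TwoBracket.pairing_basisTree_eq_zero R fun h =>
      (L.lt_iff_le_not_ge H G |>.1 hlt).2 (hL G H h)
  · rw [hB]
    exact TwoBracket.pairing_basisTree_self R G
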